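/- **Setting.** Let $\mathcal X$ be a measurable space, $\mathcal Y=\{1,\dots,k\}$, $\mathcal D_X$ a probability distribution on $\mathcal X$, and $\mathbb C$ a nonempty set of measurable classifiers $h:\mathcal X\to\mathcal Y$. Its *Natarajan dimension* is the largest $m$ for which there are $(a_1,b_1,c_1),\dots,(a_m,b_m,c_m)\in\mathcal X\times\mathcal Y\times\mathcal Y$ with $b_i\ne c_i$ and $\{b_1,c_1\}\times\cdots\times\{b_m,c_m\}\subseteq\{(h(a_1),\dots,h(a_m)):h\in\mathbb C\}$. For a distribution $\mathcal D_{XY}$ on $\mathcal X\times\mathcal Y$ let $\mathrm{err}(h)=\mathbb P(h(X)\neq Y)$ and $\eta=\inf_{h\in\mathbb C}\mathrm{err}(h)$. Let $\mathrm{BN}(\mathbb C,\alpha;\mathcal D_X)$ be the set of all $\mathcal D_{XY}$ with marginal $\mathcal D_X$ on $\mathcal X$ such that, for some $h^*\in\mathbb C$, $\mathbb P(Y\ne h^*(X)\mid X)\le\alpha$ almost surely. **Query complexity.** Let $(x_1,y_1),(x_2,y_2),\dots$ be i.i.d. from $\mathcal D_{XY}$. A (possibly randomized) active learning algorithm has access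 to $x_1,x_2,\dots$; it may adaptively request labels $y_i$ of examples $x_i$ of its choice, and it may halt and return a classifier, each action being taken after reading finitely many of the $x_i$. $\mathrm{QC}_{\mathrm{AL}}(\epsilon,\delta,\mathbb C,\mathrm{BN}(\mathbb C,\alpha;\mathcal D_X))\in\{0,1,2,\dots,\infty\}$ is the least $q$ for which there is such an algorithm that, for every $\mathcal D_{XY}\in\mathrm{BN}(\mathbb C,\alpha;\mathcal D_X)$, with probability at least $1-\delta$ makes at most $q$ label requests and then returns some $\hat h$ with $\mathrm{err}(\hat h)\le\eta+\epsilon$. **Splitting index.** For a finite set $Q$ of unordered pairs of classifiers let $Q_x^y=\{\{h,g\}\in Q:h(x)=g(x)=y\}$; the point $x$ *$\rho$-splits* $Q$ if $\max_{y}|Q_x^y|\le(1-\rho)|Q|$. A set $\mathcal H\subseteq\mathbb C$ is *$(\rho,\Delta,\tau)$-splittable* if every finite set $Q$ of pairs $\{h,g\}\subseteq\mathcal H$ with $\mathbb P_{\mathcal D_X}(h(x)\ne g(x))>\Delta$ satisfies $\mathbb P_{\mathcal D_X}(x:\ x\ \rho\text{-splits }Q)\ge\tau$. With $B(h,r)=\{g\in\mathbb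 C:\mathbb P_{\mathcal D_X}(h(x)\ne g(x))\le r\}$, put $$\rho_{h,\tau}(\epsilon)=\sup\{\rho\ge 0:\ \forall\Delta\ge\epsilon/2,\ B(h,4\Delta)\text{ is }(\rho,\Delta,\tau)\text{-splittable}\}\in[0,\infty],\qquad \rho_\tau(\epsilon)=\inf_{h\in\mathbb C}\rho_{h,\tau}(\epsilon).$$ **Lemma.** There is a universal constant $c_1\in(0,\infty)$ and, for every number of labels $k$, a constant $c_2\in(0,\infty)$ depending only on $k$, such that for all $\mathcal X$, $\mathcal D_X$ and $\mathbb C$ as above with $\mathbb C$ of finite Natarajan dimension $d$, all $\alpha\in[0,1/2)$ and all $\epsilon,\delta\in(0,1/16)$, $$\inf_{0<\tau\le1}\frac{c_1}{\rho_\tau(4\epsilon)}\ \le\ \mathrm{QC}_{\mathrm{AL}}\bigl(\epsilon,\delta,\mathbb C,\mathrm{BN}(\mathbb C,\alpha;\mathcal D_X)\bigr)\ \le\ \inf_{0<\tau\le1}\frac{c_2\,d^3}{(1-2\alpha)^2\,\rho_\tau(\epsilon)}\,\log^5\!\left(\frac1{\epsilon\,\delta\,\tau\,(1-2\alpha)}\right),$$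 with the conventions $c/\infty=0$ for $0\le c<\infty$ and $c/0=\infty$ for $0<c<\infty$. -/

import Mathlib

open MeasureTheory ProbabilityTheory
open scoped ENNReal NNReal

noncomputable section

namespace ActiveLearning

/-! Instances come from a measurable space `X`; the label space is `Fin k`. A classifier is a map
`X → Fin k` and a hypothesis class is a set of classifiers. -/

/-- Natarajan shattering of some `m` points: points `a i` and label pairs `b i ≠ c i` such that
every choice of one label from each pair is realized by some member of the class. -/
def NatarajanShatters {X : Type*} {k : ℕ} (C : Set (X → Fin k)) (m : ℕ) : Prop :=
  ∃ (a : Fin m → X) (b c : Fin m → Fin k), (∀ i, b i ≠ c i) ∧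
    ∀ s : Fin m → Bool, ∃ h ∈ C, ∀ i, h (a i) = if s i then b i else c i

/-- The Natarajan dimension (`⊤` if arbitrarily many points can be shattered). -/
def natarajanDim {X : Type*} {k : ℕ} (C : Set (X → Fin k)) : ℕ∞ :=
  ⨆ (m : ℕ) (_ : NatarajanShatters C m), (m : ℕ∞)

/-- The error rate `P(h(X) ≠ Y)`. -/
def err {X : Type*} [MeasurableSpace X] {k : ℕ} (D : ProbabilityMeasure (X × Fin k))
    (h : X → Fin k) : ℝ≥0∞ :=
  (D : Measure (X × Fin k)) {p | h p.1 ≠ p.2}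

/-- The noise rate: the smallest error rate in the class. -/
def noiseRate {X : Type*} [MeasurableSpace X] {k : ℕ} (C : Set (X → Fin k))
    (D : ProbabilityMeasure (X × Fin k)) : ℝ≥0∞ :=
  ⨅ h ∈ C, err D h

/-- The bounded noise family with marginal `μ`: for some `h` in the class, almost surely
`P(Y ≠ h(X) | X) ≤ α`. -/
def BN {X : Type*} [MeasurableSpace X] {k : ℕ} (C : Set (X → Fin k)) (α : ℝ)
    (μ : Measure X) : Set (ProbabilityMeasure (X × Fin k)) :=
  {D | (D : Measure (X × Fin k)).map Prod.fst = μ ∧ ∃ h ∈ C,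
    ((D : Measure (X × Fin k))⟦{p | p.2 ≠ h p.1} | MeasurableSpace.comap Prod.fst inferInstance⟧)
      ≤ᵐ[(D : Measure (X × Fin k))] fun _ => α}

/-- What an active learner can do next: request the label of the `i`-th example, or halt and
return a classifier. -/
inductive Action (X : Type*) (k : ℕ)
  | request (i : ℕ) : Action X k
  | output (h : X → Fin k) : Action X k

/-- A (possibly randomized) active learning algorithm. The next action is determined by the
internal randomness (uniform on `[0,1]`), the sequence of unlabeled examples, and the list of the
requests made so far with the labels received. The value `none` means that the algorithm goes on
reading unlabeled examples for ever without acting; an action is only taken on the basis of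
finitely many unlabeled examples. -/
structure Algorithm (X : Type*) [MeasurableSpace X] (k : ℕ) where
  step : unitInterval → (ℕ → X) → List (ℕ × Fin k) → Option (Action X k)
  finite_use : ∀ ω x l a, step ω x l = some a →
    ∃ n : ℕ, ∀ x' : ℕ → X, (∀ i < n, x' i = x i) → step ω x' l = some a
  measurable_request : ∀ l i,
    MeasurableSet {p : unitInterval × (ℕ → X) | step p.1 p.2 l = some (Action.request i)}
  measurable_output : ∀ l (y : Fin k),
    MeasurableSet {p : (unitInterval × (ℕ → X)) × X |
      ∃ h, step p.1.1 p.1.2 l = some (Action.output h) ∧ h p.2 = y}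

/-- The requests made and labels received within the first `t` label requests, when the labeled
examples are `s 0, s 1, …`. It stays constant once the algorithm makes no further request. -/
def Algorithm.transcript {X : Type*} [MeasurableSpace X] {k : ℕ} (A : Algorithm X k)
    (ω : unitInterval) (s : ℕ → X × Fin k) : ℕ → List (ℕ × Fin k)
  | 0 => []
  | t + 1 =>
    match A.step ω (fun i => (s i).1) (A.transcript ω s t) with
    | some (Action.request i) => A.transcript ω s t ++ [(i, (s i).2)]
    | _ => A.transcript ω s t

/-- After at most `q` label requests the algorithm halts and returns a classifier `h` with `P h`. -/
def Algorithm.Succeeds {X : Type*} [MeasurableSpace X] {k : ℕ} (A : Algorithm X k) (q : ℕ)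
    (P : (X → Fin k) → Prop) (ω : unitInterval) (s : ℕ → X × Fin k) : Prop :=
  ∃ t ≤ q, ∃ h, A.step ω (fun i => (s i).1) (A.transcript ω s t) = some (Action.output h) ∧ P h

/-- The query complexity of active learning by label requests: the least `q` for which some
algorithm, for every `D` in the family, run on i.i.d. examples from `D`, with probability at least
`1 - δ` makes at most `q` label requests and then returns a classifier of error at most the noise
rate plus `ε`. It is `⊤` if there is no such `q`. -/
def QCAL {X : Type*} [MeasurableSpace X] {k : ℕ} (ε δ : ℝ) (C : Set (X → Fin k))
    (F : Set (ProbabilityMeasure (X × Fin k))) : ℕ∞ :=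
  ⨅ (q : ℕ) (_ : ∃ A : Algorithm X k, ∀ D ∈ F,
      ENNReal.ofReal (1 - δ) ≤
        ((volume : Measure unitInterval).prod
          (Measure.infinitePi fun _ : ℕ => (D : Measure (X × Fin k))))
          {z | A.Succeeds q (fun h => err D h ≤ noiseRate C D + ENNReal.ofReal ε) z.1 z.2}),
    (q : ℕ∞)

/-- `Q_x^y`: the pairs in `Q` both of whose members give `x` the label `y`. -/
def pairsAgreeing {X : Type*} {k : ℕ} (Q : Finset (Sym2 (X → Fin k))) (x : X) (y : Fin k) :
    Finset (Sym2 (X → Fin k)) :=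
  open Classical in Q.filter fun p => ∀ h ∈ p, h x = y

/-- The point `x` `ρ`-splits `Q`. -/
def RhoSplits {X : Type*} {k : ℕ} (ρ : ℝ) (Q : Finset (Sym2 (X → Fin k))) (x : X) : Prop :=
  ∀ y, ((pairsAgreeing Q x y).card : ℝ) ≤ (1 - ρ) * Q.card

/-- `H` is `(ρ, Δ, τ)`-splittable under `μ`. -/
def Splittable {X : Type*} [MeasurableSpace X] {k : ℕ} (μ : Measure X) (H : Set (X → Fin k))
    (ρ Δ τ : ℝ) : Prop :=
  ∀ Q : Finset (Sym2 (X → Fin k)),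
    (∀ h g, s(h, g) ∈ Q → h ∈ H ∧ g ∈ H ∧ Δ < μ.real {x | h x ≠ g x}) →
      τ ≤ μ.real {x | RhoSplits ρ Q x}

/-- The closed ball `B(h, r)` in the class, for the pseudometric `P(h(X) ≠ g(X))`. -/
def ball {X : Type*} [MeasurableSpace X] {k : ℕ} (μ : Measure X) (C : Set (X → Fin k))
    (h : X → Fin k) (r : ℝ) : Set (X → Fin k) :=
  {g ∈ C | μ.real {x | h x ≠ g x} ≤ r}

/-- The splitting index `ρ_{h,τ}(ε)`, a supremum in `[0, ∞]`. -/
def splittingIndexAt {X : Type*} [MeasurableSpace X] {k : ℕ} (μ : Measure X)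
    (C : Set (X → Fin k)) (h : X → Fin k) (τ ε : ℝ) : ℝ≥0∞ :=
  ⨆ (ρ : ℝ≥0) (_ : ∀ Δ : ℝ, ε / 2 ≤ Δ → Splittable μ (ball μ C h (4 * Δ)) ρ Δ τ), (ρ : ℝ≥0∞)

/-- The worst-case splitting index `ρ_τ(ε)`. -/
def splittingIndex {X : Type*} [MeasurableSpace X] {k : ℕ} (μ : Measure X)
    (C : Set (X → Fin k)) (τ ε : ℝ) : ℝ≥0∞ :=
  ⨅ h ∈ C, splittingIndexAt μ C h τ ε

end ActiveLearning

end

open MeasureTheory ProbabilityTheory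
open scoped ENNReal NNReal

noncomputable section

set_option linter.unusedSectionVars false

namespace ActiveLearning

/-! ### Transcripts: halting, measurability and dependence on labels -/

section Transcripts

variable {X : Type*} [MeasurableSpace X] {k : ℕ}

/-! Lower bound (`exists_le_of_learns`). Noise-free laws belong to every bounded noise family, so it
is enough to defeat an algorithm with `q` requests on those. For some horizon `M`, with probability
above `7/8` all requests fall among the first `M` examples, whatever the labels are. If `q < (1/2) /
ρ_τ(4ε)` for `τ = 1/(8(M+1))`, then some `ρ` with `qρ ≤ 1/2` admits a finite set `Q` of pairs more
than `2ε` apart whose `ρ`-splitting points have mass below `τ`; with probability above `3/4` the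
horizon also holds and no splitting point precedes it. An adversary that always answers with the
label on which most pairs agree loses at most `ρ|Q|` pairs per request, so half of `Q` survives.
Both members of a surviving pair produce the same transcript and the same output, which is wrong for
one of them. Averaging over `Q` contradicts `δ < 1/16`.

Upper bound (`QCAL_le_of_cover`). The class is replaced by a finite `r`-cover inside it, whose size
is controlled by Natarajan's counting bound and a packing argument (`exists_finite_cover`). On the
cover, splitting is a game (`Solvable`): a splitting point removes a fraction `ρ` of the far pairs
whatever the answer, so about `log |V| / ρ` rounds divide the diameter by four (`solvable_add`), and
about `log(1/ε)` such phases reach diameter `ε/2` (`solvable_mul`).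

Noise is handled by voting. The label of a single example cannot be resampled, so the learner waits
for further examples on which every candidate predicts as at the chosen point, and takes a majority
of their labels. Let `t` be a candidate within `r` of the target and `γ = 1 - 2α`. A pattern can
mislead the vote only if `t` and the target differ on a fraction at least `γ/4` of it, so misleading
patterns have total mass at most `4r/γ` (`measure_not_reliablePattern_le`). One supermartingale,
`votingPotential`, bounds the probability of ever losing `t`.

The parameters are circular: `r` must be small compared with the number of rounds, which grows with
`log(1/r)`. The dependence is only logarithmic, so a constant depending on `k` closes the loop
(`exists_packing_scale`). Since every pair at distance more than `Δ` is already separated by a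
random point with probability more than `Δ`, `ρ` may be taken at least `ε/4` (`splittable_half`),
which keeps the number of rounds polynomially bounded. -/

theorem Algorithm.transcript_succ (A : Algorithm X k) (ω : unitInterval) (s : ℕ → X × Fin k)
    (t : ℕ) : A.transcript ω s (t + 1) =
      match A.step ω (fun i => (s i).1) (A.transcript ω s t) with
      | some (Action.request i) => A.transcript ω s t ++ [(i, (s i).2)]
      | _ => A.transcript ω s t := rfl

/-- Once the algorithm has halted, the transcript no longer changes. -/
theorem Algorithm.transcript_eq_of_output (A : Algorithm X k) {ω : unitInterval}
    {s : ℕ → X × Fin k} {t : ℕ} {h : X → Fin k}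
    (ht : A.step ω (fun i => (s i).1) (A.transcript ω s t) = some (Action.output h)) (n : ℕ) :
    A.transcript ω s (t + n) = A.transcript ω s t := by
  induction n with
  | zero => rfl
  | succ n ih => rw [← add_assoc, A.transcript_succ, ih, ht]

/-- The transcript is frozen after halting, so success can be read off at time `q` alone. -/
theorem Algorithm.succeeds_iff (A : Algorithm X k) (q : ℕ) (P : (X → Fin k) → Prop)
    (ω : unitInterval) (s : ℕ → X × Fin k) :
    A.Succeeds q P ω s ↔ ∃ h, A.step ω (fun i => (s i).1) (A.transcript ω s q) =
      some (Action.output h) ∧ P h := by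
  constructor
  · rintro ⟨t, htq, h, hs, hP⟩
    obtain ⟨n, rfl⟩ := Nat.exists_eq_add_of_le htq
    exact ⟨h, by rw [A.transcript_eq_of_output hs, hs], hP⟩
  · rintro ⟨h, hs, hP⟩
    exact ⟨q, le_rfl, h, hs, hP⟩

theorem Algorithm.length_transcript_le (A : Algorithm X k) (ω : unitInterval)
    (s : ℕ → X × Fin k) (t : ℕ) : (A.transcript ω s t).length ≤ t := by
  induction t with
  | zero => simp [Algorithm.transcript]
  | succ t ih =>
    rw [A.transcript_succ]
    split
    · simpa using ih
    · omega

theorem Algorithm.measurable_unlabeled :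
    Measurable fun z : unitInterval × (ℕ → X × Fin k) =>
      ((z.1, fun i => (z.2 i).1) : unitInterval × (ℕ → X)) := by
  fun_prop

theorem Algorithm.measurableSet_transcript (A : Algorithm X k) (t : ℕ)
    (l : List (ℕ × Fin k)) :
    MeasurableSet {z : unitInterval × (ℕ → X × Fin k) | A.transcript z.1 z.2 t = l} := by
  induction t generalizing l with
  | zero => exact MeasurableSet.const ([] = l)
  | succ t ih =>
    have hreq : ∀ l i, MeasurableSet {z : unitInterval × (ℕ → X × Fin k) |
        A.step z.1 (fun i => (z.2 i).1) l = some (Action.request i)} := fun l i =>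
      (A.measurable_request l i).preimage Algorithm.measurable_unlabeled
    have hlab : ∀ (i : ℕ) (y : Fin k), MeasurableSet {z : unitInterval × (ℕ → X × Fin k) |
        (z.2 i).2 = y} := fun i y =>
      (measurableSet_singleton y).preimage
        (f := fun z : unitInterval × (ℕ → X × Fin k) => (z.2 i).2) (by fun_prop)
    have : {z : unitInterval × (ℕ → X × Fin k) | A.transcript z.1 z.2 (t + 1) = l} =
        (⋃ (l' : List (ℕ × Fin k)) (i : ℕ) (y : Fin k) (_ : l = l' ++ [(i, y)]),
          {z | A.transcript z.1 z.2 t = l'} ∩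
            ({z | A.step z.1 (fun i => (z.2 i).1) l' = some (Action.request i)} ∩
              {z | (z.2 i).2 = y})) ∪
        ({z | A.transcript z.1 z.2 t = l} ∩
          ⋂ i, {z | A.step z.1 (fun i => (z.2 i).1) l = some (Action.request i)}ᶜ) := by
      ext z
      simp only [Set.mem_ofPred_eq, Set.mem_union, Set.mem_iUnion, Set.mem_inter_iff,
        Set.mem_iInter, Set.mem_compl_iff, exists_prop]
      rw [A.transcript_succ]
      constructor
      · intro h
        split at h
        · rename_i i hi
          exact Or.inl ⟨_, i, _, h.symm, rfl, hi, rfl⟩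
        · rename_i hi
          exact Or.inr ⟨h, fun i hi' => hi i (by rw [h, hi'])⟩
      · rintro (⟨l', i, y, rfl, rfl, hi, rfl⟩ | ⟨rfl, hi⟩)
        · rw [hi]
        · split
          · rename_i i hi'
            exact absurd hi' (hi i)
          · rfl
    rw [this]
    refine MeasurableSet.union ?_ ((ih l).inter (MeasurableSet.iInter fun i => (hreq l i).compl))
    exact MeasurableSet.iUnion fun l' => MeasurableSet.iUnion fun i => MeasurableSet.iUnion fun y =>
      MeasurableSet.iUnion fun _ => (ih l').inter ((hreq l' i).inter (hlab i y))

/-- The error of the returned classifier is the `D`-measure of a section of a jointly measurable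
set, hence measurable in the randomness and the data; no σ-algebra on classifiers is needed. -/
theorem Algorithm.measurableSet_step_output [Nonempty X] (A : Algorithm X k)
    (l : List (ℕ × Fin k)) (D : ProbabilityMeasure (X × Fin k)) (c : ℝ≥0∞) :
    MeasurableSet {p : unitInterval × (ℕ → X) |
      ∃ h, A.step p.1 p.2 l = some (Action.output h) ∧ err D h ≤ c} := by
  have hE : MeasurableSet {r : (unitInterval × (ℕ → X)) × (X × Fin k) |
      ∃ h, A.step r.1.1 r.1.2 l = some (Action.output h) ∧ h r.2.1 = r.2.2} := by
    have : {r : (unitInterval × (ℕ → X)) × (X × Fin k) |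
        ∃ h, A.step r.1.1 r.1.2 l = some (Action.output h) ∧ h r.2.1 = r.2.2} =
        ⋃ y : Fin k, ((fun r : (unitInterval × (ℕ → X)) × (X × Fin k) => (r.1, r.2.1)) ⁻¹'
          {p | ∃ h, A.step p.1.1 p.1.2 l = some (Action.output h) ∧ h p.2 = y}) ∩
          (fun r : (unitInterval × (ℕ → X)) × (X × Fin k) => r.2.2) ⁻¹' {y} := by
      ext r
      simp
    rw [this]
    exact MeasurableSet.iUnion fun y =>
      ((A.measurable_output l y).preimage (by fun_prop)).inter
        ((measurableSet_singleton y).preimage (by fun_prop))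
  have hx0 : MeasurableSet {p : unitInterval × (ℕ → X) |
      ∃ h, A.step p.1 p.2 l = some (Action.output h)} := by
    -- Halting is detected by evaluating the output at one fixed point, which receives some label.
    obtain ⟨x0⟩ := ‹Nonempty X›
    have : {p : unitInterval × (ℕ → X) | ∃ h, A.step p.1 p.2 l = some (Action.output h)} =
        ⋃ y : Fin k, (fun p : unitInterval × (ℕ → X) => (p, x0)) ⁻¹'
          {p | ∃ h, A.step p.1.1 p.1.2 l = some (Action.output h) ∧ h p.2 = y} := by
      ext p
      simp
    rw [this]
    exact MeasurableSet.iUnion fun y => (A.measurable_output l y).preimage (by fun_prop)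
  have : {p : unitInterval × (ℕ → X) |
      ∃ h, A.step p.1 p.2 l = some (Action.output h) ∧ err D h ≤ c} =
      {p | ∃ h, A.step p.1 p.2 l = some (Action.output h)} ∩
      {p | (D : Measure (X × Fin k)) (Prod.mk p ⁻¹' {r : (unitInterval × (ℕ → X)) × (X × Fin k) |
      ∃ h, A.step r.1.1 r.1.2 l = some (Action.output h) ∧ h r.2.1 = r.2.2}ᶜ) ≤ c} := by
    ext p
    simp only [Set.mem_ofPred_eq, Set.mem_inter_iff]
    have key : ∀ h, A.step p.1 p.2 l = some (Action.output h) →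
        (Prod.mk p ⁻¹' {r : (unitInterval × (ℕ → X)) × (X × Fin k) |
          ∃ h, A.step r.1.1 r.1.2 l = some (Action.output h) ∧ h r.2.1 = r.2.2}ᶜ) =
          {z : X × Fin k | h z.1 ≠ z.2} := by
      intro h hh
      ext z
      simp [hh]
    constructor
    · rintro ⟨h, hh, he⟩
      refine ⟨⟨h, hh⟩, ?_⟩
      rw [key h hh]
      exact he
    · rintro ⟨⟨h, hh⟩, he⟩
      rw [key h hh] at he
      exact ⟨h, hh, he⟩
  rw [this]
  exact hx0.inter (measurableSet_le (measurable_measure_prodMk_left hE.compl) measurable_const)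

theorem Algorithm.measurableSet_succeeds [Nonempty X] (A : Algorithm X k) (q : ℕ)
    (D : ProbabilityMeasure (X × Fin k)) (c : ℝ≥0∞) :
    MeasurableSet {z : unitInterval × (ℕ → X × Fin k) |
      A.Succeeds q (fun h => err D h ≤ c) z.1 z.2} := by
  have : {z : unitInterval × (ℕ → X × Fin k) |
      A.Succeeds q (fun h => err D h ≤ c) z.1 z.2} =
      ⋃ l : List (ℕ × Fin k), {z | A.transcript z.1 z.2 q = l} ∩
        (fun z : unitInterval × (ℕ → X × Fin k) =>
          ((z.1, fun i => (z.2 i).1) : unitInterval × (ℕ → X))) ⁻¹'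
        {p | ∃ h, A.step p.1 p.2 l = some (Action.output h) ∧ err D h ≤ c} := by
    ext z
    simp [A.succeeds_iff]
  rw [this]
  exact MeasurableSet.iUnion fun l => (A.measurableSet_transcript q l).inter
    ((A.measurableSet_step_output l D c).preimage Algorithm.measurable_unlabeled)

/-- For fixed unlabeled data, only finitely many transcripts arise, whatever the labels are. -/
theorem Algorithm.finite_transcripts (A : Algorithm X k) (ω : unitInterval) (x : ℕ → X)
    (t : ℕ) :
    (Set.range fun y : ℕ → Fin k => A.transcript ω (fun i => (x i, y i)) t).Finite := by
  induction t with
  | zero =>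
    refine (Set.finite_singleton ([] : List (ℕ × Fin k))).subset ?_
    rintro _ ⟨y, rfl⟩
    rfl
  | succ t ih =>
    have hfin := ih.biUnion fun l _ => (Set.finite_singleton l).union
      (Set.finite_range fun y : Fin k => match A.step ω x l with
        | some (Action.request i) => l ++ [(i, y)]
        | _ => l)
    refine hfin.subset ?_
    rintro _ ⟨y, rfl⟩
    simp only [Set.mem_iUnion]
    refine ⟨_, ⟨y, rfl⟩, ?_⟩
    dsimp only
    rw [A.transcript_succ]
    split
    · rename_i i hi
      right
      refine ⟨y i, ?_⟩
      dsimp only at hi ⊢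
      rw [hi]
    · left; rfl

/-- The bound is uniform in the labels, so that the adversary of the lower bound may choose labels
after the horizon `M` is fixed. -/
theorem Algorithm.exists_request_bound (A : Algorithm X k) (ω : unitInterval) (x : ℕ → X)
    (t : ℕ) : ∃ M : ℕ, ∀ y : ℕ → Fin k, ∀ e ∈ A.transcript ω (fun i => (x i, y i)) t, e.1 < M := by
  have hfin := (A.finite_transcripts ω x t).biUnion fun l _ => (List.finite_toSet l).image Prod.fst
  obtain ⟨M, hM⟩ := hfin.bddAbove
  refine ⟨M + 1, fun y e he => Nat.lt_succ_of_le (hM ?_)⟩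
  simp only [Set.mem_iUnion]
  exact ⟨_, ⟨y, rfl⟩, e, he, rfl⟩

/-- The transcript depends only on the labels that were requested. -/
theorem Algorithm.transcript_congr (A : Algorithm X k) {ω : unitInterval} {x : ℕ → X}
    {y y' : ℕ → Fin k} {q : ℕ}
    (h : ∀ e ∈ A.transcript ω (fun i => (x i, y i)) q, y' e.1 = y e.1) {t : ℕ} (ht : t ≤ q) :
    A.transcript ω (fun i => (x i, y' i)) t = A.transcript ω (fun i => (x i, y i)) t := by
  have mono : ∀ t n, A.transcript ω (fun i => (x i, y i)) t ⊆
      A.transcript ω (fun i => (x i, y i)) (t + n) := by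
    intro t n
    induction n with
    | zero => exact List.Subset.refl _
    | succ n ih =>
      refine fun e he => ?_
      have he := ih he
      rw [← add_assoc, A.transcript_succ]
      split
      · exact List.mem_append_left _ he
      · exact he
  induction t with
  | zero => rfl
  | succ t ih =>
    have ih := ih (by omega)
    have hsub := mono (t + 1) (q - (t + 1))
    rw [Nat.add_sub_cancel' ht] at hsub
    rw [A.transcript_succ] at hsub
    rw [A.transcript_succ, A.transcript_succ, ih]
    dsimp only at hsub ⊢
    generalize A.step ω x (A.transcript ω (fun i => (x i, y i)) t) = r at hsub ⊢
    match r with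
    | none => rfl
    | some (Action.output _) => rfl
    | some (Action.request i) =>
      dsimp only at hsub ⊢
      rw [h (i, y i) (hsub (by simp))]

end Transcripts

/-! ### Lower bound: noise-free laws and surviving pairs -/

section LowerBound

variable {X : Type*} [MeasurableSpace X] {k : ℕ}

theorem measurableSet_ne {h g : X → Fin k} (hh : Measurable h) (hg : Measurable g) :
    MeasurableSet {x | h x ≠ g x} :=
  (measurableSet_eq_fun hh hg).compl

/-- The noise-free distribution with marginal `μ` and target `g`. -/
def noiselessLaw (μ : Measure X) [IsProbabilityMeasure μ] (g : X → Fin k) (hg : Measurable g) :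
    ProbabilityMeasure (X × Fin k) :=
  ⟨μ.map fun x => (x, g x), Measure.isProbabilityMeasure_map (by fun_prop)⟩

variable (μ : Measure X) [IsProbabilityMeasure μ]

theorem err_noiselessLaw_self {g : X → Fin k} (hg : Measurable g) :
    err (noiselessLaw μ g hg) g = 0 := by
  have : MeasurableSet {p : X × Fin k | g p.1 ≠ p.2} :=
    (measurableSet_eq_fun (by fun_prop) (by fun_prop)).compl
  change (μ.map fun x => (x, g x)) {p : X × Fin k | g p.1 ≠ p.2} = 0
  rw [Measure.map_apply (by fun_prop) this]
  simp

theorem measure_ne_le_err_noiselessLaw {g : X → Fin k} (hg : Measurable g) (h : X → Fin k) :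
    μ {x | h x ≠ g x} ≤ err (noiselessLaw μ g hg) h :=
  Measure.le_map_apply (f := fun x => (x, g x)) (by fun_prop) {p : X × Fin k | h p.1 ≠ p.2}

theorem noiselessLaw_mem_BN {C : Set (X → Fin k)} {α : ℝ} (hα : 0 ≤ α) {g : X → Fin k}
    (hg : Measurable g) (hgC : g ∈ C) : noiselessLaw μ g hg ∈ BN C α μ := by
  have hcoe : ((noiselessLaw μ g hg : ProbabilityMeasure (X × Fin k)) : Measure (X × Fin k)) =
      μ.map fun x => (x, g x) := rfl
  refine ⟨?_, g, hgC, ?_⟩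
  · rw [hcoe, Measure.map_map measurable_fst (by fun_prop)]
    exact Measure.map_id
  · rw [hcoe]
    have h0 : ({p : X × Fin k | p.2 ≠ g p.1}.indicator fun _ => (1 : ℝ))
        =ᵐ[μ.map fun x => (x, g x)] 0 := by
      have : MeasurableSet {p : X × Fin k | ¬ p.2 ≠ g p.1} := by
        simpa using measurableSet_eq_fun (f := fun p : X × Fin k => p.2)
          (g := fun p => g p.1) (by fun_prop) (by fun_prop)
      have hae : ∀ᵐ p ∂(μ.map fun x => (x, g x)), ¬ p.2 ≠ g p.1 := by
        rw [ae_map_iff (by fun_prop) this]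
        simp
      filter_upwards [hae] with p hp
      exact Set.indicator_of_notMem hp _
    have := condExp_congr_ae (m := MeasurableSpace.comap Prod.fst inferInstance) h0
    rw [condExp_zero] at this
    filter_upwards [this] with p hp
    rw [hp]
    exact hα

open Classical in
-- A union bound: each entry of `l` eliminates at most `ρ|Q|` pairs, by inclusion-exclusion inside
-- `Q`.
theorem natCast_card_pairsAgreeing_inter {Q : Finset (Sym2 (X → Fin k))} {ρ : ℝ}
    (x : ℕ → X) (y : ℕ → Fin k) (l : List (ℕ × Fin k))
    (hl : ∀ e ∈ l, (1 - ρ) * Q.card ≤ (pairsAgreeing Q (x e.1) (y e.1)).card) :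
    (1 - l.length * ρ) * Q.card ≤
      (Q.filter fun p => ∀ e ∈ l, ∀ h ∈ p, h (x e.1) = y e.1).card := by
  induction l with
  | nil => simp
  | cons e l ih =>
    have ih := ih fun e' he' => hl e' (List.mem_cons_of_mem _ he')
    have he := hl e List.mem_cons_self
    have hunion := Finset.card_inter_add_card_union (pairsAgreeing Q (x e.1) (y e.1))
      (Q.filter fun p => ∀ e ∈ l, ∀ h ∈ p, h (x e.1) = y e.1)
    have hle : (pairsAgreeing Q (x e.1) (y e.1) ∪
        (Q.filter fun p => ∀ e ∈ l, ∀ h ∈ p, h (x e.1) = y e.1)).card ≤ Q.card :=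
      Finset.card_le_card (Finset.union_subset (Finset.filter_subset _ _)
        (Finset.filter_subset _ _))
    have hsub : (pairsAgreeing Q (x e.1) (y e.1) ∩
        (Q.filter fun p => ∀ e ∈ l, ∀ h ∈ p, h (x e.1) = y e.1)) ⊆
        (Q.filter fun p => ∀ e' ∈ e :: l, ∀ h ∈ p, h (x e'.1) = y e'.1) := by
      intro p hp
      simp only [pairsAgreeing, Finset.mem_inter, Finset.mem_filter, List.forall_mem_cons] at hp ⊢
      exact ⟨hp.1.1, hp.1.2, hp.2.2⟩
    have hsub := Finset.card_le_card hsub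
    have h1 : ((pairsAgreeing Q (x e.1) (y e.1) ∩
        (Q.filter fun p => ∀ e ∈ l, ∀ h ∈ p, h (x e.1) = y e.1)).card : ℝ) ≤
        (Q.filter fun p => ∀ e' ∈ e :: l, ∀ h ∈ p, h (x e'.1) = y e'.1).card := by
      exact_mod_cast hsub
    have h2 : ((pairsAgreeing Q (x e.1) (y e.1)).card : ℝ) +
        (Q.filter fun p => ∀ e ∈ l, ∀ h ∈ p, h (x e.1) = y e.1).card ≤
        (pairsAgreeing Q (x e.1) (y e.1) ∩
        (Q.filter fun p => ∀ e ∈ l, ∀ h ∈ p, h (x e.1) = y e.1)).card + Q.card := by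
      exact_mod_cast hunion.symm.le.trans (by omega)
    push_cast [List.length_cons]
    nlinarith

/-- Two targets more than `2ε` apart cannot both be learned from the same transcript. -/
theorem Algorithm.not_succeeds_of_transcript_eq (A : Algorithm X k) {C : Set (X → Fin k)} {ε : ℝ}
    (hε : 0 ≤ ε) {q : ℕ} {ω : unitInterval} {x : ℕ → X} {g g' : X → Fin k} (hg : Measurable g)
    (hg' : Measurable g') (hgC : g ∈ C) (hgC' : g' ∈ C)
    (hd : 2 * ε < μ.real {x | g x ≠ g' x})
    (ht : A.transcript ω (fun i => (x i, g (x i))) q =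
      A.transcript ω (fun i => (x i, g' (x i))) q)
    (h1 : A.Succeeds q (fun h => err (noiselessLaw μ g hg) h ≤
      noiseRate C (noiselessLaw μ g hg) + ENNReal.ofReal ε) ω (fun i => (x i, g (x i))))
    (h2 : A.Succeeds q (fun h => err (noiselessLaw μ g' hg') h ≤
      noiseRate C (noiselessLaw μ g' hg') + ENNReal.ofReal ε) ω (fun i => (x i, g' (x i)))) :
    False := by
  rw [A.succeeds_iff] at h1 h2
  obtain ⟨h, hs, he⟩ := h1
  obtain ⟨h', hs', he'⟩ := h2
  rw [ht] at hs
  obtain rfl : h = h' := by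
    have := hs.symm.trans hs'
    simpa using this
  have n0 : ∀ (f : X → Fin k) (hf : Measurable f), f ∈ C →
      noiseRate C (noiselessLaw μ f hf) = 0 := fun f hf hfC =>
    le_antisymm ((iInf₂_le f hfC).trans (err_noiselessLaw_self μ hf).le) zero_le
  rw [n0 g hg hgC, zero_add] at he
  rw [n0 g' hg' hgC', zero_add] at he'
  have a1 := (measure_ne_le_err_noiselessLaw μ hg h).trans he
  have a2 := (measure_ne_le_err_noiselessLaw μ hg' h).trans he'
  have hsub : {x | g x ≠ g' x} ⊆ {x | h x ≠ g x} ∪ {x | h x ≠ g' x} := by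
    intro x hx
    by_contra hcon
    simp only [Set.mem_union, Set.mem_ofPred_eq, not_or, not_not] at hcon
    exact hx (hcon.1.symm.trans hcon.2)
  have hle : μ {x | g x ≠ g' x} ≤ ENNReal.ofReal (2 * ε) := by
    refine (measure_mono hsub).trans ((measure_union_le _ _).trans ((add_le_add a1 a2).trans ?_))
    rw [← ENNReal.ofReal_add hε hε, two_mul]
  have := ENNReal.toReal_le_of_le_ofReal (by linarith) hle
  exact absurd hd (not_lt.mpr this)

/-- The distribution of a noise-free labeled sample. -/
theorem map_labels_infinitePi {g : X → Fin k} (hg : Measurable g) :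
    Measure.infinitePi (fun _ : ℕ => (noiselessLaw μ g hg : Measure (X × Fin k))) =
      (Measure.infinitePi fun _ : ℕ => μ).map fun x i => (x i, g (x i)) :=
  (Measure.infinitePi_map_pi (fun _ : ℕ => μ) (f := fun _ x => (x, g x))
    fun _ => by fun_prop).symm

/-- Transfers failure to the space of internal randomness and unlabeled data, where the failure
events of different targets can be compared. -/
theorem measure_fail_le [Nonempty X] (A : Algorithm X k) {δ : ℝ} {q : ℕ} {c : ℝ≥0∞}
    {g : X → Fin k} (hg : Measurable g)
    (h : ENNReal.ofReal (1 - δ) ≤ ((volume : Measure unitInterval).prod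
      (Measure.infinitePi fun _ : ℕ => (noiselessLaw μ g hg : Measure (X × Fin k))))
      {z | A.Succeeds q (fun h => err (noiselessLaw μ g hg) h ≤ c) z.1 z.2}) :
    MeasurableSet {p : unitInterval × (ℕ → X) | ¬ A.Succeeds q
      (fun h => err (noiselessLaw μ g hg) h ≤ c) p.1 (fun i => (p.2 i, g (p.2 i)))} ∧
    ((volume : Measure unitInterval).prod (Measure.infinitePi fun _ : ℕ => μ)).real
      {p | ¬ A.Succeeds q
      (fun h => err (noiselessLaw μ g hg) h ≤ c) p.1 (fun i => (p.2 i, g (p.2 i)))} ≤ δ := by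
  have hmeas : Measurable fun p : unitInterval × (ℕ → X) =>
      ((p.1, fun i => (p.2 i, g (p.2 i))) : unitInterval × (ℕ → X × Fin k)) := by fun_prop
  have hS := A.measurableSet_succeeds q (noiselessLaw μ g hg) c
  have hS' := hS.preimage hmeas
  refine ⟨hS'.compl, ?_⟩
  have hmap : (volume : Measure unitInterval).prod
      (Measure.infinitePi fun _ : ℕ => (noiselessLaw μ g hg : Measure (X × Fin k))) =
      ((volume : Measure unitInterval).prod (Measure.infinitePi fun _ : ℕ => μ)).map
        fun p => (p.1, fun i => (p.2 i, g (p.2 i))) := by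
    rw [map_labels_infinitePi]
    have := Measure.map_prod_map (volume : Measure unitInterval)
      (Measure.infinitePi fun _ : ℕ => μ) (f := id)
      (g := fun x i => (x i, g (x i))) measurable_id (by fun_prop)
    rw [Measure.map_id] at this
    exact this
  rw [hmap, Measure.map_apply hmeas hS] at h
  have := probReal_compl_eq_one_sub
    (μ := (volume : Measure unitInterval).prod (Measure.infinitePi fun _ : ℕ => μ)) hS'
  have h' := (ENNReal.ofReal_le_iff_le_toReal (measure_ne_top _ _)).1 h
  refine this.le.trans ?_
  change 1 - (_ : ENNReal).toReal ≤ δ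
  linarith

theorem measurableSet_rhoSplits {ρ : ℝ} {Q : Finset (Sym2 (X → Fin k))}
    (hQ : ∀ p ∈ Q, ∀ h ∈ p, Measurable h) : MeasurableSet {x | RhoSplits ρ Q x} := by
  classical
  have hcard : ∀ y, Measurable fun x => ((pairsAgreeing Q x y).card : ℝ) := by
    intro y
    have : (fun x => ((pairsAgreeing Q x y).card : ℝ)) =
        fun x => ∑ p ∈ Q, Set.indicator {x | ∀ h ∈ p, h x = y} (fun _ => (1 : ℝ)) x := by
      ext x
      rw [pairsAgreeing, Finset.card_filter]
      push_cast
      refine Finset.sum_congr rfl fun p _ => ?_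
      by_cases hp : ∀ h ∈ p, h x = y
      · rw [if_pos hp, Set.indicator_of_mem (by exact hp)]
      · rw [if_neg hp, Set.indicator_of_notMem (by exact hp)]
    rw [this]
    refine Finset.measurable_sum _ fun p hp => measurable_const.indicator ?_
    induction p with
    | _ h g =>
      have h1 : MeasurableSet {x | h x = y} :=
        (measurableSet_singleton y).preimage (hQ _ hp h (Sym2.mem_mk_left _ _))
      have h2 : MeasurableSet {x | g x = y} :=
        (measurableSet_singleton y).preimage (hQ _ hp g (Sym2.mem_mk_right _ _))
      simpa [Sym2.mem_iff, Set.ofPred_and] using h1.inter h2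
  have : {x | RhoSplits ρ Q x} = ⋂ y, {x | ((pairsAgreeing Q x y).card : ℝ) ≤ (1 - ρ) * Q.card} := by
    ext x
    simp [RhoSplits]
  rw [this]
  exact MeasurableSet.iInter fun y => measurableSet_le (hcard y) measurable_const

end LowerBound

/-! ### Lower bound: the adversary -/

section LowerBound

variable {X : Type*} [MeasurableSpace X] {k : ℕ} (μ : Measure X) [IsProbabilityMeasure μ]

/-- Any `ρ` strictly above the index fails for some centre and scale; `ρ = c / q` is such a value
when `q > 0`. -/
theorem exists_not_splittable {C : Set (X → Fin k)} {τ ε c : ℝ} {q : ℕ}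
    (h : (q : ℝ≥0∞) < ENNReal.ofReal c / splittingIndex μ C τ ε) :
    ∃ ρ : ℝ, 0 ≤ ρ ∧ q * ρ ≤ c ∧ ∃ g ∈ C, ∃ Δ, ε / 2 ≤ Δ ∧
      ¬ Splittable μ (ball μ C g (4 * Δ)) ρ Δ τ := by
  set S := splittingIndex μ C τ ε with hS
  have hSt : S ≠ ⊤ := by
    intro hS
    rw [hS, ENNReal.div_top] at h
    exact absurd h not_lt_zero
  have hc : 0 < c := by
    by_contra hc
    rw [ENNReal.ofReal_of_nonpos (not_lt.1 hc), ENNReal.zero_div] at h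
    exact absurd h not_lt_zero
  obtain ⟨ρ, hρ, hqρ⟩ : ∃ ρ : ℝ≥0, S < ρ ∧ q * (ρ : ℝ) ≤ c := by
    rcases Nat.eq_zero_or_pos q with rfl | hq
    · refine ⟨S.toNNReal + 1, ?_, by simpa using hc.le⟩
      rw [ENNReal.coe_add, ENNReal.coe_toNNReal hSt]
      exact ENNReal.lt_add_right hSt (by simp)
    · have hq' : (0 : ℝ) < q := by exact_mod_cast hq
      refine ⟨(c / q).toNNReal, ?_, ?_⟩
      · have h1 : S * q < ENNReal.ofReal c := by
          rw [mul_comm]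
          by_cases hS0 : S = 0
          · rw [hS0, mul_zero]
            exact ENNReal.ofReal_pos.2 hc
          · exact (ENNReal.lt_div_iff_mul_lt (Or.inl hS0) (Or.inl hSt)).1 h
        change S < ENNReal.ofReal (c / q)
        rw [ENNReal.ofReal_div_of_pos hq', ENNReal.ofReal_natCast]
        exact (ENNReal.lt_div_iff_mul_lt (Or.inl (by exact_mod_cast hq.ne')) (Or.inl (by simp))).2 h1
      · rw [Real.coe_toNNReal _ (by positivity), mul_div_cancel₀ _ hq'.ne']
  rw [hS, splittingIndex] at hρ
  simp only [iInf_lt_iff] at hρ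
  obtain ⟨g, hg, hρ⟩ := hρ
  refine ⟨ρ, ρ.2, hqρ, g, hg, ?_⟩
  by_contra hcon
  push Not at hcon
  exact absurd (le_iSup₂ (f := fun (ρ : ℝ≥0) (_ : ∀ Δ : ℝ, ε / 2 ≤ Δ →
    Splittable μ (ball μ C g (4 * Δ)) ρ Δ τ) => (ρ : ℝ≥0∞)) ρ hcon) (not_le.2 hρ)

/-- The pointwise horizons exhaust the space, so continuity from below gives one that works with
probability above `c`. -/
theorem Algorithm.exists_request_bound_measure (A : Algorithm X k) (q : ℕ)
    (ν : Measure (unitInterval × (ℕ → X))) [IsProbabilityMeasure ν] {c : ℝ} (hc : c < 1) :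
    ∃ M : ℕ, c < ν.real {p | ∀ y : ℕ → Fin k,
      ∀ e ∈ A.transcript p.1 (fun i => (p.2 i, y i)) q, e.1 < M} := by
  set B : ℕ → Set (unitInterval × (ℕ → X)) := fun M => {p | ∀ y : ℕ → Fin k,
      ∀ e ∈ A.transcript p.1 (fun i => (p.2 i, y i)) q, e.1 < M} with hB
  have hmono : Monotone B := fun M M' hM p hp y e he => (hp y e he).trans_le hM
  have hU : ⋃ M, B M = Set.univ := Set.eq_univ_of_forall fun p =>
    Set.mem_iUnion.2 (A.exists_request_bound p.1 p.2 q)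
  have ht := tendsto_measure_iUnion_atTop (μ := ν) hmono
  rw [hU, measure_univ] at ht
  have ht' := (ENNReal.tendsto_toReal ENNReal.one_ne_top).comp ht
  exact (ht'.eventually (lt_mem_nhds (by simpa using hc))).exists

open Classical in
/-- A label shared by most pairs at `x`, if there is one. -/
def adversaryLabel (Q : Finset (Sym2 (X → Fin k))) (ρ : ℝ) (g : X → Fin k) (x : X) : Fin k :=
  if h : ∃ y, (1 - ρ) * Q.card < (pairsAgreeing Q x y).card then h.choose else g x

theorem card_lt_pairsAgreeing_adversaryLabel {Q : Finset (Sym2 (X → Fin k))} {ρ : ℝ}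
    (g : X → Fin k) {x : X} (h : ¬ RhoSplits ρ Q x) :
    (1 - ρ) * Q.card < (pairsAgreeing Q x (adversaryLabel Q ρ g x)).card := by
  have h' : ∃ y, (1 - ρ) * Q.card < (pairsAgreeing Q x y).card := by
    simpa [RhoSplits] using h
  rw [adversaryLabel, dif_pos h']
  exact h'.choose_spec

/-- The value of `τ` is not known in advance: it depends on how far the algorithm at hand looks for
its requests. -/
theorem exists_le_of_learns [Nonempty X] {C : Set (X → Fin k)} (hC : ∀ h ∈ C, Measurable h)
    {α ε δ : ℝ} (hα : 0 ≤ α) (hε : 0 ≤ ε) (hδ : δ < 1 / 16) {q : ℕ} (A : Algorithm X k)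
    (hA : ∀ D ∈ BN C α μ, ENNReal.ofReal (1 - δ) ≤
        ((volume : Measure unitInterval).prod
          (Measure.infinitePi fun _ : ℕ => (D : Measure (X × Fin k))))
          {z | A.Succeeds q (fun h => err D h ≤ noiseRate C D + ENNReal.ofReal ε) z.1 z.2}) :
    ∃ τ ∈ Set.Ioc (0 : ℝ) 1,
      ENNReal.ofReal (1 / 2) / splittingIndex μ C τ (4 * ε) ≤ q := by
  classical
  by_contra hcon
  push Not at hcon
  set ν := (volume : Measure unitInterval).prod (Measure.infinitePi fun _ : ℕ => μ) with hν
  obtain ⟨M, hM⟩ := A.exists_request_bound_measure q ν (c := 7 / 8) (by norm_num)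
  have hM8 : (0 : ℝ) < 8 * (M + 1) := by positivity
  obtain ⟨ρ, hρ0, hqρ, g₀, hg₀, Δ, hΔ, hns⟩ := exists_not_splittable μ
    (hcon (1 / (8 * (M + 1))) ⟨by positivity, by
      rw [div_le_one hM8]
      have : (0 : ℝ) ≤ M := Nat.cast_nonneg M
      linarith⟩)
  rw [Splittable] at hns
  push Not at hns
  obtain ⟨Q, hQ, hτ⟩ := hns
  have hQne : Q.Nonempty := by
    rw [Finset.nonempty_iff_ne_empty]
    rintro rfl
    have : {x : X | RhoSplits ρ (∅ : Finset (Sym2 (X → Fin k))) x} = Set.univ := by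
      ext x
      simp [RhoSplits, pairsAgreeing]
    rw [this, probReal_univ] at hτ
    rw [lt_div_iff₀ hM8] at hτ
    have : (0 : ℝ) ≤ M := Nat.cast_nonneg M
    linarith
  have hQpos : (0 : ℝ) < Q.card := by exact_mod_cast hQne.card_pos
  have hQout : ∀ p ∈ Q, p.out.1 ∈ C ∧ p.out.2 ∈ C ∧
      Δ < μ.real {x | p.out.1 x ≠ p.out.2 x} := by
    intro p hp
    have : s(p.out.1, p.out.2) = p := Quot.out_eq p
    obtain ⟨h1, h2, h3⟩ := hQ p.out.1 p.out.2 (by rwa [this])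
    exact ⟨h1.1, h2.1, h3⟩
  have hQm : ∀ p ∈ Q, ∀ h ∈ p, Measurable h := by
    intro p hp h hh
    have : s(p.out.1, p.out.2) = p := Quot.out_eq p
    rw [← this, Sym2.mem_iff] at hh
    rcases hh with rfl | rfl
    · exact hC _ (hQout p hp).1
    · exact hC _ (hQout p hp).2.1
  have hW : MeasurableSet {x | RhoSplits ρ Q x} := measurableSet_rhoSplits hQm
  set Bad : Set (unitInterval × (ℕ → X)) :=
    ⋃ i ∈ Finset.range M, {p | RhoSplits ρ Q (p.2 i)} with hBad
  have hBadle : ν.real Bad ≤ 1 / 8 := by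
    have h1 : ν.real Bad ≤ ∑ i ∈ Finset.range M, ν.real {p | RhoSplits ρ Q (p.2 i)} :=
      measureReal_biUnion_finset_le _ _
    have h2 : ∀ i, ν.real {p | RhoSplits ρ Q (p.2 i)} = μ.real {x | RhoSplits ρ Q x} := by
      intro i
      have hmp : MeasurePreserving (fun p : unitInterval × (ℕ → X) => p.2 i) ν μ :=
        (measurePreserving_eval_infinitePi (fun _ : ℕ => μ) i).comp measurePreserving_snd
      exact hmp.measureReal_preimage hW.nullMeasurableSet
    simp only [h2, Finset.sum_const, Finset.card_range, nsmul_eq_mul] at h1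
    rw [lt_div_iff₀ hM8] at hτ
    have := measureReal_nonneg (μ := μ) (s := {x | RhoSplits ρ Q x})
    have hM0 : (0 : ℝ) ≤ M := Nat.cast_nonneg M
    nlinarith
  set Fail : (X → Fin k) → Set (unitInterval × (ℕ → X)) := fun g =>
    if hg : Measurable g then {p | ¬ A.Succeeds q (fun h => err (noiselessLaw μ g hg) h ≤
      noiseRate C (noiselessLaw μ g hg) + ENNReal.ofReal ε) p.1 (fun i => (p.2 i, g (p.2 i)))}
    else ∅ with hFail
  have hFail' : ∀ g ∈ C, MeasurableSet (Fail g) ∧ ν.real (Fail g) ≤ δ := by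
    intro g hg
    have := measure_fail_le μ A (hC g hg) (hA _ (noiselessLaw_mem_BN μ hα (hC g hg) hg))
    simpa only [hFail, dif_pos (hC g hg)] using this
  -- `F` counts failures over both members of every pair; its mean is at most `2δ|Q|`.
  set F : unitInterval × (ℕ → X) → ℝ := fun p => ∑ s ∈ Q,
    ((Fail s.out.1).indicator (fun _ => (1 : ℝ)) p +
      (Fail s.out.2).indicator (fun _ => (1 : ℝ)) p) with hF
  have hind : ∀ g ∈ C, Integrable ((Fail g).indicator fun _ => (1 : ℝ)) ν := fun g hg =>
    (integrable_const 1).indicator (hFail' g hg).1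
  have hind' : ∀ g ∈ C, ∫ p, (Fail g).indicator (fun _ => (1 : ℝ)) p ∂ν ≤ δ := by
    intro g hg
    have := integral_indicator_one (μ := ν) (hFail' g hg).1
    exact this.le.trans (hFail' g hg).2
  have hFint : Integrable F ν := integrable_finsetSum _ fun s hs =>
    (hind _ (hQout s hs).1).add (hind _ (hQout s hs).2.1)
  have hFle : ∫ p, F p ∂ν ≤ Q.card * (2 * δ) := by
    have hsum : ∫ p, F p ∂ν = ∑ s ∈ Q, ∫ p, ((Fail s.out.1).indicator (fun _ => (1 : ℝ)) p +
        (Fail s.out.2).indicator (fun _ => (1 : ℝ)) p) ∂ν :=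
      integral_finsetSum _ fun s hs => (hind _ (hQout s hs).1).add (hind _ (hQout s hs).2.1)
    rw [hsum, ← nsmul_eq_mul]
    refine Finset.sum_le_card_nsmul _ _ _ fun s hs => ?_
    rw [integral_add (hind _ (hQout s hs).1) (hind _ (hQout s hs).2.1), two_mul]
    exact add_le_add (hind' _ (hQout s hs).1) (hind' _ (hQout s hs).2.1)
  have hF0 : ∀ p, 0 ≤ F p := fun p => Finset.sum_nonneg fun s _ =>
    add_nonneg (Set.indicator_nonneg (fun _ _ => zero_le_one) _)
      (Set.indicator_nonneg (fun _ _ => zero_le_one) _)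
  have hMarkov := mul_meas_ge_le_integral_of_nonneg (Filter.Eventually.of_forall hF0) hFint
    (Q.card / 2)
  have hsub : {p | ∀ y : ℕ → Fin k, ∀ e ∈ A.transcript p.1 (fun i => (p.2 i, y i)) q, e.1 < M} ⊆
      {p | (Q.card : ℝ) / 2 ≤ F p} ∪ Bad := by
    intro p hp
    by_cases hpB : p ∈ Bad
    · exact Or.inr hpB
    left
    have hpB' : ∀ i < M, ¬ RhoSplits ρ Q (p.2 i) := by
      intro i hi hs
      exact hpB (Set.mem_biUnion (Finset.mem_coe.2 (Finset.mem_range.2 hi)) hs)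
    set a : X → Fin k := adversaryLabel Q ρ g₀ with ha
    set l := A.transcript p.1 (fun i => (p.2 i, a (p.2 i))) q with hl
    have hcount := natCast_card_pairsAgreeing_inter (Q := Q) (ρ := ρ) p.2 (fun i => a (p.2 i)) l
      fun e he => (card_lt_pairsAgreeing_adversaryLabel g₀
        (hpB' e.1 (hp (fun i => a (p.2 i)) e he))).le
    have hlen : (l.length : ℝ) ≤ q := by
      exact_mod_cast A.length_transcript_le _ _ _
    have hhalf : (Q.card : ℝ) / 2 ≤
        (Q.filter fun s => ∀ e ∈ l, ∀ h ∈ s, h (p.2 e.1) = a (p.2 e.1)).card := by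
      have : (l.length : ℝ) * ρ ≤ 1 / 2 := (mul_le_mul_of_nonneg_right hlen hρ0).trans hqρ
      nlinarith
    refine hhalf.trans ?_
    have hone : ∀ s ∈ Q.filter fun s => ∀ e ∈ l, ∀ h ∈ s, h (p.2 e.1) = a (p.2 e.1),
        (1 : ℝ) ≤ (Fail s.out.1).indicator (fun _ => (1 : ℝ)) p +
          (Fail s.out.2).indicator (fun _ => (1 : ℝ)) p := by
      intro s hs
      rw [Finset.mem_filter] at hs
      obtain ⟨h1, h2, h3⟩ := hQout s hs.1
      -- Members of a surviving pair answer the requests in `l` as the adversary does, and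
      -- unrequested labels do not matter.
      have htr : ∀ h ∈ s, A.transcript p.1 (fun i => (p.2 i, h (p.2 i))) q = l := fun h hh =>
        A.transcript_congr (y := fun i => a (p.2 i)) (y' := fun i => h (p.2 i))
          (fun e he => hs.2 e he h hh) le_rfl
      by_cases f1 : p ∈ Fail s.out.1
      · rw [Set.indicator_of_mem f1]
        exact le_add_of_nonneg_right (Set.indicator_nonneg (fun _ _ => zero_le_one) _)
      by_cases f2 : p ∈ Fail s.out.2
      · rw [Set.indicator_of_mem f2]
        exact le_add_of_nonneg_left (Set.indicator_nonneg (fun _ _ => zero_le_one) _)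
      exfalso
      simp only [hFail, dif_pos (hC _ h1), dif_pos (hC _ h2), Set.mem_ofPred_eq, not_not] at f1 f2
      exact A.not_succeeds_of_transcript_eq μ hε (hC _ h1) (hC _ h2) h1 h2 (by linarith)
        ((htr _ (Sym2.out_fst_mem s)).trans (htr _ (Sym2.out_snd_mem s)).symm) f1 f2
    calc ((Q.filter fun s => ∀ e ∈ l, ∀ h ∈ s, h (p.2 e.1) = a (p.2 e.1)).card : ℝ)
        ≤ ∑ s ∈ Q.filter fun s => ∀ e ∈ l, ∀ h ∈ s, h (p.2 e.1) = a (p.2 e.1),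
          ((Fail s.out.1).indicator (fun _ => (1 : ℝ)) p +
            (Fail s.out.2).indicator (fun _ => (1 : ℝ)) p) := by
          have := Finset.card_nsmul_le_sum _ _ _ hone
          simpa using this
      _ ≤ F p := Finset.sum_le_sum_of_subset_of_nonneg (Finset.filter_subset _ _)
          fun s _ _ => add_nonneg (Set.indicator_nonneg (fun _ _ => zero_le_one) _)
            (Set.indicator_nonneg (fun _ _ => zero_le_one) _)
  have hle := (measureReal_mono (μ := ν) hsub).trans (measureReal_union_le _ _)
  -- So `F ≥ |Q|/2` has probability above `3/4`, whereas Markov's inequality allows at most `4δ <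
  -- 1/4`.
  nlinarith

theorem lower_bound {C : Set (X → Fin k)} (hC : ∀ h ∈ C, Measurable h)
    {α ε δ : ℝ} (hα : 0 ≤ α) (hε : 0 ≤ ε) (hδ : δ < 1 / 16) :
    (⨅ τ ∈ Set.Ioc (0 : ℝ) 1, ENNReal.ofReal (1 / 2) / splittingIndex μ C τ (4 * ε)) ≤
      (QCAL ε δ C (BN C α μ) : ℝ≥0∞) := by
  have := nonempty_of_isProbabilityMeasure μ
  rw [QCAL]
  simp only [ENat.toENNReal_iInf]
  refine le_iInf₂ fun q ⟨A, hA⟩ => ?_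
  obtain ⟨τ, hτ, h⟩ := exists_le_of_learns μ hC hα hε hδ A hA
  exact (iInf₂_le τ hτ).trans h

end LowerBound

/-! ### Natarajan's counting bound -/

section Natarajan

variable {k : ℕ}

theorem NatarajanShatters.of_nonempty {X : Type*} {C : Set (X → Fin k)} (h : C.Nonempty) :
    NatarajanShatters C 0 :=
  ⟨Fin.elim0, Fin.elim0, Fin.elim0, fun i => i.elim0, fun _ =>
    let ⟨g, hg⟩ := h
    ⟨g, hg, fun i => i.elim0⟩⟩

/-- A class on `n + 1` points gains a shattered point over those restrictions that extend with
both of two labels. -/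
theorem NatarajanShatters.succ_of_cons {n m : ℕ} {F : Set (Fin (n + 1) → Fin k)} {b c : Fin k}
    (hbc : b ≠ c) {G : Set (Fin n → Fin k)}
    (hG : ∀ g ∈ G, (Fin.cons b g : Fin (n + 1) → Fin k) ∈ F ∧
      (Fin.cons c g : Fin (n + 1) → Fin k) ∈ F) (h : NatarajanShatters G m) :
    NatarajanShatters F (m + 1) := by
  obtain ⟨a, b', c', hne, hs⟩ := h
  refine ⟨Fin.cons 0 (fun i => (a i).succ), Fin.cons b b', Fin.cons c c', ?_, fun s => ?_⟩
  · intro i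
    refine Fin.cases ?_ (fun i => ?_) i
    · simpa using hbc
    · simpa using hne i
  · obtain ⟨g, hg, hgs⟩ := hs (fun i => s i.succ)
    refine ⟨Fin.cons (if s 0 then b else c) g, ?_, fun i => ?_⟩
    · split
      · exact (hG g hg).1
      · exact (hG g hg).2
    · refine Fin.cases ?_ (fun i => ?_) i
      · simp
      · simpa using hgs i

theorem NatarajanShatters.tail {n m : ℕ} {F : Set (Fin (n + 1) → Fin k)}
    (h : NatarajanShatters (Fin.tail '' F) m) : NatarajanShatters F m := by
  obtain ⟨a, b, c, hne, hs⟩ := h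
  refine ⟨fun i => (a i).succ, b, c, hne, fun s => ?_⟩
  obtain ⟨_, ⟨g, hg, rfl⟩, hgs⟩ := hs s
  exact ⟨g, hg, hgs⟩

theorem card_le_one_add_card_offDiag {α : Type*} [DecidableEq α] (s : Finset α) :
    s.card ≤ 1 + s.offDiag.card := by
  rw [Finset.offDiag_card]
  rcases Nat.eq_zero_or_pos s.card with h | h
  · omega
  · obtain ⟨m, hm⟩ := Nat.exists_eq_add_of_le' h
    rw [hm]
    have : (m + 1) * (m + 1) - (m + 1) = (m + 1) * m := by
      rw [← Nat.mul_sub_one]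
      rfl
    rw [this]
    nlinarith

/-- The fibre of a restriction `g` is determined by its first labels. A fibre with `m` elements has
at least `m - 1` ordered pairs of distinct labels, each extending `g` in two ways. -/
theorem card_le_card_tail_add {n : ℕ} (F : Finset (Fin (n + 1) → Fin k)) :
    F.card ≤ (F.image Fin.tail).card +
      ∑ p ∈ (Finset.univ : Finset (Fin k)).offDiag,
        ((F.image Fin.tail).filter fun g => (Fin.cons p.1 g : Fin (n + 1) → Fin k) ∈ F ∧
          (Fin.cons p.2 g : Fin (n + 1) → Fin k) ∈ F).card := by
  classical
  have h1 : F.card = ∑ g ∈ F.image Fin.tail, (F.filter fun f => Fin.tail f = g).card :=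
    Finset.card_eq_sum_card_image _ _
  have h2 : ∀ g, (F.filter fun f => Fin.tail f = g).card ≤
      ((Finset.univ : Finset (Fin k)).filter fun b =>
        (Fin.cons b g : Fin (n + 1) → Fin k) ∈ F).card := by
    intro g
    refine Finset.card_le_card_of_injOn (fun f => f 0) ?_ ?_
    · intro f hf
      simp only [Finset.coe_filter, Set.mem_ofPred_eq, Finset.mem_univ, true_and] at hf ⊢
      rw [← hf.2, Fin.cons_self_tail]
      exact hf.1
    · intro f hf f' hf' h
      simp only [Finset.coe_filter, Set.mem_ofPred_eq] at hf hf'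
      rw [← Fin.cons_self_tail f, ← Fin.cons_self_tail f', hf.2, hf'.2]
      exact congrArg (fun b => (Fin.cons b g : Fin (n + 1) → Fin k)) h
  calc F.card ≤ ∑ g ∈ F.image Fin.tail, (1 + ∑ p ∈ (Finset.univ : Finset (Fin k)).offDiag,
        if (Fin.cons p.1 g : Fin (n + 1) → Fin k) ∈ F ∧
          (Fin.cons p.2 g : Fin (n + 1) → Fin k) ∈ F then 1 else 0) := by
        rw [h1]
        refine Finset.sum_le_sum fun g _ => (h2 g).trans ((card_le_one_add_card_offDiag _).trans ?_)
        rw [← Finset.card_filter]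
        refine Nat.add_le_add_left (Finset.card_le_card fun p hp => ?_) 1
        simp only [Finset.mem_offDiag, Finset.mem_filter, Finset.mem_univ, true_and] at hp ⊢
        exact ⟨hp.2.2, hp.1, hp.2.1⟩
    _ = _ := by
        rw [Finset.sum_add_distrib, Finset.sum_comm, Finset.sum_const, smul_eq_mul, mul_one]
        simp only [Finset.card_filter]

/-- Natarajan's bound on the number of labelings of `n` points. -/
theorem card_le_of_natarajanShatters (hk : 1 ≤ k) (n d : ℕ) (F : Finset (Fin n → Fin k))
    (hF : ∀ m, NatarajanShatters (F : Set (Fin n → Fin k)) m → m ≤ d) :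
    F.card ≤ (k ^ 2 * (n + 1)) ^ d := by
  induction n generalizing d with
  | zero =>
    calc F.card ≤ 1 := Finset.card_le_one_of_subsingleton F
      _ ≤ _ := Nat.one_le_pow _ _ (by positivity)
  | succ n ih =>
    have hsum := card_le_card_tail_add F
    have htail : ∀ m, NatarajanShatters ((F.image Fin.tail : Finset (Fin n → Fin k)) :
        Set (Fin n → Fin k)) m → m ≤ d := by
      intro m hm
      rw [Finset.coe_image] at hm
      exact hF m hm.tail
    have hpair : ∀ p ∈ (Finset.univ : Finset (Fin k)).offDiag, ∀ m,
        NatarajanShatters (((F.image Fin.tail).filter fun g =>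
          (Fin.cons p.1 g : Fin (n + 1) → Fin k) ∈ F ∧
          (Fin.cons p.2 g : Fin (n + 1) → Fin k) ∈ F : Finset (Fin n → Fin k)) :
          Set (Fin n → Fin k)) m → m + 1 ≤ d := by
      intro p hp m hm
      refine hF _ (NatarajanShatters.succ_of_cons (Finset.mem_offDiag.1 hp).2.2 (fun g hg => ?_) hm)
      exact (Finset.mem_filter.1 (Finset.mem_coe.1 hg)).2
    -- Restrictions with two extensions have dimension one lower, so for `d = 0` there are none.
    rcases d with _ | d
    · have h0 : ∑ p ∈ (Finset.univ : Finset (Fin k)).offDiag,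
        ((F.image Fin.tail).filter fun g => (Fin.cons p.1 g : Fin (n + 1) → Fin k) ∈ F ∧
          (Fin.cons p.2 g : Fin (n + 1) → Fin k) ∈ F).card = 0 := by
        refine Finset.sum_eq_zero fun p hp => ?_
        rw [Finset.card_eq_zero, ← Finset.not_nonempty_iff_eq_empty]
        intro hne
        exact absurd (hpair p hp 0 (NatarajanShatters.of_nonempty hne)) (by simp)
      have := ih 0 _ htail
      simp only [pow_zero] at this ⊢
      omega
    · have h1 := ih (d + 1) _ htail
      have h2 : ∑ p ∈ (Finset.univ : Finset (Fin k)).offDiag,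
          ((F.image Fin.tail).filter fun g => (Fin.cons p.1 g : Fin (n + 1) → Fin k) ∈ F ∧
          (Fin.cons p.2 g : Fin (n + 1) → Fin k) ∈ F).card ≤
          k ^ 2 * (k ^ 2 * (n + 1)) ^ d := by
        refine (Finset.sum_le_card_nsmul _ _ _ fun p hp =>
          ih d _ fun m hm => Nat.le_of_succ_le_succ (hpair p hp m hm)).trans ?_
        rw [smul_eq_mul]
        refine Nat.mul_le_mul_right _ ?_
        rw [Finset.offDiag_card, Finset.card_univ, Fintype.card_fin, sq]
        exact Nat.sub_le _ _
      calc F.card ≤ (k ^ 2 * (n + 1)) ^ (d + 1) + k ^ 2 * (k ^ 2 * (n + 1)) ^ d := by omega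
        _ = (k ^ 2 * (n + 1)) ^ d * (k ^ 2 * (n + 1 + 1)) := by ring
        _ ≤ (k ^ 2 * (n + 1 + 1)) ^ d * (k ^ 2 * (n + 1 + 1)) :=
          Nat.mul_le_mul_right _ (Nat.pow_le_pow_left (Nat.mul_le_mul_left _ (by omega)) _)
        _ = (k ^ 2 * (n + 1 + 1)) ^ (d + 1) := by ring

end Natarajan

/-! ### Separated sets are distinguished by few points -/

section Packing

variable {X : Type*} [MeasurableSpace X] {k : ℕ} (μ : Measure X) [IsProbabilityMeasure μ]

open Classical in
theorem exists_card_filter_notMem_le {β : Type*} (Q : Finset β) (E : β → Set X) {r : ℝ}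
    (hE : ∀ q ∈ Q, MeasurableSet (E q)) (hr : ∀ q ∈ Q, r ≤ μ.real (E q)) :
    ∃ x, ((Q.filter fun q => x ∉ E q).card : ℝ) ≤ (1 - r) * Q.card := by
  have hint : ∀ q ∈ Q, Integrable ((E q)ᶜ.indicator fun _ => (1 : ℝ)) μ := fun q hq =>
    (integrable_const 1).indicator (hE q hq).compl
  obtain ⟨x, hx⟩ := exists_le_integral (μ := μ)
    (f := fun x => ∑ q ∈ Q, (E q)ᶜ.indicator (fun _ => (1 : ℝ)) x) (integrable_finsetSum _ hint)
  refine ⟨x, ?_⟩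
  have h1 : ((Q.filter fun q => x ∉ E q).card : ℝ) =
      ∑ q ∈ Q, (E q)ᶜ.indicator (fun _ => (1 : ℝ)) x := by
    rw [Finset.card_filter]
    push_cast
    refine Finset.sum_congr rfl fun q _ => ?_
    by_cases hq : x ∈ E q
    · simp [hq]
    · simp [hq]
  rw [h1]
  refine hx.trans ?_
  rw [integral_finsetSum _ hint, mul_comm, ← nsmul_eq_mul]
  refine Finset.sum_le_card_nsmul _ _ _ fun q hq => ?_
  have h2 := integral_indicator_one (μ := μ) (hE q hq).compl
  refine h2.le.trans ?_
  rw [probReal_compl_eq_one_sub (hE q hq)]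
  linarith [hr q hq]

open Classical in
-- Greedy hitting: by averaging, some point misses at most a fraction `1 - r` of the events not hit
-- so far.
theorem exists_points_card_filter_le {β : Type*} (Q : Finset β) (E : β → Set X) {r : ℝ}
    (hr1 : r ≤ 1) (hE : ∀ q ∈ Q, MeasurableSet (E q)) (hr : ∀ q ∈ Q, r ≤ μ.real (E q)) (n : ℕ) :
    ∃ a : Fin n → X, ((Q.filter fun q => ∀ i, a i ∉ E q).card : ℝ) ≤ (1 - r) ^ n * Q.card := by
  induction n with
  | zero => exact ⟨Fin.elim0, by simp⟩
  | succ n ih =>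
    obtain ⟨a, ha⟩ := ih
    obtain ⟨x, hx⟩ := exists_card_filter_notMem_le μ (Q.filter fun q => ∀ i, a i ∉ E q) E
      (fun q hq => hE q (Finset.mem_filter.1 hq).1) (fun q hq => hr q (Finset.mem_filter.1 hq).1)
    refine ⟨Fin.cons x a, ?_⟩
    have : (Q.filter fun q => ∀ i, (Fin.cons x a : Fin (n + 1) → X) i ∉ E q) =
        (Q.filter fun q => ∀ i, a i ∉ E q).filter fun q => x ∉ E q := by
      ext q
      simp only [Finset.mem_filter, Fin.forall_fin_succ, Fin.cons_zero, Fin.cons_succ]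
      tauto
    rw [this]
    refine hx.trans ?_
    rw [pow_succ', mul_assoc]
    exact mul_le_mul_of_nonneg_left ha (by linarith)

theorem exists_points_of_pow_mul_card_lt {β : Type*} (Q : Finset β) (E : β → Set X) {r : ℝ}
    (hr1 : r ≤ 1) (hE : ∀ q ∈ Q, MeasurableSet (E q)) (hr : ∀ q ∈ Q, r ≤ μ.real (E q)) {n : ℕ}
    (hn : (1 - r) ^ n * Q.card < 1) : ∃ a : Fin n → X, ∀ q ∈ Q, ∃ i, a i ∈ E q := by
  classical
  obtain ⟨a, ha⟩ := exists_points_card_filter_le μ Q E hr1 hE hr n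
  refine ⟨a, fun q hq => ?_⟩
  by_contra hcon
  push Not at hcon
  have h0 := ha.trans_lt hn
  rw [Nat.cast_lt_one, Finset.card_eq_zero, Finset.eq_empty_iff_forall_notMem] at h0
  exact h0 q (Finset.mem_filter.2 ⟨hq, hcon⟩)

/-- A finite `r`-separated subset of a class of Natarajan dimension at most `d` has at most as
many elements as there are labelings of `n` points, once `n` is large enough. -/
theorem card_packing_le_pow (hk : 1 ≤ k) {C : Set (X → Fin k)} {d : ℕ}
    (hd : ∀ m, NatarajanShatters C m → m ≤ d) (V : Finset (X → Fin k)) (hVC : ∀ h ∈ V, h ∈ C)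
    (hC : ∀ h ∈ C, Measurable h) {r : ℝ} (hr1 : r ≤ 1)
    (hsep : ∀ h ∈ V, ∀ g ∈ V, h ≠ g → r ≤ μ.real {x | h x ≠ g x}) {n : ℕ}
    (hn : (1 - r) ^ n * (V.card : ℝ) ^ 2 < 1) : V.card ≤ (k ^ 2 * (n + 1)) ^ d := by
  classical
  have hcard : (V.offDiag.card : ℝ) ≤ (V.card : ℝ) ^ 2 := by
    have : V.offDiag.card ≤ V.card ^ 2 := by
      rw [Finset.offDiag_card, sq]
      exact Nat.sub_le _ _
    exact_mod_cast this
  obtain ⟨a, ha⟩ := exists_points_of_pow_mul_card_lt μ V.offDiag (fun p => {x | p.1 x ≠ p.2 x}) hr1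
    (fun p hp => measurableSet_ne (hC _ (hVC _ (Finset.mem_offDiag.1 hp).1))
      (hC _ (hVC _ (Finset.mem_offDiag.1 hp).2.1)))
    (fun p hp => hsep _ (Finset.mem_offDiag.1 hp).1 _ (Finset.mem_offDiag.1 hp).2.1
      (Finset.mem_offDiag.1 hp).2.2) (n := n) (lt_of_le_of_lt (mul_le_mul_of_nonneg_left hcard
    (pow_nonneg (by linarith) n)) hn)
  have hinj : Set.InjOn (fun h : X → Fin k => h ∘ a) (V : Set (X → Fin k)) := by
    intro h hh g hg heq
    by_contra hne
    obtain ⟨i, hi⟩ := ha (h, g) (Finset.mem_offDiag.2 ⟨hh, hg, hne⟩)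
    exact hi (congrFun heq i)
  rw [← Finset.card_image_of_injOn hinj]
  refine card_le_of_natarajanShatters hk n d _ fun m hm => hd m ?_
  obtain ⟨a', b, c, hne, hs⟩ := hm
  refine ⟨fun i => a (a' i), b, c, hne, fun s => ?_⟩
  obtain ⟨g, hg, hgs⟩ := hs s
  obtain ⟨h, hh, rfl⟩ := Finset.mem_image.1 (Finset.mem_coe.1 hg)
  exact ⟨h, hVC h hh, hgs⟩

end Packing

/-! ### Finite covers from maximal packings -/

section Cover

variable {X : Type*} [MeasurableSpace X] {k : ℕ} (μ : Measure X) [IsProbabilityMeasure μ]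

/-- Distinguishing `N` separated classifiers takes about `2 log N / r` points, and the counting
bound on those points returns `log N ≤ d log(O(k² log N / r))`, which is then solved for `log N`. -/
theorem log_card_packing_le (hk : 1 ≤ k) {C : Set (X → Fin k)} {d : ℕ} (hd1 : 1 ≤ d)
    (hd : ∀ m, NatarajanShatters C m → m ≤ d) (V : Finset (X → Fin k)) (hVC : ∀ h ∈ V, h ∈ C)
    (hC : ∀ h ∈ C, Measurable h) {r : ℝ} (hr0 : 0 < r) (hr1 : r ≤ 1)
    (hsep : ∀ h ∈ V, ∀ g ∈ V, h ≠ g → r ≤ μ.real {x | h x ≠ g x}) :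
    Real.log V.card ≤ 2 * d * Real.log (8 * k ^ 2 * d / r) := by
  have hk' : (1 : ℝ) ≤ k := by exact_mod_cast hk
  have hd' : (1 : ℝ) ≤ d := by exact_mod_cast hd1
  have hk2 : (1 : ℝ) ≤ (k : ℝ) ^ 2 := one_le_pow₀ hk'
  have h8 : (8 : ℝ) ≤ 8 * k ^ 2 * d / r := by
    rw [le_div_iff₀ hr0]
    nlinarith [mul_le_mul hk2 hd' zero_le_one (by positivity)]
  have hlog1 : 1 ≤ Real.log (8 * k ^ 2 * d / r) := by
    rw [Real.le_log_iff_exp_le (by linarith)]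
    linarith [Real.exp_one_lt_d9]
  set z := Real.log V.card with hz
  rcases le_or_gt z 1 with hz1 | hz1
  · nlinarith
  have hV0 : (0 : ℝ) < V.card := by
    rcases Nat.eq_zero_or_pos V.card with h | h
    · rw [hz, h] at hz1
      simp at hz1
      linarith
    · exact_mod_cast h
  have hn := card_packing_le_pow μ hk hd V hVC hC hr1 hsep (n := ⌊2 * z / r⌋₊ + 1) (by
    have h1 : 1 - r ≤ Real.exp (-r) := by linarith [Real.add_one_le_exp (-r)]
    have h2 : (V.card : ℝ) ^ 2 = Real.exp (2 * z) := by
      rw [two_mul, Real.exp_add, hz, Real.exp_log hV0, sq]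
    have h3 : 2 * z < r * (⌊2 * z / r⌋₊ + 1 : ℕ) := by
      have := Nat.lt_floor_add_one (2 * z / r)
      rw [div_lt_iff₀ hr0] at this
      push_cast
      linarith
    calc (1 - r) ^ (⌊2 * z / r⌋₊ + 1) * (V.card : ℝ) ^ 2
        ≤ Real.exp (-r) ^ (⌊2 * z / r⌋₊ + 1) * (V.card : ℝ) ^ 2 :=
          mul_le_mul_of_nonneg_right (pow_le_pow_left₀ (by linarith) h1 _) (by positivity)
      _ = Real.exp (2 * z - r * (⌊2 * z / r⌋₊ + 1 : ℕ)) := by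
          rw [← Real.exp_nat_mul, h2, ← Real.exp_add]
          congr 1
          ring
      _ < 1 := Real.exp_lt_one_iff.2 (by linarith))
  have hn' : (V.card : ℝ) ≤ ((k : ℝ) ^ 2 * ((⌊2 * z / r⌋₊ + 1 : ℕ) + 1)) ^ d := by
    exact_mod_cast hn
  have hfl : ((⌊2 * z / r⌋₊ + 1 : ℕ) + 1 : ℝ) ≤ 4 * z / r := by
    have h1 := Nat.floor_le (a := 2 * z / r) (by positivity)
    have h2 : 2 ≤ 2 * z / r := by
      rw [le_div_iff₀ hr0]
      nlinarith
    have h3 : 4 * z / r = 2 * z / r + 2 * z / r := by ring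
    push_cast
    linarith
  have hz0 : 0 < z := by linarith
  have h4 : z ≤ d * Real.log ((k : ℝ) ^ 2 * (4 * z / r)) := by
    rw [← Real.log_pow, hz]
    refine Real.log_le_log hV0 (hn'.trans (pow_le_pow_left₀ (by positivity) ?_ _))
    exact mul_le_mul_of_nonneg_left hfl (by positivity)
  -- The factor `z / (2d)` is split off because `d log(z / (2d)) ≤ z/2 - d` is absorbed by the left
  -- side.
  have h5 : (k : ℝ) ^ 2 * (4 * z / r) = 8 * k ^ 2 * d / r * (z / (2 * d)) := by
    field_simp
    ring
  rw [h5, Real.log_mul (by positivity) (by positivity)] at h4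
  have h6 := Real.log_le_sub_one_of_pos (x := z / (2 * d)) (by positivity)
  have h7 : d * (z / (2 * d)) = z / 2 := by field_simp
  nlinarith

/-- A class of finite Natarajan dimension has a finite `r`-cover inside the class. -/
theorem exists_finite_cover (hk : 1 ≤ k) {C : Set (X → Fin k)} {d : ℕ} (hd1 : 1 ≤ d)
    (hd : ∀ m, NatarajanShatters C m → m ≤ d) (hC : ∀ h ∈ C, Measurable h) {r : ℝ} (hr0 : 0 < r)
    (hr1 : r ≤ 1) :
    ∃ V : Finset (X → Fin k), (∀ h ∈ V, h ∈ C) ∧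
      (∀ h ∈ C, ∃ g ∈ V, μ.real {x | g x ≠ h x} ≤ r) ∧
      Real.log V.card ≤ 2 * d * Real.log (8 * k ^ 2 * d / r) := by
  classical
  set S : Set ℕ := {n | ∃ V : Finset (X → Fin k), V.card = n ∧ (∀ h ∈ V, h ∈ C) ∧
    ∀ h ∈ V, ∀ g ∈ V, h ≠ g → r ≤ μ.real {x | h x ≠ g x}} with hS
  have hne : S.Nonempty := ⟨0, ∅, by simp⟩
  have hbdd : BddAbove S := by
    refine ⟨⌈Real.exp (2 * d * Real.log (8 * k ^ 2 * d / r))⌉₊, ?_⟩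
    rintro _ ⟨V, rfl, hVC, hsep⟩
    rcases Nat.eq_zero_or_pos V.card with h | h
    · rw [h]
      exact Nat.zero_le _
    · have h0 : (0 : ℝ) < V.card := by exact_mod_cast h
      have := log_card_packing_le μ hk hd1 hd V hVC hC hr0 hr1 hsep
      rw [Real.log_le_iff_le_exp h0] at this
      exact_mod_cast this.trans (Nat.le_ceil _)
  -- A separated set of maximal size is a cover, since an uncovered classifier could be added to it.
  obtain ⟨V, hcard, hVC, hsep⟩ := Nat.sSup_mem hne hbdd
  refine ⟨V, hVC, fun h hh => ?_, log_card_packing_le μ hk hd1 hd V hVC hC hr0 hr1 hsep⟩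
  by_contra hcon
  push Not at hcon
  have hnot : h ∉ V := by
    intro hV
    have := hcon h hV
    simp at this
    linarith
  have hmem : V.card + 1 ∈ S := by
    refine ⟨insert h V, Finset.card_insert_of_notMem hnot, ?_, ?_⟩
    · intro g hg
      rcases Finset.mem_insert.1 hg with rfl | hg
      · exact hh
      · exact hVC g hg
    · intro g hg g' hg' hne
      rcases Finset.mem_insert.1 hg with h1 | h1 <;> rcases Finset.mem_insert.1 hg' with h2 | h2
      · exact absurd (h1.trans h2.symm) hne
      · simp only [h1, ne_comm (a := h _)]
        exact (hcon g' h2).le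
      · rw [h2]
        exact (hcon g h1).le
      · exact hsep g h1 g' h2 hne
  have := le_csSup hbdd hmem
  omega

end Cover

/-! ### Monotonicity of splittability and the trivial splitting rate -/

section Splitting

variable {X : Type*} [MeasurableSpace X] {k : ℕ} (μ : Measure X) [IsProbabilityMeasure μ]

theorem Splittable.anti_rho {H : Set (X → Fin k)} {ρ ρ' Δ τ : ℝ} (hρ : ρ' ≤ ρ)
    (h : Splittable μ H ρ Δ τ) : Splittable μ H ρ' Δ τ := by
  refine fun Q hQ => (h Q hQ).trans (measureReal_mono fun x hx y => (hx y).trans ?_)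
  exact mul_le_mul_of_nonneg_right (by linarith) (Nat.cast_nonneg _)

theorem Splittable.anti_tau {H : Set (X → Fin k)} {ρ Δ τ τ' : ℝ} (hτ : τ' ≤ τ)
    (h : Splittable μ H ρ Δ τ) : Splittable μ H ρ Δ τ' :=
  fun Q hQ => hτ.trans (h Q hQ)

/-- A random point distinguishes the members of a pair at distance more than `Δ` with
probability more than `Δ`. -/
theorem splittable_half {H : Set (X → Fin k)} (hH : ∀ h ∈ H, Measurable h) {ρ Δ : ℝ}
    (hρ0 : 0 ≤ ρ) (hρ1 : ρ ≤ 1) (hΔ : 2 * ρ ≤ Δ) : Splittable μ H ρ Δ ρ := by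
  classical
  intro Q hQ
  have hQm : ∀ p ∈ Q, ∀ h ∈ p, Measurable h := by
    intro p
    induction p with
    | _ h g =>
      intro hp f hf
      obtain ⟨h1, h2, -⟩ := hQ h g hp
      rcases Sym2.mem_iff.1 hf with rfl | rfl
      · exact hH _ h1
      · exact hH _ h2
  set W := {x | RhoSplits ρ Q x} with hWdef
  have hW : MeasurableSet W := measurableSet_rhoSplits hQm
  rcases Q.eq_empty_or_nonempty with rfl | hne
  · have : W = Set.univ := by
      ext x
      simp [hWdef, RhoSplits, pairsAgreeing]
    rwa [this, probReal_univ]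
  set E : Sym2 (X → Fin k) → Set X := fun p => {x | p.out.1 x ≠ p.out.2 x} with hE
  have hout : ∀ p : Sym2 (X → Fin k), s(p.out.1, p.out.2) = p := fun p => Quot.out_eq p
  have hEm : ∀ p ∈ Q, MeasurableSet (E p) := fun p hp =>
    measurableSet_ne (hQm p hp _ (Sym2.out_fst_mem p)) (hQm p hp _ (Sym2.out_snd_mem p))
  have hEΔ : ∀ p ∈ Q, Δ ≤ μ.real (E p) := by
    intro p hp
    exact (hQ p.out.1 p.out.2 (by rwa [hout])).2.2.le
  have hint : ∀ p ∈ Q, Integrable ((E p).indicator fun _ => (1 : ℝ)) μ := fun p hp =>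
    (integrable_const 1).indicator (hEm p hp)
  have hQpos : (0 : ℝ) < Q.card := by exact_mod_cast hne.card_pos
  have hlow : Q.card * Δ ≤ ∫ x, ∑ p ∈ Q, (E p).indicator (fun _ => (1 : ℝ)) x ∂μ := by
    rw [integral_finsetSum _ hint, ← nsmul_eq_mul]
    refine Finset.card_nsmul_le_sum _ _ _ fun p hp => ?_
    have h2 := integral_indicator_one (μ := μ) (hEm p hp)
    exact (hEΔ p hp).trans h2.ge
  -- Off `W` fewer than `ρ|Q|` pairs disagree at `x`, and on `W` at most `|Q|` do; comparison with
  -- `hlow` gives `Δ ≤ μ(W) + ρ`.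
  have hup : ∫ x, ∑ p ∈ Q, (E p).indicator (fun _ => (1 : ℝ)) x ∂μ ≤
      ∫ x, (Q.card * W.indicator (fun _ => (1 : ℝ)) x + ρ * Q.card) ∂μ := by
    refine integral_mono (integrable_finsetSum _ hint)
      ((((integrable_const (1 : ℝ)).indicator hW).const_mul _).add (integrable_const _)) fun x => ?_
    have hdis : ∀ y, ∑ p ∈ Q, (E p).indicator (fun _ => (1 : ℝ)) x ≤
        Q.card - (pairsAgreeing Q x y).card := by
      intro y
      have : (∑ p ∈ Q, (E p).indicator (fun _ => (1 : ℝ)) x) + (pairsAgreeing Q x y).card =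
          ∑ p ∈ Q, ((E p).indicator (fun _ => (1 : ℝ)) x +
            if ∀ h ∈ p, h x = y then 1 else 0) := by
        rw [Finset.sum_add_distrib, pairsAgreeing, Finset.card_filter]
        push_cast
        rfl
      have hle : ∑ p ∈ Q, ((E p).indicator (fun _ => (1 : ℝ)) x +
            if ∀ h ∈ p, h x = y then 1 else 0) ≤ Q.card • (1 : ℝ) := by
        refine Finset.sum_le_card_nsmul _ _ _ fun p hp => ?_
        by_cases hx : x ∈ E p
        · rw [Set.indicator_of_mem hx, if_neg, add_zero]
          intro hall
          exact hx ((hall _ (Sym2.out_fst_mem p)).trans (hall _ (Sym2.out_snd_mem p)).symm)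
        · rw [Set.indicator_of_notMem hx, zero_add]
          split <;> norm_num
      rw [nsmul_eq_mul, mul_one] at hle
      linarith
    by_cases hx : x ∈ W
    · rw [Set.indicator_of_mem hx, mul_one]
      have hle : ∑ p ∈ Q, (E p).indicator (fun _ => (1 : ℝ)) x ≤ Q.card • (1 : ℝ) :=
        Finset.sum_le_card_nsmul _ _ _ fun p _ => Set.indicator_le_self' (fun _ _ => zero_le_one) x
      rw [nsmul_eq_mul, mul_one] at hle
      nlinarith
    · rw [Set.indicator_of_notMem hx]
      obtain ⟨y, hy⟩ : ∃ y, (1 - ρ) * Q.card < (pairsAgreeing Q x y).card := by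
        simpa [hWdef, RhoSplits] using hx
      have := hdis y
      dsimp only
      linarith
  have hWi := integral_indicator_one (μ := μ) hW
  rw [integral_add ((((integrable_const (1 : ℝ)).indicator hW).const_mul _)) (integrable_const _),
    integral_const_mul, integral_const, probReal_univ, one_smul] at hup
  have hWi' : ∫ x, W.indicator (fun _ => (1 : ℝ)) x ∂μ = μ.real W := hWi
  rw [hWi'] at hup
  have := hlow.trans hup
  have h3 : (Q.card : ℝ) * Δ ≤ Q.card * (μ.real W + ρ) := by linarith
  have h4 := le_of_mul_le_mul_left h3 hQpos
  linarith

end Splitting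

/-! ### The splitting game on a finite set of candidates -/

section Solvable

variable {X : Type*} [MeasurableSpace X] {k : ℕ} (μ : Measure X) [IsProbabilityMeasure μ]
  {ι : Type*} (f : ι → X → Fin k)

/-- `n` rounds of binary-search-like queries suffice to shrink the set `V` of candidates to diameter
at most `r`, where each round must have probability at least `τ` of finding a suitable point. -/
def Solvable (τ r : ℝ) : ℕ → Finset ι → Prop
  | 0, V => ∀ i ∈ V, ∀ j ∈ V, μ.real {x | f i x ≠ f j x} ≤ r
  | n + 1, V => τ ≤ μ.real {x | ∀ y, Solvable τ r n (V.filter fun i => f i x = y)}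

theorem Solvable.mono {τ r : ℝ} {n : ℕ} {V V' : Finset ι} (h : Solvable μ f τ r n V)
    (hV : V' ⊆ V) : Solvable μ f τ r n V' := by
  induction n generalizing V V' with
  | zero => exact fun i hi j hj => h i (hV hi) j (hV hj)
  | succ n ih =>
    exact le_trans h (measureReal_mono fun x hx y => ih (hx y) (Finset.filter_subset_filter _ hV))

open Classical in
/-- The pairs of classifiers indexed by `V` at distance more than `Δ`. -/
def farPairs (Δ : ℝ) (V : Finset ι) : Finset (Sym2 (X → Fin k)) :=
  (V.image f).sym2.filter fun p => ∃ h g, p = s(h, g) ∧ Δ < μ.real {x | h x ≠ g x}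

theorem mem_farPairs {Δ : ℝ} {V : Finset ι} {h g : X → Fin k} : s(h, g) ∈ farPairs μ f Δ V ↔
    (∃ i ∈ V, f i = h) ∧ (∃ i ∈ V, f i = g) ∧ Δ < μ.real {x | h x ≠ g x} := by
  classical
  rw [farPairs, Finset.mem_filter, Finset.mk_mem_sym2_iff, Finset.mem_image, Finset.mem_image,
    and_assoc]
  refine and_congr_right fun _ => and_congr_right fun _ => ⟨?_, fun hd => ⟨h, g, rfl, hd⟩⟩
  rintro ⟨h', g', he, hd⟩
  rcases Sym2.eq_iff.1 he with ⟨rfl, rfl⟩ | ⟨rfl, rfl⟩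
  · exact hd
  · simpa only [ne_comm] using hd

theorem card_farPairs_le (Δ : ℝ) (V : Finset ι) : (farPairs μ f Δ V).card ≤ V.card ^ 2 := by
  classical
  refine (Finset.card_filter_le _ _).trans ?_
  rw [Finset.card_sym2]
  have h1 : (V.image f).card ≤ V.card := Finset.card_image_le
  refine (Nat.choose_le_choose 2 (Nat.add_le_add_right h1 1)).trans ?_
  rw [Nat.choose_two_right, Nat.add_sub_cancel]
  refine Nat.div_le_of_le_mul ?_
  rcases Nat.eq_zero_or_pos V.card with h | h
  · simp [h]
  · nlinarith

theorem farPairs_filter_subset (Δ : ℝ) (V : Finset ι) (x : X) (y : Fin k) :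
    farPairs μ f Δ (V.filter fun i => f i x = y) ⊆ pairsAgreeing (farPairs μ f Δ V) x y := by
  classical
  intro p
  induction p with
  | _ h g =>
    intro hp
    rw [mem_farPairs] at hp
    obtain ⟨⟨i, hi, rfl⟩, ⟨j, hj, rfl⟩, hd⟩ := hp
    rw [Finset.mem_filter] at hi hj
    simp only [pairsAgreeing, Finset.mem_filter, mem_farPairs]
    refine ⟨⟨⟨i, hi.1, rfl⟩, ⟨j, hj.1, rfl⟩, hd⟩, fun h hh => ?_⟩
    rcases Sym2.mem_iff.1 hh with rfl | rfl
    · exact hi.2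
    · exact hj.2

variable {C : Set (X → Fin k)}

/-- Each splitting point multiplies the number of far pairs by at most `1 - ρ ≤ exp(-ρ)`, whatever
its label. After `t` rounds fewer than one is left, so the diameter is at most `Δ`. -/
theorem solvable_add (hfC : ∀ i, f i ∈ C) {ρ Δ τ r : ℝ} (hτ : τ ≤ 1)
    (hs : ∀ g ∈ C, Splittable μ (ball μ C g (4 * Δ)) ρ Δ τ) {n : ℕ}
    (hn : ∀ V : Finset ι, (∀ i ∈ V, ∀ j ∈ V, μ.real {x | f i x ≠ f j x} ≤ Δ) →
      Solvable μ f τ r n V) (t : ℕ) {V : Finset ι}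
    (hV : ∀ i ∈ V, ∀ j ∈ V, μ.real {x | f i x ≠ f j x} ≤ 4 * Δ)
    (ht : ((farPairs μ f Δ V).card : ℝ) < Real.exp (ρ * t)) : Solvable μ f τ r (n + t) V := by
  induction t generalizing V with
  | zero =>
    refine hn V fun i hi j hj => ?_
    by_contra hcon
    have hmem := (mem_farPairs μ f (Δ := Δ) (V := V)).2
      ⟨⟨i, hi, rfl⟩, ⟨j, hj, rfl⟩, not_le.1 hcon⟩
    have := Finset.card_pos.2 ⟨_, hmem⟩
    simp only [Nat.cast_zero, mul_zero, Real.exp_zero, Nat.cast_lt_one] at ht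
    omega
  | succ t ih =>
    have hspl : τ ≤ μ.real {x | RhoSplits ρ (farPairs μ f Δ V) x} := by
      rcases V.eq_empty_or_nonempty with rfl | ⟨i, hi⟩
      · have : farPairs μ f Δ (∅ : Finset ι) = ∅ := by
          simp [farPairs]
        rw [this]
        have : {x : X | RhoSplits ρ (∅ : Finset (Sym2 (X → Fin k))) x} = Set.univ := by
          ext x
          simp [RhoSplits, pairsAgreeing]
        rwa [this, probReal_univ]
      -- Any candidate serves as the centre of the ball, because `V` has diameter at most `4Δ`.
      · refine hs (f i) (hfC i) _ fun h g hp => ?_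
        rw [mem_farPairs] at hp
        obtain ⟨⟨j, hj, rfl⟩, ⟨j', hj', rfl⟩, hd⟩ := hp
        exact ⟨⟨hfC j, hV i hi j hj⟩, ⟨hfC j', hV i hi j' hj'⟩, hd⟩
    refine hspl.trans (measureReal_mono fun x hx y => ?_)
    refine ih (fun i hi j hj => hV i (Finset.mem_filter.1 hi).1 j (Finset.mem_filter.1 hj).1) ?_
    have h1 : ((farPairs μ f Δ (V.filter fun i => f i x = y)).card : ℝ) ≤
        (pairsAgreeing (farPairs μ f Δ V) x y).card := by
      exact_mod_cast Finset.card_le_card (farPairs_filter_subset μ f Δ V x y)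
    have h2 : (1 - ρ) * ((farPairs μ f Δ V).card : ℝ) ≤
        Real.exp (-ρ) * (farPairs μ f Δ V).card :=
      mul_le_mul_of_nonneg_right (by linarith [Real.add_one_le_exp (-ρ)]) (Nat.cast_nonneg _)
    refine (h1.trans ((hx y).trans h2)).trans_lt ?_
    have h3 : Real.exp (ρ * t) = Real.exp (-ρ) * Real.exp (ρ * (t + 1 : ℕ)) := by
      rw [← Real.exp_add]
      congr 1
      push_cast
      ring
    rw [h3]
    exact mul_lt_mul_of_pos_left ht (Real.exp_pos _)

/-- `J` phases of `T` rounds, each dividing the diameter by four. The scales `(ε/2)·4^J` are all at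
least `ε/2`, as splittability requires. -/
theorem solvable_mul [Fintype ι] (hfC : ∀ i, f i ∈ C) {ρ ε τ : ℝ} (hτ : τ ≤ 1)
    (hs : ∀ g ∈ C, ∀ Δ, ε / 2 ≤ Δ → Splittable μ (ball μ C g (4 * Δ)) ρ Δ τ) (hε : 0 ≤ ε) {T : ℕ}
    (hT : (Fintype.card ι : ℝ) ^ 2 < Real.exp (ρ * T)) (J : ℕ) {V : Finset ι}
    (hV : ∀ i ∈ V, ∀ j ∈ V, μ.real {x | f i x ≠ f j x} ≤ ε / 2 * 4 ^ J) :
    Solvable μ f τ (ε / 2) (J * T) V := by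
  induction J generalizing V with
  | zero => simpa [Solvable] using hV
  | succ J ih =>
    rw [Nat.succ_mul]
    have h4 : (1 : ℝ) ≤ 4 ^ J := one_le_pow₀ (by norm_num)
    refine solvable_add μ f hfC (Δ := ε / 2 * 4 ^ J) hτ (fun g hg => hs g hg _ (by nlinarith))
      (fun V hV => ih hV) T (fun i hi j hj => (hV i hi j hj).trans_eq (by ring)) ?_
    have h1 : ((farPairs μ f (ε / 2 * 4 ^ J) V).card : ℝ) ≤ (V.card : ℝ) ^ 2 := by
      exact_mod_cast card_farPairs_le μ f _ V
    have h2 : (V.card : ℝ) ≤ Fintype.card ι := by exact_mod_cast Finset.card_le_univ V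
    exact (h1.trans (pow_le_pow_left₀ (Nat.cast_nonneg _) h2 2)).trans_lt hT

end Solvable

/-! ### Learners as state machines, and supermartingale bounds -/

section Sampler

variable {X : Type*} [MeasurableSpace X] {k : ℕ} {σ : Type*}

/-- A learner with states in `σ`: in state `s` it waits for the next example in `region s`, requests
its label and moves on to the state `next s x y`; after `left s` further requests it halts and
returns `out`. -/
structure Sampler (X : Type*) [MeasurableSpace X] (k : ℕ) (σ : Type*) where
  init : σ
  region : σ → Set X
  next : σ → X → Fin k → σ
  left : σ → ℕ
  out : σ → X → Fin k
  measurableSet_region : ∀ s, MeasurableSet (region s)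
  measurableSet_next : ∀ s y s', MeasurableSet {x | next s x y = s'}
  measurable_out : ∀ s, Measurable (out s)
  left_next : ∀ s x y, left s ≠ 0 → left (next s x y) + 1 = left s

namespace Sampler

variable (S : Sampler X k σ)

/-- The state reached after the requests in `l`. -/
def state (x : ℕ → X) (l : List (ℕ × Fin k)) : σ :=
  l.foldl (fun s e => S.next s (x e.1) e.2) S.init

/-- The first example after the requests in `l`. -/
def pos (l : List (ℕ × Fin k)) : ℕ :=
  l.foldl (fun _ e => e.1 + 1) 0

open Classical in
/-- The action taken after the requests in `l`. -/
def step (x : ℕ → X) (l : List (ℕ × Fin k)) : Option (Action X k) :=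
  if S.left (S.state x l) = 0 then some (Action.output (S.out (S.state x l)))
  else if h : ∃ i, pos l ≤ i ∧ x i ∈ S.region (S.state x l) then
    some (Action.request (Nat.find h))
  else none

theorem state_append (x : ℕ → X) (l : List (ℕ × Fin k)) (i : ℕ) (y : Fin k) :
    S.state x (l ++ [(i, y)]) = S.next (S.state x l) (x i) y := by
  simp [state]

theorem pos_append (l : List (ℕ × Fin k)) (i : ℕ) (y : Fin k) : pos (l ++ [(i, y)]) = i + 1 := by
  simp [pos]

theorem step_eq_request_iff (x : ℕ → X) (l : List (ℕ × Fin k)) (i : ℕ) :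
    S.step x l = some (Action.request i) ↔ S.left (S.state x l) ≠ 0 ∧ pos l ≤ i ∧
      x i ∈ S.region (S.state x l) ∧ ∀ j, pos l ≤ j → j < i → x j ∉ S.region (S.state x l) := by
  classical
  rw [step]
  split_ifs with h1 h2
  · simp [h1]
  · rw [Option.some_inj, Action.request.injEq, Nat.find_eq_iff]
    constructor
    · rintro ⟨⟨h3, h4⟩, h5⟩
      exact ⟨h1, h3, h4, fun j hj hji hx => h5 j hji ⟨hj, hx⟩⟩
    · rintro ⟨-, h3, h4, h5⟩
      exact ⟨⟨h3, h4⟩, fun j hji hj => h5 j hj.1 hji hj.2⟩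
  · simp only [ne_eq, false_iff, not_and]
    exact fun _ h3 h4 => absurd ⟨i, h3, h4⟩ h2

theorem step_eq_output_iff (x : ℕ → X) (l : List (ℕ × Fin k)) (h : X → Fin k) :
    S.step x l = some (Action.output h) ↔ S.left (S.state x l) = 0 ∧ S.out (S.state x l) = h := by
  rw [step]
  split_ifs with h1 h2
  · simp [h1]
  · simp [h1]
  · simp [h1]

theorem state_congr {x x' : ℕ → X} {l : List (ℕ × Fin k)} (h : ∀ e ∈ l, x' e.1 = x e.1) :
    S.state x' l = S.state x l := by
  induction l using List.reverseRecOn with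
  | nil => rfl
  | append_singleton l e ih =>
    rw [state_append, state_append, ih fun e he => h e (List.mem_append_left _ he),
      h e (by simp)]

theorem measurableSet_state [Countable σ] (l : List (ℕ × Fin k)) (s : σ) :
    MeasurableSet {x : ℕ → X | S.state x l = s} := by
  induction l using List.reverseRecOn generalizing s with
  | nil => exact MeasurableSet.const (S.init = s)
  | append_singleton l e ih =>
    have : {x : ℕ → X | S.state x (l ++ [e]) = s} =
        ⋃ s', {x | S.state x l = s'} ∩ (fun x : ℕ → X => x e.1) ⁻¹' {x | S.next s' x e.2 = s} := by
      ext x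
      simp only [Set.mem_ofPred_eq, Set.mem_iUnion, Set.mem_inter_iff, Set.mem_preimage]
      rw [S.state_append x l e.1 e.2]
      simp
    rw [this]
    exact MeasurableSet.iUnion fun s' => (ih s').inter
      ((S.measurableSet_next s' e.2 s).preimage (measurable_pi_apply _))

/-- The active learning algorithm that runs a sampler. -/
def toAlgorithm [Countable σ] : Algorithm X k where
  step _ x l := S.step x l
  finite_use := by
    intro _ x l a ha
    obtain ⟨M, hM⟩ := (List.finite_toSet l).image Prod.fst |>.bddAbove
    have hst : ∀ x' : ℕ → X, (∀ i < M + 1, x' i = x i) → S.state x' l = S.state x l := fun x' hx' =>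
      S.state_congr fun e he => hx' _ (Nat.lt_succ_of_le (hM ⟨e, he, rfl⟩))
    cases a with
    | request i =>
      refine ⟨max (M + 1) (i + 1), fun x' hx' => ?_⟩
      rw [step_eq_request_iff] at ha ⊢
      rw [hst x' fun j hj => hx' j (hj.trans_le (le_max_left _ _))]
      obtain ⟨h1, h2, h3, h4⟩ := ha
      refine ⟨h1, h2, ?_, fun j hj hji => ?_⟩
      · rwa [hx' i ((Nat.lt_succ_self i).trans_le (le_max_right _ _))]
      · rw [hx' j ((hji.trans (Nat.lt_succ_self i)).trans_le (le_max_right _ _))]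
        exact h4 j hj hji
    | output h =>
      refine ⟨M + 1, fun x' hx' => ?_⟩
      rw [step_eq_output_iff] at ha ⊢
      rwa [hst x' hx']
  measurable_request := by
    intro l i
    have hR : ∀ (s : σ) (j : ℕ), MeasurableSet {x : ℕ → X | x j ∈ S.region s} := fun s j =>
      (S.measurableSet_region s).preimage (measurable_pi_apply j)
    have : {p : unitInterval × (ℕ → X) | S.step p.2 l = some (Action.request i)} =
        Prod.snd ⁻¹' ⋃ s, {x : ℕ → X | S.state x l = s} ∩ ({x | S.left s ≠ 0 ∧ pos l ≤ i} ∩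
          ({x | x i ∈ S.region s} ∩
            ⋂ j, ⋂ (_ : pos l ≤ j), ⋂ (_ : j < i), {x | x j ∈ S.region s}ᶜ)) := by
      ext p
      simp [step_eq_request_iff, and_assoc]
    rw [this]
    refine measurable_snd (MeasurableSet.iUnion fun s => (S.measurableSet_state l s).inter
      ((MeasurableSet.const _).inter ((hR s i).inter ?_)))
    exact MeasurableSet.iInter fun j => MeasurableSet.iInter fun _ => MeasurableSet.iInter fun _ =>
      (hR s j).compl
  measurable_output := by
    intro l y
    have : {p : (unitInterval × (ℕ → X)) × X |
        ∃ h, S.step p.1.2 l = some (Action.output h) ∧ h p.2 = y} =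
        ⋃ s, (fun p : (unitInterval × (ℕ → X)) × X => p.1.2) ⁻¹' {x | S.state x l = s} ∩
          ({p | S.left s = 0} ∩ Prod.snd ⁻¹' (S.out s ⁻¹' {y})) := by
      ext p
      simp [step_eq_output_iff, and_assoc]
    rw [this]
    exact MeasurableSet.iUnion fun s =>
      ((S.measurableSet_state l s).preimage (by fun_prop)).inter
        ((MeasurableSet.const _).inter
          (((measurableSet_singleton y).preimage (S.measurable_out s)).preimage measurable_snd))

open Classical in
/-- The effect of one labeled example on the state. -/
def move (s : σ) (z : X × Fin k) : σ :=
  if S.left s ≠ 0 ∧ z.1 ∈ S.region s then S.next s z.1 z.2 else s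

/-- The state after `n` examples have been read. -/
def run (z : ℕ → X × Fin k) : ℕ → σ
  | 0 => S.init
  | n + 1 => S.move (run z n) (z n)

/-- Simulation invariant between two clocks: transcripts advance per request, `run` advances per
example. The last clause says that the examples skipped since the last request lie outside the
current region, so the next hit is the one that `step` finds. -/
theorem exists_transcript_run [Countable σ] (ω : unitInterval) (z : ℕ → X × Fin k) (n : ℕ) :
    ∃ t, t + S.left (S.run z n) = S.left S.init ∧
      S.state (fun i => (z i).1) (S.toAlgorithm.transcript ω z t) = S.run z n ∧
      pos (S.toAlgorithm.transcript ω z t) ≤ n ∧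
      (S.left (S.run z n) ≠ 0 → ∀ i, pos (S.toAlgorithm.transcript ω z t) ≤ i → i < n →
        (z i).1 ∉ S.region (S.run z n)) := by
  induction n with
  | zero => exact ⟨0, by simp [run], rfl, le_rfl, fun _ i _ h => absurd h (Nat.not_lt_zero i)⟩
  | succ n ih =>
    obtain ⟨t, ht, hst, hpos, hno⟩ := ih
    by_cases hm : S.left (S.run z n) ≠ 0 ∧ (z n).1 ∈ S.region (S.run z n)
    · have hrun : S.run z (n + 1) = S.next (S.run z n) (z n).1 (z n).2 := by
        rw [run, move, if_pos hm]
      have hreq : S.toAlgorithm.step ω (fun i => (z i).1) (S.toAlgorithm.transcript ω z t) =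
          some (Action.request n) := by
        change S.step _ _ = _
        rw [step_eq_request_iff, hst]
        exact ⟨hm.1, hpos, hm.2, hno hm.1⟩
      have htr : S.toAlgorithm.transcript ω z (t + 1) =
          S.toAlgorithm.transcript ω z t ++ [(n, (z n).2)] := by
        rw [Algorithm.transcript_succ, hreq]
      refine ⟨t + 1, ?_, ?_, ?_, ?_⟩
      · rw [hrun]
        have := S.left_next _ (z n).1 (z n).2 hm.1
        omega
      · rw [htr, state_append, hst, hrun]
      · rw [htr, pos_append]
      · rw [htr, pos_append]
        intro _ i h1 h2
        omega
    · have hrun : S.run z (n + 1) = S.run z n := by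
        rw [run, move, if_neg hm]
      refine ⟨t, by rw [hrun, ht], by rw [hst, hrun], by omega, ?_⟩
      rw [hrun]
      intro h0 i h1 h2
      rcases Nat.lt_succ_iff_lt_or_eq.1 h2 with h | rfl
      · exact hno h0 i h1 h
      · exact fun hx => hm ⟨h0, hx⟩

theorem succeeds_of_run [Countable σ] {P : (X → Fin k) → Prop} (ω : unitInterval)
    {z : ℕ → X × Fin k} {n : ℕ} (h0 : S.left (S.run z n) = 0) (hP : P (S.out (S.run z n))) :
    S.toAlgorithm.Succeeds (S.left S.init) P ω z := by
  obtain ⟨t, ht, hst, -, -⟩ := S.exists_transcript_run ω z n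
  refine ⟨t, by omega, S.out (S.run z n), ?_, hP⟩
  change S.step _ _ = _
  rw [step_eq_output_iff, hst]
  exact ⟨h0, rfl⟩

section Potential

variable [Countable σ] [MeasurableSpace σ] [DiscreteMeasurableSpace σ]

theorem measurable_move (s : σ) : Measurable (S.move s) := by
  classical
  refine measurable_to_countable' fun s' => ?_
  have : S.move s ⁻¹' {s'} =
      ({z | S.left s ≠ 0} ∩ Prod.fst ⁻¹' S.region s ∩
        ⋃ y, (Prod.fst ⁻¹' {x | S.next s x y = s'} ∩ Prod.snd ⁻¹' {y})) ∪
      (({z | S.left s ≠ 0} ∩ Prod.fst ⁻¹' S.region s)ᶜ ∩ {z | s = s'}) := by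
    ext z
    by_cases hm : S.left s ≠ 0 ∧ z.1 ∈ S.region s
    · simp [move, hm.1, hm.2]
    · rw [Set.mem_preimage, move, if_neg hm]
      simp only [Set.mem_union, Set.mem_inter_iff, Set.mem_compl_iff, Set.mem_preimage,
        Set.mem_ofPred_eq, hm, Set.mem_singleton_iff, not_false_eq_true, true_and, false_and,
        false_or]
  rw [this]
  have hR : MeasurableSet ({z : X × Fin k | S.left s ≠ 0} ∩ Prod.fst ⁻¹' S.region s) :=
    (MeasurableSet.const _).inter ((S.measurableSet_region s).preimage measurable_fst)
  refine (hR.inter (MeasurableSet.iUnion fun y => ?_)).union (hR.compl.inter (MeasurableSet.const _))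
  exact ((S.measurableSet_next s y s').preimage measurable_fst).inter
    ((measurableSet_singleton y).preimage measurable_snd)

theorem measurable_uncurry_move : Measurable fun p : σ × (X × Fin k) => S.move p.1 p.2 :=
  measurable_from_prod_countable_right fun s => S.measurable_move s

theorem measurable_run (n : ℕ) : Measurable fun z : ℕ → X × Fin k => S.run z n := by
  induction n with
  | zero => exact measurable_const
  | succ n ih => exact S.measurable_uncurry_move.comp (ih.prodMk (measurable_pi_apply n))

theorem run_congr {z z' : ℕ → X × Fin k} {n : ℕ} (h : ∀ i < n, z i = z' i) :
    S.run z n = S.run z' n := by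
  induction n with
  | zero => rfl
  | succ n ih => rw [run, run, ih fun i hi => h i (by omega), h n (by omega)]

variable (D : Measure (X × Fin k)) [IsProbabilityMeasure D]

/-- The state depends on the first `n` coordinates only; padding with `z₀` makes it a function of
that finite block. -/
theorem indepFun_run (n : ℕ) : IndepFun (fun z : ℕ → X × Fin k => S.run z n) (fun z => z n)
    (Measure.infinitePi fun _ : ℕ => D) := by
  classical
  obtain ⟨z₀⟩ := nonempty_of_isProbabilityMeasure D
  have hind : iIndepFun (fun (i : ℕ) (z : ℕ → X × Fin k) => z i)
      (Measure.infinitePi fun _ : ℕ => D) :=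
    iIndepFun_infinitePi (P := fun _ : ℕ => D) (X := fun _ z => z) fun _ => measurable_id
  have h2 := hind.indepFun_finset (Finset.range n) {n} (by simp) fun i => measurable_pi_apply i
  have hext : Measurable fun (w : Finset.range n → X × Fin k) (i : ℕ) =>
      if h : i ∈ Finset.range n then w ⟨i, h⟩ else z₀ := by
    refine measurable_pi_iff.2 fun i => ?_
    by_cases h : i ∈ Finset.range n
    · simp only [h, dif_pos]
      exact measurable_pi_apply _
    · simp only [h, dif_neg, not_false_eq_true]
      exact measurable_const
  have h3 := h2.comp ((S.measurable_run n).comp hext)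
    (measurable_pi_apply (⟨n, by simp⟩ : ({n} : Finset ℕ)))
  have h4 : (fun z : ℕ → X × Fin k => S.run z n) = ((fun z => S.run z n) ∘ fun w i =>
      if h : i ∈ Finset.range n then w ⟨i, h⟩ else z₀) ∘ fun a (i : Finset.range n) => a i := by
    ext z
    refine S.run_congr fun i hi => ?_
    simp [hi]
  rw [h4]
  exact h3

theorem lintegral_run_succ (Φ : σ → ℝ≥0∞) (n : ℕ) :
    ∫⁻ z, Φ (S.run z (n + 1)) ∂(Measure.infinitePi fun _ : ℕ => D) =
      ∫⁻ z, (∫⁻ p, Φ (S.move (S.run z n) p) ∂D) ∂(Measure.infinitePi fun _ : ℕ => D) := by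
  have hΦ : Measurable Φ := measurable_of_countable _
  have hmove : Measurable fun p : σ × (X × Fin k) => Φ (S.move p.1 p.2) :=
    hΦ.comp S.measurable_uncurry_move
  have h1 := (indepFun_iff_map_prod_eq_prod_map_map (S.measurable_run n).aemeasurable
    (measurable_pi_apply n).aemeasurable).1 (S.indepFun_run D n)
  have h2 : (Measure.infinitePi fun _ : ℕ => D).map (fun z => z n) = D :=
    (measurePreserving_eval_infinitePi (fun _ : ℕ => D) n).map_eq
  rw [h2] at h1
  calc ∫⁻ z, Φ (S.run z (n + 1)) ∂(Measure.infinitePi fun _ : ℕ => D)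
      = ∫⁻ p, Φ (S.move p.1 p.2) ∂((Measure.infinitePi fun _ : ℕ => D).map
          fun z => (S.run z n, z n)) := by
        rw [lintegral_map hmove ((S.measurable_run n).prodMk (measurable_pi_apply n))]
        rfl
    _ = ∫⁻ s, ∫⁻ p, Φ (S.move s p) ∂D ∂((Measure.infinitePi fun _ : ℕ => D).map
          fun z => S.run z n) := by
        rw [h1, lintegral_prod _ hmove.aemeasurable]
    _ = _ := lintegral_map (measurable_of_countable _) (S.measurable_run n)

theorem lintegral_run_add_sum_le {Φ w : σ → ℝ≥0∞}
    (h : ∀ s, ∫⁻ p, Φ (S.move s p) ∂D + w s ≤ Φ s) (n : ℕ) :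
    ∫⁻ z, Φ (S.run z n) ∂(Measure.infinitePi fun _ : ℕ => D) +
      ∑ i ∈ Finset.range n, ∫⁻ z, w (S.run z i) ∂(Measure.infinitePi fun _ : ℕ => D) ≤
      Φ S.init := by
  induction n with
  | zero => simp [run]
  | succ n ih =>
    refine le_trans ?_ ih
    rw [Finset.sum_range_succ, add_comm (Finset.sum _ _), ← add_assoc]
    refine add_le_add_left ?_ _
    have hw : Measurable fun z : ℕ → X × Fin k => w (S.run z n) :=
      (measurable_of_countable w).comp (S.measurable_run n)
    rw [lintegral_run_succ, ← lintegral_add_right _ hw]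
    exact lintegral_mono fun z => h _

/-- Outside the region the state stands still, so the drift condition need only be checked on the
region. -/
theorem lintegral_move_add_le {Φ : σ → ℝ≥0∞} {s : σ} {w : ℝ≥0∞} (h0 : S.left s ≠ 0)
    (h : ∫⁻ p in {p | p.1 ∈ S.region s}, Φ (S.next s p.1 p.2) ∂D + w ≤
      Φ s * D {p | p.1 ∈ S.region s}) : ∫⁻ p, Φ (S.move s p) ∂D + w ≤ Φ s := by
  have hR : MeasurableSet {p : X × Fin k | p.1 ∈ S.region s} :=
    (S.measurableSet_region s).preimage measurable_fst
  rw [← lintegral_add_compl _ hR]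
  have h1 : ∫⁻ p in {p : X × Fin k | p.1 ∈ S.region s}, Φ (S.move s p) ∂D =
      ∫⁻ p in {p | p.1 ∈ S.region s}, Φ (S.next s p.1 p.2) ∂D := by
    refine setLIntegral_congr_fun hR fun p hp => ?_
    rw [move, if_pos ⟨h0, hp⟩]
  have h2 : ∫⁻ p in {p : X × Fin k | p.1 ∈ S.region s}ᶜ, Φ (S.move s p) ∂D =
      Φ s * D {p | p.1 ∈ S.region s}ᶜ := by
    rw [← setLIntegral_const]
    refine setLIntegral_congr_fun hR.compl fun p hp => ?_
    rw [move, if_neg fun hm => hp hm.2]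
  rw [h1, h2, add_right_comm]
  refine (add_le_add_left h _).trans_eq ?_
  rw [← mul_add, measure_add_measure_compl hR, measure_univ, mul_one]

theorem lintegral_move_of_left_eq_zero {Φ : σ → ℝ≥0∞} {s : σ} (h0 : S.left s = 0) :
    ∫⁻ p, Φ (S.move s p) ∂D = Φ s := by
  have : ∀ p, S.move s p = s := fun p => by rw [move, if_neg fun hm => hm.1 h0]
  simp [this]

/-- `left` itself is a potential with expected decrease at least `c` per example while the sampler
runs. Hence the probabilities of still running are summable. -/
theorem tendsto_measure_left_run {c : ℝ≥0∞} (hc : c ≠ 0)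
    (hreg : ∀ s, S.left s ≠ 0 → c ≤ D {p | p.1 ∈ S.region s}) :
    Filter.Tendsto (fun n => (Measure.infinitePi fun _ : ℕ => D) {z | S.left (S.run z n) ≠ 0})
      Filter.atTop (nhds 0) := by
  have hstep : ∀ s, ∫⁻ p, (S.left (S.move s p) : ℝ≥0∞) ∂D +
      {s | S.left s ≠ 0}.indicator (fun _ => c) s ≤ S.left s := by
    intro s
    by_cases h0 : S.left s = 0
    · rw [lintegral_move_of_left_eq_zero S D (Φ := fun s => (S.left s : ℝ≥0∞)) h0,
        Set.indicator_of_notMem (by simpa using h0), add_zero]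
    · rw [Set.indicator_of_mem (by exact h0)]
      refine S.lintegral_move_add_le D (Φ := fun s => (S.left s : ℝ≥0∞)) h0 ?_
      refine (add_le_add_right (hreg s h0) _).trans ?_
      obtain ⟨m, hm⟩ := Nat.exists_eq_succ_of_ne_zero h0
      have : ∀ p : X × Fin k, S.left (S.next s p.1 p.2) = m := fun p => by
        have := S.left_next s p.1 p.2 h0
        omega
      simp only [this, hm, setLIntegral_const, Nat.succ_eq_add_one, Nat.cast_add, Nat.cast_one,
        add_mul, one_mul, le_refl]
  have hsum : ∀ n, ∑ i ∈ Finset.range n, c * (Measure.infinitePi fun _ : ℕ => D)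
      {z | S.left (S.run z i) ≠ 0} ≤ S.left S.init := by
    intro n
    refine le_trans (le_trans ?_ le_add_self) (S.lintegral_run_add_sum_le D hstep n)
    refine Finset.sum_le_sum fun i _ => ?_
    have : MeasurableSet {z : ℕ → X × Fin k | S.left (S.run z i) ≠ 0} :=
      S.measurable_run i (MeasurableSet.of_discrete (s := {s | S.left s ≠ 0}))
    rw [← lintegral_indicator_const this]
    exact le_rfl
  have h1 : ∑' i, c * (Measure.infinitePi fun _ : ℕ => D) {z | S.left (S.run z i) ≠ 0} ≠ ⊤ :=
    ne_top_of_le_ne_top (ENNReal.natCast_ne_top _) (ENNReal.tsum_le_of_sum_range_le hsum)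
  rw [ENNReal.tsum_mul_left] at h1
  refine ENNReal.tendsto_atTop_zero_of_tsum_ne_top fun h => h1 ?_
  rw [h, ENNReal.mul_top hc]

/-- A supermartingale bound on the failure probability of a sampler. -/
theorem one_le_measure_succeeds_add {c : ℝ≥0∞} (hc : c ≠ 0)
    (hreg : ∀ s, S.left s ≠ 0 → c ≤ D {p | p.1 ∈ S.region s}) {Φ : σ → ℝ≥0∞}
    {P : (X → Fin k) → Prop}
    (hΦ : ∀ s, S.left s ≠ 0 → ∫⁻ p in {p | p.1 ∈ S.region s}, Φ (S.next s p.1 p.2) ∂D ≤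
      Φ s * D {p | p.1 ∈ S.region s})
    (hP : ∀ s, S.left s = 0 → ¬ P (S.out s) → 1 ≤ Φ s) :
    1 ≤ ((volume : Measure unitInterval).prod (Measure.infinitePi fun _ : ℕ => D))
      {z | S.toAlgorithm.Succeeds (S.left S.init) P z.1 z.2} + Φ S.init := by
  set ν := Measure.infinitePi fun _ : ℕ => D with hν
  set p := ((volume : Measure unitInterval).prod ν)
      {z | S.toAlgorithm.Succeeds (S.left S.init) P z.1 z.2} with hp
  have hstep : ∀ s, ∫⁻ p, Φ (S.move s p) ∂D + (fun _ => 0) s ≤ Φ s := by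
    intro s
    by_cases h0 : S.left s = 0
    · rw [lintegral_move_of_left_eq_zero S D h0, add_zero]
    · exact S.lintegral_move_add_le D h0 (by simpa using hΦ s h0)
  have hn : ∀ n, 1 ≤ ν {z | S.left (S.run z n) ≠ 0} + (p + Φ S.init) := by
    intro n
    -- After `n` examples the sampler is still running, has succeeded, or has `Φ ≥ 1`; Markov's
    -- inequality bounds the last event and the first vanishes as `n → ∞`.
    have hcov : (Set.univ : Set (ℕ → X × Fin k)) ⊆ {z | S.left (S.run z n) ≠ 0} ∪
        ({z | S.left (S.run z n) = 0 ∧ P (S.out (S.run z n))} ∪ {z | 1 ≤ Φ (S.run z n)}) := by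
      intro z _
      by_cases h0 : S.left (S.run z n) = 0
      · by_cases h1 : P (S.out (S.run z n))
        · exact Or.inr (Or.inl ⟨h0, h1⟩)
        · exact Or.inr (Or.inr (hP _ h0 h1))
      · exact Or.inl h0
    have h1 : ν {z | S.left (S.run z n) = 0 ∧ P (S.out (S.run z n))} ≤ p := by
      have : (Set.univ ×ˢ {z | S.left (S.run z n) = 0 ∧ P (S.out (S.run z n))} :
          Set (unitInterval × (ℕ → X × Fin k))) ⊆
          {z | S.toAlgorithm.Succeeds (S.left S.init) P z.1 z.2} := fun z hz =>
        S.succeeds_of_run z.1 hz.2.1 hz.2.2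
      refine le_trans ?_ (measure_mono this)
      rw [Measure.prod_prod, measure_univ, one_mul]
    have h2 : ν {z | 1 ≤ Φ (S.run z n)} ≤ Φ S.init := by
      have := S.lintegral_run_add_sum_le D hstep n
      simp only [lintegral_const, zero_mul, Finset.sum_const_zero, add_zero] at this
      refine le_trans ?_ this
      have hm := mul_meas_ge_le_lintegral (μ := ν)
        ((measurable_of_countable Φ).comp (S.measurable_run n)) 1
      rwa [one_mul] at hm
    calc (1 : ℝ≥0∞) = ν Set.univ := measure_univ.symm
      _ ≤ _ := measure_mono hcov
      _ ≤ _ := (measure_union_le _ _).trans (add_le_add_right ((measure_union_le _ _).trans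
          (add_le_add h1 h2)) _)
  have hlim := (S.tendsto_measure_left_run D hc hreg).add_const (p + Φ S.init)
  rw [zero_add] at hlim
  exact ge_of_tendsto' hlim hn

end Potential

end Sampler

end Sampler

/-! ### The voting learner and its potential -/

/-- The states of the voting learner. In `choose n V` it looks for a point that makes progress on the
candidates `V`, with `n` rounds left; in `vote n V p j L` it collects labels `L` of points at which
the candidates predict `p`, with `j + 1` labels to go. -/
inductive Phase (ι : Type*) (k : ℕ)
  | choose (n : ℕ) (V : Finset ι) : Phase ι k
  | vote (n : ℕ) (V : Finset ι) (p : ι → Fin k) (j : ℕ) (L : List (Fin k)) : Phase ι k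

instance Phase.measurableSpace (ι : Type*) (k : ℕ) : MeasurableSpace (Phase ι k) := ⊤

instance Phase.discreteMeasurableSpace (ι : Type*) (k : ℕ) : DiscreteMeasurableSpace (Phase ι k) :=
  ⟨fun _ => trivial⟩

instance Phase.countable (ι : Type*) [Finite ι] (k : ℕ) : Countable (Phase ι k) := by
  let e : Phase ι k → (ℕ × Finset ι) ⊕ (ℕ × Finset ι × (ι → Fin k) × ℕ × List (Fin k)) := fun s =>
    match s with
    | .choose n V => Sum.inl (n, V)
    | .vote n V p j L => Sum.inr (n, V, p, j, L)
  refine Function.Injective.countable (f := e) fun s s' h => ?_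
  cases s <;> cases s' <;> simp_all [e]

section Voting

variable {X : Type*} [MeasurableSpace X] {k : ℕ} {ι : Type*} [Fintype ι]

theorem measurableSet_pattern {f : ι → X → Fin k} (hf : ∀ i, Measurable (f i))
    (U : Set (ι → Fin k)) : MeasurableSet {x | (fun i => f i x) ∈ U} :=
  (Set.to_countable U).measurableSet.preimage (measurable_pi_iff.2 hf)

/-- The candidates whose prediction has an absolute majority in `L`. -/
def majoritySet (V : Finset ι) (p : ι → Fin k) (L : List (Fin k)) : Finset ι :=
  V.filter fun i => L.length < 2 * L.count (p i)

/-- Two labels cannot both have an absolute majority. The retained candidates therefore lie in a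
single label class, and solvability survives even when the vote is wrong. -/
theorem exists_majoritySet_subset (V : Finset ι) (p : ι → Fin k) (L : List (Fin k)) (y₀ : Fin k) :
    ∃ y, majoritySet V p L ⊆ V.filter fun i => p i = y := by
  by_cases h : ∃ y, L.length < 2 * L.count y
  · obtain ⟨y, hy⟩ := h
    refine ⟨y, fun i hi => ?_⟩
    rw [majoritySet, Finset.mem_filter] at hi
    refine Finset.mem_filter.2 ⟨hi.1, ?_⟩
    by_contra hne
    have h1 : L.count (p i) + L.count y ≤ L.length := by
      clear hy hi
      induction L with
      | nil => simp
      | cons a L ih =>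
        rw [List.count_cons, List.count_cons, List.length_cons]
        by_cases h1 : a = p i
        · have : a ≠ y := fun h2 => hne (h1.symm.trans h2)
          simp [h1, hne]
          omega
        · by_cases h2 : a = y
          · simp [h2, Ne.symm hne]
            omega
          · simp [h1, h2]
            omega
    have h2 := hi.2
    omega
  · refine ⟨y₀, fun i hi => absurd ⟨_, (Finset.mem_filter.1 hi).2⟩ h⟩

variable (μ : Measure X) [IsProbabilityMeasure μ] (f : ι → X → Fin k) (τ r : ℝ)

/-- The points that make progress on the candidates `V`. -/
def progressSet (n : ℕ) (V : Finset ι) : Set X :=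
  {x | ∀ y, Solvable μ f τ r n (V.filter fun i => f i x = y)}

/-- The points where the candidates predict `p`. -/
def patternSet (p : ι → Fin k) : Set X := {x | (fun i => f i x) = p}

open Classical in
/-- The points whose label the voting learner requests. -/
def votingRegion : Phase ι k → Set X
  | .choose 0 _ => Set.univ
  | .choose (n + 1) V =>
    -- The default `Set.univ` keeps the mass of every region bounded below, so that the learner
    -- almost surely halts.
    if τ ≤ μ.real (progressSet μ f τ r n V) then progressSet μ f τ r n V else Set.univ
  | .vote _ _ p _ _ => if μ (patternSet f p) ≠ 0 then patternSet f p else Set.univ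

/-- The transitions of the voting learner. -/
def votingNext (M : ℕ) : Phase ι k → X → Fin k → Phase ι k
  | .choose 0 V, _, _ => .choose 0 V
  -- The label of the point found is discarded; `M + 1` fresh ones follow, so a round costs `M + 2`
  -- requests.
  | .choose (n + 1) V, x, _ => .vote n V (fun i => f i x) M []
  | .vote n V p 0 L, _, y => .choose n (majoritySet V p (y :: L))
  | .vote n V p (j + 1) L, _, y => .vote n V p j (y :: L)

/-- The number of requests before the voting learner halts. -/
def votingLeft (M : ℕ) : Phase ι k → ℕ
  | .choose n _ => n * (M + 2)
  | .vote n _ _ j _ => n * (M + 2) + j + 1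

open Classical in
/-- The hypothesis returned by the voting learner. -/
def votingOut (i₀ : ι) : Phase ι k → X → Fin k
  | .choose _ V => if h : V.Nonempty then f h.choose else f i₀
  | .vote _ _ _ _ _ => f i₀

theorem measurableSet_votingRegion (hf : ∀ i, Measurable (f i)) (s : Phase ι k) :
    MeasurableSet (votingRegion μ f τ r s) := by
  match s with
  | .choose 0 _ => exact MeasurableSet.univ
  | .choose (n + 1) V =>
    rw [votingRegion]
    split
    · exact measurableSet_pattern hf
        {p | ∀ y, Solvable μ f τ r n (V.filter fun i => p i = y)}
    · exact MeasurableSet.univ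
  | .vote n V p j L =>
    rw [votingRegion]
    split
    · exact measurableSet_pattern hf {p}
    · exact MeasurableSet.univ

/-- The learner that looks for a point on which the candidates disagree, collects `M + 1` labels of
points that no candidate distinguishes from it, and keeps the candidates that agree with the
majority. -/
def votingSampler (hf : ∀ i, Measurable (f i)) (i₀ : ι) (R M : ℕ) : Sampler X k (Phase ι k) where
  init := .choose R Finset.univ
  region := votingRegion μ f τ r
  next := votingNext f M
  left := votingLeft M
  out := votingOut f i₀
  measurableSet_region := measurableSet_votingRegion μ f τ r hf
  measurableSet_next := by
    intro s y s'
    match s with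
    | .choose 0 V => exact MeasurableSet.const (Phase.choose 0 V = s')
    | .choose (n + 1) V => exact measurableSet_pattern hf {p | Phase.vote n V p M [] = s'}
    | .vote n V p 0 L =>
      exact MeasurableSet.const (Phase.choose n (majoritySet V p (y :: L)) = s')
    | .vote n V p (j + 1) L => exact MeasurableSet.const (Phase.vote n V p j (y :: L) = s')
  measurable_out := by
    intro s
    match s with
    | .choose _ V =>
      rw [votingOut]
      split
      · exact hf _
      · exact hf _
    | .vote _ _ _ _ _ => exact hf i₀
  left_next := by
    intro s x y h
    match s with
    | .choose 0 _ => simp [votingLeft] at h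
    | .choose (n + 1) V =>
      simp only [votingLeft, votingNext]
      ring
    | .vote n V p 0 L => rfl
    | .vote n V p (j + 1) L => rfl

/-- There are finitely many patterns, so those of positive mass have a least mass. It affects only
the number of unlabeled examples. -/
theorem exists_le_measure_votingRegion (hτ : 0 < τ) (hτ1 : τ ≤ 1) (M : ℕ) :
    ∃ c : ℝ≥0∞, c ≠ 0 ∧ ∀ s, votingLeft M s ≠ 0 → c ≤ μ (votingRegion μ f τ r s) := by
  classical
  set c := min (ENNReal.ofReal τ) ((Finset.univ : Finset (ι → Fin k)).inf fun p =>
    if μ (patternSet f p) ≠ 0 then μ (patternSet f p) else 1) with hc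
  have hcτ : c ≤ ENNReal.ofReal τ := min_le_left _ _
  have hc1 : c ≤ 1 := hcτ.trans (by simpa using hτ1)
  refine ⟨c, ?_, fun s hs => ?_⟩
  · refine (lt_min (ENNReal.ofReal_pos.2 hτ) ((Finset.lt_inf_iff (by simp)).2 fun p _ => ?_)).ne'
    split
    · rename_i h
      exact pos_iff_ne_zero.2 h
    · exact zero_lt_one
  · match s with
    | .choose 0 _ => simp [votingLeft] at hs
    | .choose (n + 1) V =>
      rw [votingRegion]
      split
      · rename_i h
        exact hcτ.trans (ENNReal.ofReal_le_of_le_toReal h)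
      · rwa [measure_univ]
    | .vote n V p j L =>
      rw [votingRegion]
      split
      · rename_i h
        refine (min_le_right _ _).trans ((Finset.inf_le (Finset.mem_univ p)).trans ?_)
        rw [if_pos h]
      · rwa [measure_univ]

variable (D : Measure (X × Fin k)) [IsProbabilityMeasure D]

theorem setLIntegral_le_of_le {R : Set (X × Fin k)} (hR : MeasurableSet R)
    {g : X × Fin k → ℝ≥0∞} {c : ℝ≥0∞} (h : ∀ z ∈ R, g z ≤ c) : ∫⁻ z in R, g z ∂D ≤ c * D R :=
  (setLIntegral_mono' hR h).trans_eq (setLIntegral_const _ _)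

theorem setLIntegral_le_of_le_of_le {R E : Set (X × Fin k)} (hR : MeasurableSet R)
    (hE : MeasurableSet E) {g : X × Fin k → ℝ≥0∞} {u v w : ℝ} (hu : 0 ≤ u) (hv : 0 ≤ v)
    (hw : 0 ≤ w) (h1 : ∀ z ∈ R, z ∈ E → g z ≤ ENNReal.ofReal u)
    (h2 : ∀ z ∈ R, z ∉ E → g z ≤ ENNReal.ofReal v)
    (h : u * D.real (R ∩ E) + v * (D.real R - D.real (R ∩ E)) ≤ w * D.real R) :
    ∫⁻ z in R, g z ∂D ≤ ENNReal.ofReal w * D R := by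
  have hsplit := measureReal_inter_add_sdiff (μ := D) (s := R) hE
  rw [← lintegral_inter_add_sdiff _ R hE]
  refine (add_le_add (setLIntegral_le_of_le D (hR.inter hE) fun z hz => h1 z hz.1 hz.2)
    (setLIntegral_le_of_le D (hR.diff hE) fun z hz => h2 z hz.1 hz.2)).trans ?_
  rw [← ofReal_measureReal (μ := D) (s := R), ← ofReal_measureReal (μ := D) (s := R ∩ E),
    ← ofReal_measureReal (μ := D) (s := R \ E), ← ENNReal.ofReal_mul hu, ← ENNReal.ofReal_mul hv,
    ← ENNReal.ofReal_mul hw, ← ENNReal.ofReal_add (by positivity) (by positivity)]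
  refine ENNReal.ofReal_le_ofReal ?_
  have : D.real (R \ E) = D.real R - D.real (R ∩ E) := by linarith
  rw [this]
  exact h

variable (γ δ' : ℝ) (t : ι)

/-- The labels at points with pattern `p` are likely to agree with the candidate `t`. -/
def ReliablePattern (p : ι → Fin k) : Prop :=
  0 < μ.real (patternSet f p) ∧
    D.real {z | z.1 ∈ patternSet f p ∧ z.2 ≠ p t} ≤ (1 / 2 - γ / 4) * μ.real (patternSet f p)

/-- The exponential weight of a list of labels, which is at least `1` if the label `y` has no
majority. -/
def voteWeight (y : Fin k) (L : List (Fin k)) : ℝ :=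
  Real.exp (γ / 4 * (L.length - 2 * L.count y))

theorem voteWeight_cons_self (y : Fin k) (L : List (Fin k)) :
    voteWeight γ y (y :: L) = Real.exp (-(γ / 4)) * voteWeight γ y L := by
  rw [voteWeight, voteWeight, ← Real.exp_add]
  congr 1
  rw [List.count_cons_self, List.length_cons]
  push_cast
  ring

theorem voteWeight_cons_of_ne {y y' : Fin k} (h : y' ≠ y) (L : List (Fin k)) :
    voteWeight γ y (y' :: L) = Real.exp (γ / 4) * voteWeight γ y L := by
  rw [voteWeight, voteWeight, ← Real.exp_add]
  congr 1
  rw [List.count_cons_of_ne h, List.length_cons]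
  push_cast
  ring

/-- With `x = γ/4` and `exp(±x) ≤ 1 ± x + x²`, the left side is at most `1 + x² - x(1 - 2a)`, and `1
- 2a ≥ γ/2`. -/
theorem exp_mul_add_exp_neg_mul_le {γ a : ℝ} (hγ0 : 0 ≤ γ) (hγ1 : γ ≤ 1)
    (ha : a ≤ 1 / 2 - γ / 4) (ha0 : 0 ≤ a) :
    Real.exp (γ / 4) * a + Real.exp (-(γ / 4)) * (1 - a) ≤ 1 - γ ^ 2 / 16 := by
  have h1 := (abs_le.1 (Real.abs_exp_sub_one_sub_id_le (x := γ / 4)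
    (by rw [abs_of_nonneg (by linarith)]; linarith))).2
  have h2 := (abs_le.1 (Real.abs_exp_sub_one_sub_id_le (x := -(γ / 4))
    (by rw [abs_neg, abs_of_nonneg (by linarith)]; linarith))).2
  have h3 := mul_le_mul_of_nonneg_right (sub_le_iff_le_add.1 (sub_le_iff_le_add.1 h1)) ha0
  have h4 := mul_le_mul_of_nonneg_right (sub_le_iff_le_add.1 (sub_le_iff_le_add.1 h2))
    (by linarith : 0 ≤ 1 - a)
  nlinarith

open Classical in
/-- The supermartingale that bounds the failure probability of the voting learner. -/
def votingPotential : Phase ι k → ℝ≥0∞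
  | .choose n V => if Solvable μ f τ r n V then
      ENNReal.ofReal (n * δ' + if t ∈ V then 0 else 1) else ⊤
  | .vote n V p j L => if ∀ y, Solvable μ f τ r n (V.filter fun i => p i = y) then
      ENNReal.ofReal (n * δ' + if t ∈ V ∧ ReliablePattern μ f D γ t p then
        voteWeight γ (p t) L * (1 - γ ^ 2 / 16) ^ (j + 1) else 1) else ⊤

variable {μ f τ r D γ δ' t}

/-- A round has budget `δ'`. Half pays for an unreliable pattern, of conditional probability at most
`δ'/2` since the progress set has mass at least `τ`; half pays for losing the vote on a reliable
one. -/
theorem lintegral_votingPotential_choose_le (hf : ∀ i, Measurable (f i)) (hγ0 : 0 < γ) (hγ1 : γ ≤ 1)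
    (hδ : 0 ≤ δ') (hμ : D.map Prod.fst = μ) {M : ℕ}
    (hM : (1 - γ ^ 2 / 16) ^ (M + 1) ≤ δ' / 2)
    (hbad : μ.real {x | ¬ ReliablePattern μ f D γ t (fun i => f i x)} ≤ δ' / 2 * τ)
    {n : ℕ} {V : Finset ι} (hS : Solvable μ f τ r (n + 1) V) :
    ∫⁻ z in {z | z.1 ∈ votingRegion μ f τ r (.choose (n + 1) V)},
      votingPotential μ f τ r D γ δ' t (votingNext f M (.choose (n + 1) V) z.1 z.2) ∂D ≤
      votingPotential μ f τ r D γ δ' t (.choose (n + 1) V) *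
        D {z | z.1 ∈ votingRegion μ f τ r (.choose (n + 1) V)} := by
  classical
  have hβ : 0 ≤ 1 - γ ^ 2 / 16 := by nlinarith
  have hreg : votingRegion μ f τ r (.choose (n + 1) V) = progressSet μ f τ r n V := by
    rw [votingRegion, if_pos]
    exact hS
  have hΦ : votingPotential μ f τ r D γ δ' t (.choose (n + 1) V) =
      ENNReal.ofReal ((n + 1 : ℕ) * δ' + if t ∈ V then 0 else 1) := by
    rw [votingPotential, if_pos hS]
  have hRm : MeasurableSet {z : X × Fin k | z.1 ∈ progressSet μ f τ r n V} := by
    have := measurableSet_votingRegion μ f τ r hf (.choose (n + 1) V)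
    rw [hreg] at this
    exact this.preimage measurable_fst
  have hEm : MeasurableSet {x | ¬ ReliablePattern μ f D γ t (fun i => f i x)} :=
    measurableSet_pattern hf {p | ¬ ReliablePattern μ f D γ t p}
  have hD : ∀ s : Set X, MeasurableSet s → D.real {z : X × Fin k | z.1 ∈ s} = μ.real s := by
    intro s hs
    rw [← hμ, map_measureReal_apply measurable_fst hs]
    rfl
  have hR : τ ≤ D.real {z : X × Fin k | z.1 ∈ progressSet μ f τ r n V} := by
    have := measurableSet_votingRegion μ f τ r hf (.choose (n + 1) V)
    rw [hreg] at this
    rw [hD _ this]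
    exact hS
  have hnext : ∀ z : X × Fin k, z.1 ∈ progressSet μ f τ r n V →
      votingPotential μ f τ r D γ δ' t (votingNext f M (.choose (n + 1) V) z.1 z.2) =
      ENNReal.ofReal (n * δ' + if t ∈ V ∧ ReliablePattern μ f D γ t (fun i => f i z.1) then
        (1 - γ ^ 2 / 16) ^ (M + 1) else 1) := by
    intro z hz
    rw [votingNext, votingPotential, if_pos (by exact hz)]
    simp [voteWeight]
  rw [hreg, hΦ]
  have hn0 : 0 ≤ (n : ℝ) * δ' := by positivity
  by_cases ht : t ∈ V
  · rw [if_pos ht, add_zero]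
    refine setLIntegral_le_of_le_of_le D hRm (hEm.preimage measurable_fst) (u := n * δ' + 1)
      (v := n * δ' + δ' / 2) (by linarith) (by linarith) (by positivity) ?_ ?_ ?_
    · intro z hz hE
      rw [hnext z hz, if_neg fun h => hE h.2]
    · intro z hz hE
      rw [hnext z hz, if_pos ⟨ht, not_not.1 hE⟩]
      exact ENNReal.ofReal_le_ofReal (by linarith)
    · have h1 : D.real ({z : X × Fin k | z.1 ∈ progressSet μ f τ r n V} ∩
          Prod.fst ⁻¹' {x | ¬ ReliablePattern μ f D γ t (fun i => f i x)}) ≤ δ' / 2 * τ := by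
        refine (measureReal_mono Set.inter_subset_right).trans ?_
        exact (hD _ hEm).le.trans hbad
      have h2 := measureReal_nonneg (μ := D) (s := ({z : X × Fin k | z.1 ∈ progressSet μ f τ r n V} ∩
          Prod.fst ⁻¹' {x | ¬ ReliablePattern μ f D γ t (fun i => f i x)}))
      push_cast
      nlinarith
  · rw [if_neg ht]
    refine setLIntegral_le_of_le D hRm fun z hz => ?_
    rw [hnext z hz, if_neg fun h => ht h.1]
    refine ENNReal.ofReal_le_ofReal ?_
    push_cast
    linarith

/-- On a reliable pattern one more label multiplies the expected weight by at most `1 - γ²/16`,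
which the power of that factor in the potential compensates. If `t` loses the vote, the final weight
is at least `1`. In the remaining case the potential already charges `1`. -/
theorem lintegral_votingPotential_vote_le (hf : ∀ i, Measurable (f i)) (hγ0 : 0 < γ) (hγ1 : γ ≤ 1)
    (hδ : 0 ≤ δ') (hμ : D.map Prod.fst = μ) {M n j : ℕ} {V : Finset ι} {p : ι → Fin k}
    {L : List (Fin k)} (hS : ∀ y, Solvable μ f τ r n (V.filter fun i => p i = y)) :
    ∫⁻ z in {z | z.1 ∈ votingRegion μ f τ r (.vote n V p j L)},
      votingPotential μ f τ r D γ δ' t (votingNext f M (.vote n V p j L) z.1 z.2) ∂D ≤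
      votingPotential μ f τ r D γ δ' t (.vote n V p j L) *
        D {z | z.1 ∈ votingRegion μ f τ r (.vote n V p j L)} := by
  classical
  have hβ : 0 ≤ 1 - γ ^ 2 / 16 := by nlinarith
  have hn0 : 0 ≤ (n : ℝ) * δ' := by positivity
  have hRm : MeasurableSet {z : X × Fin k | z.1 ∈ votingRegion μ f τ r (.vote n V p j L)} :=
    (measurableSet_votingRegion μ f τ r hf _).preimage measurable_fst
  rw [votingPotential, if_pos hS]
  have hmaj : ∀ y, Solvable μ f τ r n (majoritySet V p (y :: L)) := by
    intro y
    obtain ⟨y', hy'⟩ := exists_majoritySet_subset V p (y :: L) y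
    exact (hS y').mono μ f hy'
  by_cases hgood : t ∈ V ∧ ReliablePattern μ f D γ t p
  · rw [if_pos hgood]
    have hw : ∀ L, 0 ≤ voteWeight γ (p t) L := fun L => (Real.exp_pos _).le
    have hreg : votingRegion μ f τ r (.vote n V p j L) = patternSet f p := by
      rw [votingRegion, if_pos]
      intro h0
      have := hgood.2.1
      rw [measureReal_def, h0] at this
      simp at this
    have hnext : ∀ z : X × Fin k, votingPotential μ f τ r D γ δ' t
        (votingNext f M (.vote n V p j L) z.1 z.2) ≤
        ENNReal.ofReal (n * δ' + voteWeight γ (p t) (z.2 :: L) * (1 - γ ^ 2 / 16) ^ j) := by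
      intro z
      match j with
      | 0 =>
        rw [votingNext, votingPotential, if_pos (hmaj z.2)]
        refine ENNReal.ofReal_le_ofReal ?_
        rw [pow_zero, mul_one]
        refine add_le_add_right ?_ _
        split
        · exact hw _
        · rename_i hm
          rw [majoritySet, Finset.mem_filter, not_and] at hm
          have hm := not_lt.1 (hm hgood.1)
          rw [voteWeight]
          refine Real.one_le_exp (mul_nonneg (by linarith) ?_)
          have : (2 * (z.2 :: L).count (p t) : ℝ) ≤ (z.2 :: L).length := by exact_mod_cast hm
          linarith
      | j + 1 =>
        rw [votingNext, votingPotential, if_pos hS, if_pos hgood]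
    rw [hreg] at hRm ⊢
    set B := (1 - γ ^ 2 / 16) ^ j with hB
    have hB0 : 0 ≤ B := by positivity
    have hEm : MeasurableSet {z : X × Fin k | z.2 ≠ p t} :=
      ((measurableSet_singleton (p t)).preimage measurable_snd).compl
    have hDR : D.real {z : X × Fin k | z.1 ∈ patternSet f p} = μ.real (patternSet f p) := by
      have hpm : MeasurableSet (patternSet f p) := measurableSet_pattern hf {p}
      rw [← hμ, map_measureReal_apply measurable_fst hpm]
      rfl
    refine setLIntegral_le_of_le_of_le D hRm hEm
      (u := n * δ' + Real.exp (γ / 4) * voteWeight γ (p t) L * B)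
      (v := n * δ' + Real.exp (-(γ / 4)) * voteWeight γ (p t) L * B)
      (add_nonneg hn0 (mul_nonneg (mul_nonneg (Real.exp_pos _).le (hw L)) hB0))
      (add_nonneg hn0 (mul_nonneg (mul_nonneg (Real.exp_pos _).le (hw L)) hB0))
      (add_nonneg hn0 (mul_nonneg (hw L) (by positivity))) ?_ ?_ ?_
    · intro z _ hE
      refine (hnext z).trans_eq ?_
      rw [voteWeight_cons_of_ne γ hE]
    · intro z _ hE
      refine (hnext z).trans_eq ?_
      rw [not_not.1 hE, voteWeight_cons_self]
    · have hg := hgood.2.2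
      rw [hDR]
      have hE0 := measureReal_nonneg (μ := D)
        (s := {z : X × Fin k | z.1 ∈ patternSet f p} ∩ {z | z.2 ≠ p t})
      have hg' : D.real ({z : X × Fin k | z.1 ∈ patternSet f p} ∩ {z | z.2 ≠ p t}) ≤
          (1 / 2 - γ / 4) * μ.real (patternSet f p) := hg
      set e := D.real ({z : X × Fin k | z.1 ∈ patternSet f p} ∩ {z | z.2 ≠ p t}) with he
      set m := μ.real (patternSet f p) with hm
      have hmpos : 0 < m := hgood.2.1
      have key := exp_mul_add_exp_neg_mul_le hγ0.le hγ1 (a := e / m)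
        (by rwa [div_le_iff₀ hmpos]) (by positivity)
      have key2 := mul_le_mul_of_nonneg_right key hmpos.le
      have key3 : (Real.exp (γ / 4) * (e / m) + Real.exp (-(γ / 4)) * (1 - e / m)) * m =
          Real.exp (γ / 4) * e + Real.exp (-(γ / 4)) * (m - e) := by
        field_simp
      rw [key3] at key2
      have key4 := mul_le_mul_of_nonneg_left key2 (mul_nonneg (hw L) hB0)
      rw [pow_succ, ← hB]
      nlinarith
  · rw [if_neg hgood]
    refine setLIntegral_le_of_le D hRm fun z _ => ?_
    match j with
    | 0 =>
      rw [votingNext, votingPotential, if_pos (hmaj z.2)]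
      refine ENNReal.ofReal_le_ofReal (add_le_add_right ?_ _)
      split <;> norm_num
    | j + 1 => rw [votingNext, votingPotential, if_pos hS, if_neg hgood]

theorem one_le_measure_voting_succeeds_add (hf : ∀ i, Measurable (f i)) (i₀ : ι) {R M : ℕ}
    (hτ : 0 < τ) (hτ1 : τ ≤ 1) (hsolv : Solvable μ f τ r R Finset.univ)
    (hγ0 : 0 < γ) (hγ1 : γ ≤ 1)
    (hδ : 0 ≤ δ') (hμ : D.map Prod.fst = μ)
    (hM : (1 - γ ^ 2 / 16) ^ (M + 1) ≤ δ' / 2)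
    (hbad : μ.real {x | ¬ ReliablePattern μ f D γ t (fun i => f i x)} ≤ δ' / 2 * τ)
    {P : (X → Fin k) → Prop} (hP : ∀ i, μ.real {x | f i x ≠ f t x} ≤ r → P (f i)) :
    1 ≤ ((volume : Measure unitInterval).prod (Measure.infinitePi fun _ : ℕ => D))
      {z | (votingSampler μ f τ r hf i₀ R M).toAlgorithm.Succeeds (R * (M + 2)) P z.1 z.2} +
        ENNReal.ofReal (R * δ') := by
  classical
  obtain ⟨c, hc0, hc⟩ := exists_le_measure_votingRegion μ f τ r hτ hτ1 M
  have hDreg : ∀ s, D {z | z.1 ∈ votingRegion μ f τ r s} = μ (votingRegion μ f τ r s) := by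
    intro s
    have := Measure.map_apply (μ := D) measurable_fst (measurableSet_votingRegion μ f τ r hf s)
    rw [hμ] at this
    exact this.symm
  have hreg : ∀ s, votingLeft M s ≠ 0 → c ≤ D {z | z.1 ∈ votingRegion μ f τ r s} := fun s hs =>
    (hc s hs).trans_eq (hDreg s).symm
  have := (votingSampler μ f τ r hf i₀ R M).one_le_measure_succeeds_add D hc0 hreg
    (Φ := votingPotential μ f τ r D γ δ' t) (P := P) ?_ ?_
  · refine this.trans_eq ?_
    have h1 : votingPotential μ f τ r D γ δ' t (votingSampler μ f τ r hf i₀ R M).init =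
        ENNReal.ofReal (R * δ') := by
      change votingPotential μ f τ r D γ δ' t (.choose R Finset.univ) = _
      rw [votingPotential, if_pos hsolv, if_pos (Finset.mem_univ t), add_zero]
    rw [h1]
    rfl
  · intro s hs
    have hD0 := (lt_of_lt_of_le (pos_iff_ne_zero.2 hc0) (hreg s hs)).ne'
    change ∫⁻ z in {z | z.1 ∈ votingRegion μ f τ r s},
      votingPotential μ f τ r D γ δ' t (votingNext f M s z.1 z.2) ∂D ≤
      votingPotential μ f τ r D γ δ' t s * D {z | z.1 ∈ votingRegion μ f τ r s}
    match s with
    | .choose 0 V => exact absurd (Nat.zero_mul _) hs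
    | .choose (n + 1) V =>
      by_cases hS : Solvable μ f τ r (n + 1) V
      · exact lintegral_votingPotential_choose_le hf hγ0 hγ1 hδ hμ hM hbad hS
      · have : votingPotential μ f τ r D γ δ' t (.choose (n + 1) V) = ⊤ := by
          rw [votingPotential, if_neg hS]
        rw [this, ENNReal.top_mul hD0]
        exact le_top
    | .vote n V p j L =>
      by_cases hS : ∀ y, Solvable μ f τ r n (V.filter fun i => p i = y)
      · exact lintegral_votingPotential_vote_le hf hγ0 hγ1 hδ hμ hS
      · have : votingPotential μ f τ r D γ δ' t (.vote n V p j L) = ⊤ := by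
          rw [votingPotential, if_neg hS]
        rw [this, ENNReal.top_mul hD0]
        exact le_top
  · intro s hs hPs
    match s with
    | .vote n V p j L => exact absurd hs (Nat.succ_ne_zero _)
    | .choose (n + 1) V =>
      exact absurd hs (Nat.mul_ne_zero (Nat.succ_ne_zero _) (by omega))
    | .choose 0 V =>
      rw [votingPotential]
      split
      · rename_i hS
        have ht : t ∉ V := by
          intro ht
          refine hPs ?_
          change P (votingOut f i₀ (.choose 0 V))
          have hne : V.Nonempty := ⟨t, ht⟩
          rw [votingOut, dif_pos hne]
          exact hP _ (hS _ hne.choose_spec _ ht)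
        simp [ht]
      · exact le_top

end Voting

/-! ### Consequences of bounded noise -/

section BoundedNoise

variable {X : Type*} [MeasurableSpace X] {k : ℕ} {μ : Measure X} [IsProbabilityMeasure μ]

/-- Integrated form of the bounded noise condition. -/
def NoiseBounded (μ : Measure X) (D : ProbabilityMeasure (X × Fin k)) (α : ℝ) (h : X → Fin k) :
    Prop :=
  ∀ B : Set X, MeasurableSet B →
    (D : Measure (X × Fin k)).real {p | p.1 ∈ B ∧ p.2 ≠ h p.1} ≤ α * μ.real B

theorem exists_noiseBounded_of_mem_BN {C : Set (X → Fin k)} (hC : ∀ h ∈ C, Measurable h) {α : ℝ}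
    {D : ProbabilityMeasure (X × Fin k)} (hD : D ∈ BN C α μ) :
    ∃ h ∈ C, NoiseBounded μ D α h := by
  obtain ⟨hμ, h, hh, hle⟩ := hD
  refine ⟨h, hh, fun B hB => ?_⟩
  have hm : MeasurableSpace.comap Prod.fst inferInstance ≤
      (inferInstance : MeasurableSpace (X × Fin k)) := measurable_fst.comap_le
  have hE : MeasurableSet {p : X × Fin k | p.2 ≠ h p.1} :=
    (measurableSet_eq_fun measurable_snd ((hC h hh).comp measurable_fst)).compl
  have hs : MeasurableSet[MeasurableSpace.comap Prod.fst inferInstance]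
      (Prod.fst ⁻¹' B : Set (X × Fin k)) := ⟨B, hB, rfl⟩
  have hint : Integrable ({p : X × Fin k | p.2 ≠ h p.1}.indicator fun _ => (1 : ℝ))
      (D : Measure (X × Fin k)) := (integrable_const 1).indicator hE
  have h1 := setIntegral_condExp hm hint hs
  rw [setIntegral_indicator hE, setIntegral_const, smul_eq_mul, mul_one] at h1
  have h2 : {p : X × Fin k | p.1 ∈ B ∧ p.2 ≠ h p.1} = Prod.fst ⁻¹' B ∩ {p | p.2 ≠ h p.1} := rfl
  rw [h2, ← h1, ← hμ, map_measureReal_apply measurable_fst hB]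
  refine (setIntegral_mono_ae integrable_condExp.integrableOn
    (integrableOn_const (by simp)) hle).trans_eq ?_
  rw [setIntegral_const, smul_eq_mul, mul_comm]

variable {D : ProbabilityMeasure (X × Fin k)} {α : ℝ}

/-- Where `g` and `h` differ, `g` errs whenever `h` is right, and `h` is right at least half of the
time there. So the target attains the noise rate. -/
theorem err_le_err_of_noiseBounded (hμ : (D : Measure (X × Fin k)).map Prod.fst = μ)
    {h g : X → Fin k} (hh : Measurable h) (hg : Measurable g) (hα : α ≤ 1 / 2)
    (hD : NoiseBounded μ D α h) : err D h ≤ err D g := by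
  set B := {x | g x ≠ h x} with hB
  have hBm : MeasurableSet B := measurableSet_ne hg hh
  have hnoise := hD B hBm
  rw [← hμ, map_measureReal_apply measurable_fst hBm] at hnoise
  set N := {p : X × Fin k | p.1 ∈ B ∧ p.2 ≠ h p.1} with hN
  have hBm' : MeasurableSet (Prod.fst ⁻¹' B : Set (X × Fin k)) := hBm.preimage measurable_fst
  have hEh : MeasurableSet {p : X × Fin k | h p.1 ≠ p.2} :=
    (measurableSet_eq_fun (hh.comp measurable_fst) measurable_snd).compl
  have hNm : MeasurableSet N := by
    have : N = Prod.fst ⁻¹' B ∩ {p : X × Fin k | h p.1 ≠ p.2} := by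
      ext p
      simp [hN, eq_comm]
    rw [this]
    exact hBm'.inter hEh
  have hsplit := measureReal_inter_add_sdiff (μ := (D : Measure (X × Fin k)))
    (s := (Prod.fst ⁻¹' B : Set (X × Fin k))) hNm
  have hNB : (Prod.fst ⁻¹' B : Set (X × Fin k)) ∩ N = N :=
    Set.inter_eq_right.2 fun p hp => hp.1
  rw [hNB] at hsplit
  have hle : (D : Measure (X × Fin k)).real N ≤
      (D : Measure (X × Fin k)).real (Prod.fst ⁻¹' B \ N) := by
    have := measureReal_nonneg (μ := (D : Measure (X × Fin k)))
      (s := (Prod.fst ⁻¹' B : Set (X × Fin k)))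
    nlinarith
  have hle' : (D : Measure (X × Fin k)) N ≤ (D : Measure (X × Fin k)) (Prod.fst ⁻¹' B \ N) := by
    rwa [← ENNReal.toReal_le_toReal (measure_ne_top _ _) (measure_ne_top _ _)]
  rw [err, err, ← measure_inter_add_sdiff _ hBm', ← measure_inter_add_sdiff
    {p : X × Fin k | g p.1 ≠ p.2} hBm']
  refine add_le_add (le_trans (measure_mono ?_) (hle'.trans (measure_mono ?_))) (measure_mono ?_)
  · rintro p ⟨hp, hpB⟩
    exact ⟨hpB, Ne.symm hp⟩
  · rintro p ⟨hpB, hp⟩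
    refine ⟨fun hgp => hp ⟨hpB, fun hph => hpB (hgp.trans hph)⟩, hpB⟩
  · rintro p ⟨hp, hpB⟩
    refine ⟨?_, hpB⟩
    have : g p.1 = h p.1 := not_not.1 hpB
    change g p.1 ≠ p.2
    rw [this]
    exact hp

theorem err_le_err_add (hμ : (D : Measure (X × Fin k)).map Prod.fst = μ)
    {h g : X → Fin k} (hh : Measurable h) (hg : Measurable g) :
    err D g ≤ err D h + μ {x | g x ≠ h x} := by
  rw [← hμ, Measure.map_apply measurable_fst (measurableSet_ne hg hh)]
  refine (measure_mono ?_).trans (measure_union_le _ _)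
  intro p hp
  by_cases hgh : g p.1 = h p.1
  · left
    change h p.1 ≠ p.2
    rw [← hgh]
    exact hp
  · exact Or.inr hgh

theorem err_le_noiseRate_add (hμ : (D : Measure (X × Fin k)).map Prod.fst = μ)
    {C : Set (X → Fin k)} (hC : ∀ h ∈ C, Measurable h) (hα : α ≤ 1 / 2)
    {h g : X → Fin k} (hh : h ∈ C) (hg : Measurable g) (hD : NoiseBounded μ D α h) {ε : ℝ}
    (hε : μ.real {x | g x ≠ h x} ≤ ε) : err D g ≤ noiseRate C D + ENNReal.ofReal ε := by
  refine (err_le_err_add hμ (hC h hh) hg).trans (add_le_add ?_ ?_)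
  · exact le_iInf₂ fun g' hg' => err_le_err_of_noiseBounded hμ (hC h hh) (hC g' hg') hα hD
  · rw [← ofReal_measureReal (μ := μ)]
    exact ENNReal.ofReal_le_ofReal hε

theorem measureReal_ne_le_add (f g h : X → Fin k) :
    μ.real {x | f x ≠ h x} ≤ μ.real {x | f x ≠ g x} + μ.real {x | g x ≠ h x} := by
  refine (measureReal_mono ?_).trans (measureReal_union_le _ _)
  intro x hx
  by_cases hfg : f x = g x
  · right
    change g x ≠ h x
    rw [← hfg]
    exact hx
  · exact Or.inl hfg

/-- If some candidate is close to the target, a random pattern is probably reliable. -/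
theorem measure_not_reliablePattern_le {ι : Type*} [Fintype ι] {f : ι → X → Fin k}
    (hf : ∀ i, Measurable (f i)) (hμ : (D : Measure (X × Fin k)).map Prod.fst = μ)
    {h : X → Fin k} (hh : Measurable h) (hD : NoiseBounded μ D α h) (hα : α < 1 / 2) (t : ι) :
    (1 - 2 * α) / 4 * μ.real {x | ¬ ReliablePattern μ f D (1 - 2 * α) t (fun i => f i x)} ≤
      μ.real {x | f t x ≠ h x} := by
  classical
  set W := {x | f t x ≠ h x} with hW
  have hWm : MeasurableSet W := measurableSet_ne (hf t) hh
  have hpm : ∀ p, MeasurableSet (patternSet f p) := fun p => measurableSet_pattern hf {p}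
  set bad := (Finset.univ : Finset (ι → Fin k)).filter fun p =>
    ¬ ReliablePattern μ f D (1 - 2 * α) t p with hbad
  -- Labels on an unreliable pattern of positive mass differ from `p t` on more than a fraction `1/2
  -- - γ/4`, where `γ = 1 - 2α`. Noise explains at most `α = 1/2 - γ/2`, so `f t ≠ h` on at least
  -- the remaining `γ/4`.
  have hp : ∀ p ∈ bad, (1 - 2 * α) / 4 * μ.real (patternSet f p) ≤
      μ.real (patternSet f p ∩ W) := by
    intro p hp
    have hp := (Finset.mem_filter.1 hp).2
    by_cases h0 : 0 < μ.real (patternSet f p)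
    · rw [ReliablePattern, not_and] at hp
      have hp := not_le.1 (hp h0)
      have h1 := hD _ (hpm p)
      have h2 : (D : Measure (X × Fin k)).real {z | z.1 ∈ patternSet f p ∧ z.2 ≠ p t} ≤
          (D : Measure (X × Fin k)).real {z | z.1 ∈ patternSet f p ∧ z.2 ≠ h z.1} +
          (D : Measure (X × Fin k)).real (Prod.fst ⁻¹' (patternSet f p ∩ W)) := by
        refine (measureReal_mono ?_).trans (measureReal_union_le _ _)
        rintro z ⟨hz, hzt⟩
        by_cases hz2 : z.2 = h z.1
        · right
          refine ⟨hz, fun hft => hzt ?_⟩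
          have : f t z.1 = p t := congrFun hz t
          rw [hz2, ← hft, this]
        · exact Or.inl ⟨hz, hz2⟩
      have h3 : (D : Measure (X × Fin k)).real (Prod.fst ⁻¹' (patternSet f p ∩ W)) =
          μ.real (patternSet f p ∩ W) := by
        rw [← hμ, map_measureReal_apply measurable_fst ((hpm p).inter hWm)]
      rw [h3] at h2
      linarith
    · have : μ.real (patternSet f p) = 0 := le_antisymm (not_lt.1 h0) measureReal_nonneg
      rw [this, mul_zero]
      exact measureReal_nonneg
  have hsub : {x | ¬ ReliablePattern μ f D (1 - 2 * α) t (fun i => f i x)} ⊆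
      ⋃ p ∈ bad, patternSet f p := by
    intro x hx
    exact Set.mem_biUnion (x := fun i => f i x)
      (Finset.mem_coe.2 (Finset.mem_filter.2 ⟨Finset.mem_univ _, hx⟩)) rfl
  have hdisj : (bad : Set (ι → Fin k)).PairwiseDisjoint fun p => patternSet f p ∩ W := by
    intro p _ q _ hpq
    refine Set.disjoint_left.2 fun x hx hx' => hpq ?_
    exact hx.1.symm.trans hx'.1
  calc (1 - 2 * α) / 4 * μ.real {x | ¬ ReliablePattern μ f D (1 - 2 * α) t (fun i => f i x)}
      ≤ (1 - 2 * α) / 4 * ∑ p ∈ bad, μ.real (patternSet f p) :=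
        mul_le_mul_of_nonneg_left ((measureReal_mono hsub (measure_ne_top _ _)).trans
          (measureReal_biUnion_finset_le _ _)) (by linarith)
    _ ≤ ∑ p ∈ bad, μ.real (patternSet f p ∩ W) := by
        rw [Finset.mul_sum]
        exact Finset.sum_le_sum hp
    _ = μ.real (⋃ p ∈ bad, patternSet f p ∩ W) :=
        (measureReal_biUnion_finset hdisj fun p _ => (hpm p).inter hWm).symm
    _ ≤ μ.real W := measureReal_mono (Set.iUnion₂_subset fun p _ => Set.inter_subset_right)

end BoundedNoise

/-! ### Upper bound from a cover -/

section UpperBound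

variable {X : Type*} [MeasurableSpace X] {k : ℕ} (μ : Measure X) [IsProbabilityMeasure μ]

/-- The learner must only keep a cover element `g` near the target: its output is then within `ε/2`
of `g` and within `ε/2 + r ≤ ε` of the target. The hypothesis `hr` makes unreliable patterns rare
even conditionally on a progress set. -/
theorem QCAL_le_of_cover {C : Set (X → Fin k)} (hC : ∀ h ∈ C, Measurable h) {α ε δ : ℝ}
    (hα0 : 0 ≤ α) (hα : α < 1 / 2) (hε : 0 ≤ ε) {V : Finset (X → Fin k)}
    (hVC : ∀ h ∈ V, h ∈ C) (hVne : V.Nonempty) {r : ℝ} (hrε : r ≤ ε / 2)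
    (hcover : ∀ h ∈ C, ∃ g ∈ V, μ.real {x | g x ≠ h x} ≤ r) {ρ τ : ℝ} (hτ : 0 < τ) (hτ1 : τ ≤ 1)
    (hs : ∀ g ∈ C, ∀ Δ, ε / 2 ≤ Δ → Splittable μ (ball μ C g (4 * Δ)) ρ Δ τ) {J T M : ℕ}
    (hJ : 1 ≤ ε / 2 * 4 ^ J) (hT : (V.card : ℝ) ^ 2 < Real.exp (ρ * T)) {δ' : ℝ} (hδ' : 0 ≤ δ')
    (hM : (1 - (1 - 2 * α) ^ 2 / 16) ^ (M + 1) ≤ δ' / 2)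
    (hr : r ≤ (1 - 2 * α) / 4 * (δ' / 2 * τ)) (hδ : (J * T : ℕ) * δ' ≤ δ) :
    QCAL ε δ C (BN C α μ) ≤ (J * T * (M + 2) : ℕ) := by
  obtain ⟨h₀, hh₀⟩ := hVne
  set f : V → X → Fin k := Subtype.val with hf
  have hfC : ∀ i, f i ∈ C := fun i => hVC i i.2
  have hfm : ∀ i, Measurable (f i) := fun i => hC _ (hfC i)
  have hsolv : Solvable μ f τ (ε / 2) (J * T) Finset.univ :=
    solvable_mul μ f hfC hτ1 hs hε (by rwa [Fintype.card_coe]) J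
      fun i _ j _ => measureReal_le_one.trans hJ
  generalize hR : J * T = R at hsolv hδ ⊢
  rw [QCAL]
  refine iInf₂_le_of_le (R * (M + 2)) ⟨(votingSampler μ f τ (ε / 2) hfm ⟨h₀, hh₀⟩ R M).toAlgorithm,
    ?_⟩ le_rfl
  intro D hD
  obtain ⟨h, hh, hnb⟩ := exists_noiseBounded_of_mem_BN hC hD
  obtain ⟨g, hg, hgr⟩ := hcover h hh
  have hbad := measure_not_reliablePattern_le hfm hD.1 (hC h hh) hnb hα ⟨g, hg⟩
  have hγ : 0 < (1 - 2 * α) / 4 := by linarith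
  have hbad' := le_of_mul_le_mul_left (hbad.trans (hgr.trans hr)) hγ
  have hP : ∀ i, μ.real {x | f i x ≠ f ⟨g, hg⟩ x} ≤ ε / 2 →
      err D (f i) ≤ noiseRate C D + ENNReal.ofReal ε := fun i hi =>
    err_le_noiseRate_add hD.1 hC hα.le hh (hfm i) hnb
      ((measureReal_ne_le_add _ g _).trans (by
        have hi' : μ.real {x | f i x ≠ g x} ≤ ε / 2 := hi
        linarith))
  have hsucc := one_le_measure_voting_succeeds_add (M := M) hfm ⟨h₀, hh₀⟩ hτ hτ1 hsolv
    (by linarith) (by linarith) hδ' hD.1 hM hbad'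
    (P := fun h => err D h ≤ noiseRate C D + ENNReal.ofReal ε) hP
  rw [ENNReal.ofReal_sub _ (le_trans (by positivity) hδ), ENNReal.ofReal_one, tsub_le_iff_right]
  exact hsucc.trans (add_le_add_right (ENNReal.ofReal_le_ofReal hδ) _)

/-- No labels are needed if the class has small diameter. -/
theorem QCAL_eq_zero_of_diam_le {C : Set (X → Fin k)} (hC : ∀ h ∈ C, Measurable h)
    (hne : C.Nonempty) {α ε δ : ℝ} (hα : α ≤ 1 / 2) (hδ : 0 ≤ δ)
    (hdiam : ∀ h ∈ C, ∀ g ∈ C, μ.real {x | h x ≠ g x} ≤ ε) : QCAL ε δ C (BN C α μ) = 0 := by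
  obtain ⟨g, hg⟩ := hne
  rw [← nonpos_iff_eq_zero]
  let A : Algorithm X k :=
    { step := fun _ _ _ => some (Action.output g)
      finite_use := fun _ _ _ _ ha => ⟨0, fun _ _ => ha⟩
      measurable_request := fun _ _ => by simp
      measurable_output := fun _ y => by
        have : {p : (unitInterval × (ℕ → X)) × X | ∃ h, some (Action.output g) =
            some (Action.output h) ∧ h p.2 = y} = Prod.snd ⁻¹' (g ⁻¹' {y}) := by
          ext p
          simp
        rw [this]
        exact ((measurableSet_singleton y).preimage (hC g hg)).preimage measurable_snd }
  refine iInf₂_le 0 ⟨A, fun D hD => ?_⟩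
  obtain ⟨h, hh, hnb⟩ := exists_noiseBounded_of_mem_BN hC hD
  have : {z : unitInterval × (ℕ → X × Fin k) | A.Succeeds 0
      (fun h => err D h ≤ noiseRate C D + ENNReal.ofReal ε) z.1 z.2} = Set.univ := by
    refine Set.eq_univ_of_forall fun z => ⟨0, le_rfl, g, rfl, ?_⟩
    exact err_le_noiseRate_add hD.1 hC hα hh (hC g hg) hnb (hdiam g hg h hh)
  rw [this, measure_univ]
  simpa using hδ

end UpperBound

/-! ### Bounds on the splitting index -/

section SplittingIndex

variable {X : Type*} [MeasurableSpace X] {k : ℕ} (μ : Measure X) [IsProbabilityMeasure μ]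

theorem splittable_of_lt_splittingIndex {C : Set (X → Fin k)} {τ ε : ℝ} {ρ : ℝ≥0}
    (h : (ρ : ℝ≥0∞) < splittingIndex μ C τ ε) {g : X → Fin k} (hg : g ∈ C) {Δ : ℝ}
    (hΔ : ε / 2 ≤ Δ) : Splittable μ (ball μ C g (4 * Δ)) ρ Δ τ := by
  have h1 := h.trans_le (iInf₂_le g hg)
  rw [splittingIndexAt] at h1
  simp only [lt_iSup_iff] at h1
  obtain ⟨ρ', hρ', hlt⟩ := h1
  exact (hρ' Δ hΔ).anti_rho μ (by exact_mod_cast hlt.le)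

/-- For `ρ > 1` no point splits a nonempty set of pairs, and a single far pair is such a set. -/
theorem splittingIndex_le_one {C : Set (X → Fin k)} {τ ε : ℝ} (hτ : 0 < τ) (hε : 0 ≤ ε)
    {h g : X → Fin k} (hh : h ∈ C) (hg : g ∈ C) (hd : ε / 2 < μ.real {x | h x ≠ g x}) :
    splittingIndex μ C τ ε ≤ 1 := by
  refine (iInf₂_le h hh).trans (iSup₂_le fun ρ hρ => ?_)
  by_contra hcon
  have hρ1 : (1 : ℝ) < ρ := by exact_mod_cast not_le.1 hcon
  set d := μ.real {x | h x ≠ g x} with hd'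
  have hsp := hρ (max (ε / 2) (d / 2)) (le_max_left _ _) {s(h, g)} (by
    intro h' g' hp
    have hmax := le_max_right (ε / 2) (d / 2)
    have hmax' : max (ε / 2) (d / 2) < d := max_lt hd (by linarith)
    have hhb : h ∈ ball μ C h (4 * max (ε / 2) (d / 2)) := ⟨hh, by
      have : {x | h x ≠ h x} = ∅ := by simp
      rw [this, measureReal_empty]
      linarith⟩
    have hgb : g ∈ ball μ C h (4 * max (ε / 2) (d / 2)) := ⟨hg, by rw [← hd']; linarith⟩
    rcases Sym2.eq_iff.1 (Finset.mem_singleton.1 hp) with ⟨rfl, rfl⟩ | ⟨rfl, rfl⟩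
    · exact ⟨hhb, hgb, hmax'⟩
    · refine ⟨hgb, hhb, hmax'.trans_eq ?_⟩
      simp only [hd', ne_comm])
  have : {x | RhoSplits (ρ : ℝ) {s(h, g)} x} = ∅ := by
    ext x
    simp only [Set.mem_ofPred_eq, Set.mem_empty_iff_false, iff_false]
    intro hx
    have h1 := hx (h x)
    have h2 : (0 : ℝ) ≤ (pairsAgreeing {s(h, g)} x (h x)).card := Nat.cast_nonneg _
    simp only [Finset.card_singleton, Nat.cast_one, mul_one] at h1
    linarith
  rw [this, measureReal_empty] at hsp
  linarith

end SplittingIndex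

/-! ### Choice of constants -/

section Constants

/-- The left side grows like `log B`, so a large square works. The factor `768 = 32 · 24` comes from
comparing the cover radius with the number of rounds. -/
theorem exists_packing_scale {K : ℝ} (hK : 1 ≤ K) :
    ∃ B : ℝ, 1 ≤ B ∧ 768 * (2 * (Real.log (8 * K * B) + 7)) ≤ B := by
  have hK0 : 0 ≤ Real.log (8 * K) := Real.log_nonneg (by linarith)
  set s := 3072 + 1536 * (Real.log (8 * K) + 7) with hs
  have hs1 : 1 ≤ s := by linarith
  refine ⟨s ^ 2, one_le_pow₀ hs1, ?_⟩
  rw [Real.log_mul (by positivity) (by positivity), Real.log_pow]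
  have := Real.log_le_sub_one_of_pos (by linarith : 0 < s)
  push_cast
  nlinarith

/-- The factor in the bound on the number of rounds. -/
def roundConst (K B : ℝ) : ℝ := 2 * (Real.log (8 * K * B) + 7)

theorem roundConst_ge {K B : ℝ} (hK : 1 ≤ K) (hB : 1 ≤ B) : 14 ≤ roundConst K B := by
  have : 0 ≤ Real.log (8 * K * B) := Real.log_nonneg (by nlinarith)
  rw [roundConst]
  linarith

/-- The terms in `log d` are absorbed by a second factor `d`. -/
theorem log_cover_le {K B d Λ : ℝ} (hK : 1 ≤ K) (hB : 1 ≤ B) (hd : 1 ≤ d) (hΛ : 256 ≤ Λ) :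
    2 * d * Real.log (8 * K * d / (1 / (B * d ^ 2 * Λ ^ 4))) ≤
      roundConst K B * d ^ 2 * Real.log Λ := by
  have h8 : 0 ≤ Real.log (8 * K * B) := Real.log_nonneg (by nlinarith)
  have hL : 1 ≤ Real.log Λ := by
    rw [Real.le_log_iff_exp_le (by linarith)]
    linarith [Real.exp_one_lt_d9]
  have h1 : 8 * K * d / (1 / (B * d ^ 2 * Λ ^ 4)) = 8 * K * B * (d ^ 3 * Λ ^ 4) := by
    field_simp
  have h2 : Real.log (8 * K * d / (1 / (B * d ^ 2 * Λ ^ 4))) =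
      Real.log (8 * K * B) + (3 * Real.log d + 4 * Real.log Λ) := by
    rw [h1, Real.log_mul (x := 8 * K * B) (by positivity) (by positivity),
      Real.log_mul (x := d ^ 3) (by positivity) (by positivity), Real.log_pow, Real.log_pow]
    norm_num
  have hld := Real.log_le_sub_one_of_pos (by linarith : 0 < d)
  have hdL : 1 ≤ d * Real.log Λ := one_le_mul_of_one_le_of_one_le hd hL
  have h3 : Real.log (8 * K * B) + (3 * Real.log d + 4 * Real.log Λ) ≤
      d * Real.log Λ * (Real.log (8 * K * B) + 7) := by
    nlinarith [mul_le_mul_of_nonneg_right hdL h8]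
  rw [h2, roundConst]
  calc 2 * d * (Real.log (8 * K * B) + (3 * Real.log d + 4 * Real.log Λ))
      ≤ 2 * d * (d * Real.log Λ * (Real.log (8 * K * B) + 7)) :=
        mul_le_mul_of_nonneg_left h3 (by linarith)
    _ = _ := by ring

theorem pow_vote_le {γ η : ℝ} (hγ : 0 < γ) (hγ1 : γ ≤ 1) (hη : 0 < η) :
    (1 - γ ^ 2 / 16) ^ (⌊16 * Real.log (1 / η) / γ ^ 2⌋₊ + 1) ≤ η := by
  set M := ⌊16 * Real.log (1 / η) / γ ^ 2⌋₊ with hM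
  have h1 : 1 - γ ^ 2 / 16 ≤ Real.exp (-(γ ^ 2 / 16)) := by
    linarith [Real.add_one_le_exp (-(γ ^ 2 / 16))]
  have h2 := Nat.lt_floor_add_one (16 * Real.log (1 / η) / γ ^ 2)
  rw [div_lt_iff₀ (by positivity), ← hM] at h2
  calc (1 - γ ^ 2 / 16) ^ (M + 1) ≤ Real.exp (-(γ ^ 2 / 16)) ^ (M + 1) :=
        pow_le_pow_left₀ (by nlinarith) h1 _
    _ = Real.exp (-(γ ^ 2 / 16) * (M + 1)) := by
        rw [← Real.exp_nat_mul]
        congr 1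
        push_cast
        ring
    _ ≤ Real.exp (Real.log η) := by
        refine Real.exp_le_exp.2 ?_
        rw [one_div, Real.log_inv] at h2
        linarith
    _ = η := Real.exp_log hη

end Constants

/-! ### Upper bound: assembling the parameters -/

section UpperBound

/-- The factor in the upper bound on the query complexity. -/
def queryConst (K B : ℝ) : ℝ :=
  216 * roundConst K B * (Real.log (48 * roundConst K B) + 6)

theorem queryConst_pos {K B : ℝ} (hK : 1 ≤ K) (hB : 1 ≤ B) : 0 < queryConst K B := by
  have hA := roundConst_ge hK hB
  have : 0 ≤ Real.log (48 * roundConst K B) := Real.log_nonneg (by linarith)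
  rw [queryConst]
  positivity

/-- Rounds contribute `d²L²/ρ` and votes per round `dL/γ²`. This gives `L³`, which is weakened to
`L⁵`. -/
theorem query_count_le {A d L Λ γ ρ ϱ δ : ℝ} {R : ℕ} (hA : 14 ≤ A) (hd : 1 ≤ d)
    (hL : L = Real.log Λ) (hL1 : 1 ≤ L) (hΛ : 256 ≤ Λ) (hγ : 0 < γ) (hγ1 : γ ≤ 1) (hρ : 0 < ρ)
    (hϱ : 0 < ϱ) (hϱρ : ϱ / 2 ≤ ρ) (hδ : 0 < δ) (hδΛ : 1 ≤ δ * Λ) (hR1 : 1 ≤ R)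
    (hR : (R : ℝ) ≤ 6 * A * d ^ 2 * L ^ 2 / ρ) (hRΛ : (R : ℝ) ≤ 24 * A * d ^ 2 * Λ ^ 3) :
    ((R * (⌊16 * Real.log (1 / (δ / R / 2)) / γ ^ 2⌋₊ + 2) : ℕ) : ℝ) ≤
      216 * A * (Real.log (48 * A) + 6) * d ^ 3 / γ ^ 2 * L ^ 5 / ϱ := by
  have hR0 : (0 : ℝ) < R := by exact_mod_cast hR1
  have hA48 : 0 ≤ Real.log (48 * A) := Real.log_nonneg (by linarith)
  set G := Real.log (48 * A) + 6 with hG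
  have hdL : 1 ≤ d * L := one_le_mul_of_one_le_of_one_le hd hL1
  have hlog : Real.log (1 / (δ / R / 2)) ≤ G * (d * L) := by
    have h1 : 1 / (δ / R / 2) ≤ 48 * A * (d ^ 2 * Λ ^ 4) := by
      have : 1 / (δ / R / 2) = 2 * R / δ := by field_simp
      rw [this, div_le_iff₀ hδ]
      have h2 : 48 * A * (d ^ 2 * Λ ^ 4) * δ = 2 * (24 * A * d ^ 2 * Λ ^ 3) * (δ * Λ) := by ring
      rw [h2]
      have h3 : (0 : ℝ) ≤ 2 * (24 * A * d ^ 2 * Λ ^ 3) := by positivity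
      nlinarith
    have h2 := Real.log_le_log (by positivity) h1
    rw [Real.log_mul (x := 48 * A) (by positivity) (by positivity),
      Real.log_mul (x := d ^ 2) (by positivity) (by positivity), Real.log_pow, Real.log_pow,
      ← hL] at h2
    have hld := Real.log_le_sub_one_of_pos (by linarith : 0 < d)
    push_cast at h2
    nlinarith [mul_le_mul_of_nonneg_right hdL hA48]
  have hlog0 : 0 ≤ G * (d * L) := by positivity
  have hγ2 : 0 < γ ^ 2 := by positivity
  have hγ21 : γ ^ 2 ≤ 1 := by nlinarith
  have hM : (⌊16 * Real.log (1 / (δ / R / 2)) / γ ^ 2⌋₊ : ℝ) + 2 ≤ 18 * G * (d * L) / γ ^ 2 := by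
    have h1 : (⌊16 * Real.log (1 / (δ / R / 2)) / γ ^ 2⌋₊ : ℝ) ≤ 16 * (G * (d * L)) / γ ^ 2 := by
      refine le_trans (Nat.cast_le.2 (Nat.floor_le_floor ?_)) (Nat.floor_le (by positivity))
      gcongr
    have h2 : 2 ≤ 2 * G * (d * L) / γ ^ 2 := by
      rw [le_div_iff₀ hγ2]
      nlinarith
    have h3 : 18 * G * (d * L) / γ ^ 2 = 16 * (G * (d * L)) / γ ^ 2 + 2 * G * (d * L) / γ ^ 2 := by
      ring
    linarith
  have hρϱ : 1 / ρ ≤ 2 / ϱ := by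
    rw [div_le_div_iff₀ hρ hϱ]
    linarith
  have hL35 : L ^ 3 ≤ L ^ 5 := pow_le_pow_right₀ hL1 (by norm_num)
  push_cast
  calc (R : ℝ) * ((⌊16 * Real.log (1 / (δ / R / 2)) / γ ^ 2⌋₊ : ℝ) + 2)
      ≤ (6 * A * d ^ 2 * L ^ 2 / ρ) * (18 * G * (d * L) / γ ^ 2) :=
        mul_le_mul hR hM (by positivity) (by positivity)
    _ = 108 * A * G * d ^ 3 / γ ^ 2 * L ^ 3 * (1 / ρ) := by ring
    _ ≤ 108 * A * G * d ^ 3 / γ ^ 2 * L ^ 5 * (2 / ϱ) := by gcongr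
    _ = _ := by ring

variable {X : Type*} [MeasurableSpace X] {k : ℕ} (μ : Measure X) [IsProbabilityMeasure μ]

theorem QCAL_le_of_splittable (hk : 1 ≤ k) {B : ℝ} (hB : 1 ≤ B)
    (hBA : 768 * roundConst ((k : ℝ) ^ 2) B ≤ B) {C : Set (X → Fin k)} (hne : C.Nonempty)
    (hC : ∀ h ∈ C, Measurable h) {d : ℕ} (hd1 : 1 ≤ d) (hd : ∀ m, NatarajanShatters C m → m ≤ d)
    {α ε δ τ ϱ : ℝ} (hα0 : 0 ≤ α) (hα : α < 1 / 2) (hε : 0 < ε) (hε1 : ε < 1 / 16) (hδ : 0 < δ)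
    (hδ1 : δ < 1 / 16) (hτ : 0 < τ) (hτ1 : τ ≤ 1) (hϱ : 0 < ϱ) (hϱ1 : ϱ ≤ 1)
    (hs : ∀ g ∈ C, ∀ Δ, ε / 2 ≤ Δ → Splittable μ (ball μ C g (4 * Δ)) (ϱ / 2) Δ τ) :
    ∃ q : ℕ, QCAL ε δ C (BN C α μ) ≤ q ∧
      (q : ℝ) ≤ queryConst ((k : ℝ) ^ 2) B * (d : ℝ) ^ 3 / (1 - 2 * α) ^ 2 *
        Real.log (1 / (ε * δ * τ * (1 - 2 * α))) ^ 5 / ϱ := by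
  set γ := 1 - 2 * α with hγdef
  have hγ : 0 < γ := by linarith
  have hγ1 : γ ≤ 1 := by linarith
  have hK : (1 : ℝ) ≤ (k : ℝ) ^ 2 := one_le_pow₀ (by exact_mod_cast hk)
  set A := roundConst ((k : ℝ) ^ 2) B with hAdef
  have hA : 14 ≤ A := roundConst_ge hK hB
  have hdR : (1 : ℝ) ≤ d := by exact_mod_cast hd1
  set a := ε * δ * τ * γ with ha
  have ha0 : 0 < a := by positivity
  set Λ := 1 / a with hΛdef
  have hΛ0 : 0 < Λ := by positivity
  have haΛ : a * Λ = 1 := mul_one_div_cancel ha0.ne'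
  have hτγ : τ * γ ≤ 1 := mul_le_one₀ hτ1 hγ.le hγ1
  have haδ : a ≤ ε / 16 := by
    have : a = ε * (δ * (τ * γ)) := by rw [ha]; ring
    have h1 := mul_le_mul_of_nonneg_left
      (mul_le_mul hδ1.le hτγ (by positivity) (by norm_num)) hε.le
    linarith
  have haε : a ≤ δ := by
    have : a = δ * (ε * (τ * γ)) := by rw [ha]; ring
    have h1 := mul_le_mul_of_nonneg_left
      (mul_le_mul hε1.le hτγ (by positivity) (by norm_num)) hδ.le
    linarith
  have hΛ : 256 ≤ Λ := by
    rw [hΛdef, le_div_iff₀ ha0]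
    linarith
  have hεΛ : 16 ≤ ε * Λ := by linarith [mul_le_mul_of_nonneg_right haδ hΛ0.le]
  have hδΛ : 1 ≤ δ * Λ := by linarith [mul_le_mul_of_nonneg_right haε hΛ0.le]
  set L := Real.log Λ with hLdef
  have hL1 : 1 ≤ L := by
    rw [hLdef, Real.le_log_iff_exp_le hΛ0]
    linarith [Real.exp_one_lt_d9]
  have hLΛ : L ≤ Λ := (Real.log_le_sub_one_of_pos hΛ0).trans (by linarith)
  -- Three powers of `Λ` dominate the number of rounds and the fourth is `1 / (εδτγ)`.
  set r := 1 / (B * (d : ℝ) ^ 2 * Λ ^ 4) with hrdef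
  have hΛ4 : Λ ≤ Λ ^ 4 := le_self_pow₀ (by linarith) (by norm_num)
  have hd2 : (1 : ℝ) ≤ (d : ℝ) ^ 2 := one_le_pow₀ hdR
  have hBd : 1 ≤ B * (d : ℝ) ^ 2 := one_le_mul_of_one_le_of_one_le hB hd2
  have hBdΛ : Λ ≤ B * (d : ℝ) ^ 2 * Λ ^ 4 :=
    hΛ4.trans (le_mul_of_one_le_left (by positivity) hBd)
  have hr0 : 0 < r := by positivity
  have hrε : r ≤ ε / 2 := by
    rw [hrdef, div_le_iff₀ (by positivity)]
    linarith [mul_le_mul_of_nonneg_left hBdΛ hε.le]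
  obtain ⟨V, hVC, hcover, hV⟩ := exists_finite_cover μ hk hd1 hd hC hr0 (by linarith : r ≤ 1)
  have hVne : V.Nonempty := by
    obtain ⟨h, hh⟩ := hne
    obtain ⟨g, hg, -⟩ := hcover h hh
    exact ⟨g, hg⟩
  have hVpos : (0 : ℝ) < V.card := by exact_mod_cast hVne.card_pos
  set ℓ := A * (d : ℝ) ^ 2 * L with hℓ
  have hVℓ : Real.log V.card ≤ ℓ := hV.trans (log_cover_le hK hB hdR hΛ)
  have hℓ1 : 1 ≤ ℓ := one_le_mul_of_one_le_of_one_le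
    (one_le_mul_of_one_le_of_one_le (by linarith) hd2) hL1
  -- The floor `ε/4` bounds the number of rounds, hence the admissible radius `r`, independently of
  -- `ϱ`. The smaller `τ'` suits both alternatives.
  set ρ := max (ϱ / 2) (ε / 4) with hρdef
  have hρ0 : 0 < ρ := lt_max_of_lt_left (by linarith)
  have hρ1 : ρ ≤ 1 := max_le (by linarith) (by linarith)
  have hρϱ : ϱ / 2 ≤ ρ := le_max_left _ _
  have hρε : ε / 4 ≤ ρ := le_max_right _ _
  set τ' := τ * ε / 4 with hτ'
  have hτ'0 : 0 < τ' := by positivity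
  have hτ'τ : τ' ≤ τ := by
    linarith [mul_le_mul_of_nonneg_left (by linarith : ε ≤ 1) hτ.le]
  have hτ'ε : τ' ≤ ε / 4 := by linarith [mul_le_mul_of_nonneg_right hτ1 hε.le]
  have hs' : ∀ g ∈ C, ∀ Δ, ε / 2 ≤ Δ → Splittable μ (ball μ C g (4 * Δ)) ρ Δ τ' := by
    intro g hg Δ hΔ
    rcases max_choice (ϱ / 2) (ε / 4) with h | h
    · rw [hρdef, h]
      exact (hs g hg Δ hΔ).anti_tau μ hτ'τ
    · rw [hρdef, h]
      exact (splittable_half μ (fun f hf => hC f hf.1) (by positivity) (by linarith)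
        (by linarith)).anti_tau μ hτ'ε
  set J := ⌈L⌉₊ with hJdef
  set T := ⌊2 * ℓ / ρ⌋₊ + 1 with hTdef
  have hJL : (J : ℝ) ≤ 2 * L := by
    have := Nat.ceil_lt_add_one (a := L) (by linarith)
    linarith
  have hJ1 : 1 ≤ J := Nat.one_le_ceil_iff.2 (by linarith)
  have hJ : 1 ≤ ε / 2 * 4 ^ J := by
    have h1 : Λ ≤ 4 ^ J := by
      have h2 : Real.exp 1 ≤ 4 := by linarith [Real.exp_one_lt_d9]
      calc Λ = Real.exp L := (Real.exp_log hΛ0).symm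
        _ ≤ Real.exp (J * 1) := Real.exp_le_exp.2 (by simpa using Nat.le_ceil L)
        _ = Real.exp 1 ^ J := Real.exp_nat_mul _ _
        _ ≤ 4 ^ J := pow_le_pow_left₀ (Real.exp_pos _).le h2 _
    linarith [mul_le_mul_of_nonneg_left h1 hε.le]
  have hTl : 2 * ℓ < ρ * T := by
    have := Nat.lt_floor_add_one (2 * ℓ / ρ)
    rw [div_lt_iff₀ hρ0] at this
    rw [hTdef]
    push_cast
    linarith
  have hT : (V.card : ℝ) ^ 2 < Real.exp (ρ * T) := by
    have : (V.card : ℝ) ^ 2 = Real.exp (2 * Real.log V.card) := by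
      rw [two_mul, Real.exp_add, Real.exp_log hVpos, sq]
    rw [this]
    exact Real.exp_lt_exp.2 (by linarith)
  have hTu : (T : ℝ) ≤ 3 * ℓ / ρ := by
    have h1 := Nat.floor_le (a := 2 * ℓ / ρ) (by positivity)
    have h2 : 1 ≤ ℓ / ρ := by
      rw [le_div_iff₀ hρ0]
      linarith
    have h3 : 3 * ℓ / ρ = 2 * ℓ / ρ + ℓ / ρ := by ring
    rw [hTdef]
    push_cast
    linarith
  set R := J * T with hR
  have hR1 : 1 ≤ R := Nat.one_le_iff_ne_zero.2 (Nat.mul_ne_zero (by omega) (by omega))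
  have hR0 : (0 : ℝ) < R := by exact_mod_cast hR1
  have hRu : (R : ℝ) ≤ 6 * A * (d : ℝ) ^ 2 * L ^ 2 / ρ := by
    rw [hR]
    push_cast
    calc (J : ℝ) * T ≤ (2 * L) * (3 * ℓ / ρ) :=
          mul_le_mul hJL hTu (Nat.cast_nonneg _) (by linarith)
      _ = _ := by
          rw [hℓ]
          ring
  have hRΛ : (R : ℝ) ≤ 24 * A * (d : ℝ) ^ 2 * Λ ^ 3 := by
    refine hRu.trans ?_
    rw [div_le_iff₀ hρ0]
    have h1 : L ^ 2 ≤ Λ ^ 2 := pow_le_pow_left₀ (by linarith) hLΛ 2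
    have h2 : 1 ≤ 4 * (Λ * ρ) := by linarith [mul_le_mul_of_nonneg_left hρε hΛ0.le]
    calc 6 * A * (d : ℝ) ^ 2 * L ^ 2 ≤ 6 * A * (d : ℝ) ^ 2 * Λ ^ 2 * 1 := by
          rw [mul_one]
          gcongr
      _ ≤ 6 * A * (d : ℝ) ^ 2 * Λ ^ 2 * (4 * (Λ * ρ)) := by gcongr
      _ = _ := by ring
  refine ⟨R * (⌊16 * Real.log (1 / (δ / R / 2)) / γ ^ 2⌋₊ + 2), ?_, ?_⟩
  · refine QCAL_le_of_cover μ hC hα0 hα hε.le hVC hVne hrε hcover hτ'0 (by linarith) hs' hJ hT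
      (δ' := δ / R) (by positivity) (pow_vote_le hγ hγ1 (by positivity)) ?_ ?_
    · have h1 : (1 - 2 * α) / 4 * (δ / R / 2 * τ') = a / (32 * R) := by
        rw [hτ', ha, ← hγdef]
        field_simp
        ring
      rw [h1, hrdef, div_le_div_iff₀ (by positivity) (by positivity), one_mul]
      have h2 : a * (B * (d : ℝ) ^ 2 * Λ ^ 4) = B * (d : ℝ) ^ 2 * Λ ^ 3 * (a * Λ) := by ring
      rw [h2, haΛ, mul_one]
      calc 32 * (R : ℝ) ≤ 32 * (24 * A * (d : ℝ) ^ 2 * Λ ^ 3) := by gcongr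
        _ = 768 * A * ((d : ℝ) ^ 2 * Λ ^ 3) := by ring
        _ ≤ B * ((d : ℝ) ^ 2 * Λ ^ 3) := by gcongr
        _ = _ := by ring
    · rw [mul_div_cancel₀ _ hR0.ne']
  · rw [queryConst, ← hAdef]
    exact query_count_le hA hdR hLdef hL1 hΛ hγ hγ1 hρ0 hϱ hρϱ hδ hδΛ hR1 hRu hRΛ

/-- A class of diameter at most `ε/2` needs no labels. Otherwise two distinct classifiers force `d ≥
1` and an index at most `1`; half the index is used because the supremum need not be attained. -/
theorem upper_bound (hk : 1 ≤ k) {B : ℝ} (hB : 1 ≤ B)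
    (hBA : 768 * roundConst ((k : ℝ) ^ 2) B ≤ B) {C : Set (X → Fin k)} (hne : C.Nonempty)
    (hC : ∀ h ∈ C, Measurable h) {d : ℕ} (hd : natarajanDim C = d)
    {α ε δ τ : ℝ} (hα0 : 0 ≤ α) (hα : α < 1 / 2) (hε : 0 < ε) (hε1 : ε < 1 / 16) (hδ : 0 < δ)
    (hδ1 : δ < 1 / 16) (hτ : 0 < τ) (hτ1 : τ ≤ 1) :
    (QCAL ε δ C (BN C α μ) : ℝ≥0∞) ≤
      ENNReal.ofReal (queryConst ((k : ℝ) ^ 2) B * (d : ℝ) ^ 3 / (1 - 2 * α) ^ 2 *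
        Real.log (1 / (ε * δ * τ * (1 - 2 * α))) ^ 5) / splittingIndex μ C τ ε := by
  by_cases hdiam : ∀ h ∈ C, ∀ g ∈ C, μ.real {x | h x ≠ g x} ≤ ε / 2
  · rw [QCAL_eq_zero_of_diam_le μ hC hne hα.le hδ.le
      fun h hh g hg => (hdiam h hh g hg).trans (by linarith)]
    simp
  push Not at hdiam
  obtain ⟨h, hh, g, hg, hfar⟩ := hdiam
  have hdm : ∀ m, NatarajanShatters C m → m ≤ d := by
    intro m hm
    have : (m : ℕ∞) ≤ natarajanDim C := le_iSup₂ (f := fun (m : ℕ) (_ : NatarajanShatters C m) =>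
      (m : ℕ∞)) m hm
    rw [hd] at this
    exact_mod_cast this
  have hd1 : 1 ≤ d := by
    refine hdm 1 ?_
    obtain ⟨x, hx⟩ : ∃ x, h x ≠ g x := by
      by_contra hcon
      push Not at hcon
      simp [hcon] at hfar
      linarith
    refine ⟨fun _ => x, fun _ => h x, fun _ => g x, fun _ => hx, fun s => ?_⟩
    cases hs : s 0
    · exact ⟨g, hg, fun i => by simp [Subsingleton.elim i 0, hs]⟩
    · exact ⟨h, hh, fun i => by simp [Subsingleton.elim i 0, hs]⟩
  have hS1 := splittingIndex_le_one μ hτ hε.le hh hg hfar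
  set S := splittingIndex μ C τ ε with hS
  have hK : (1 : ℝ) ≤ (k : ℝ) ^ 2 := one_le_pow₀ (by exact_mod_cast hk)
  have hγ : 0 < 1 - 2 * α := by linarith
  have hlog : 0 < Real.log (1 / (ε * δ * τ * (1 - 2 * α))) := by
    refine Real.log_pos ?_
    rw [lt_div_iff₀ (by positivity), one_mul]
    have h1 : ε * δ < 1 := by nlinarith
    have h2 : τ * (1 - 2 * α) ≤ 1 := mul_le_one₀ hτ1 hγ.le (by linarith)
    calc ε * δ * τ * (1 - 2 * α) = (ε * δ) * (τ * (1 - 2 * α)) := by ring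
      _ < 1 := by nlinarith [mul_pos hε hδ]
  have hdpos : (0 : ℝ) < d := by exact_mod_cast hd1
  have hN : 0 < queryConst ((k : ℝ) ^ 2) B * (d : ℝ) ^ 3 / (1 - 2 * α) ^ 2 *
        Real.log (1 / (ε * δ * τ * (1 - 2 * α))) ^ 5 := by
    have := queryConst_pos hK hB
    positivity
  rcases eq_or_ne S 0 with hS0 | hS0
  · rw [hS0, ENNReal.div_zero (ENNReal.ofReal_pos.2 hN).ne']
    exact le_top
  have hSt : S ≠ ⊤ := ne_top_of_le_ne_top ENNReal.one_ne_top hS1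
  have hϱ : 0 < S.toReal := ENNReal.toReal_pos hS0 hSt
  have hϱ1 : S.toReal ≤ 1 := by
    simpa using ENNReal.toReal_mono ENNReal.one_ne_top hS1
  obtain ⟨q, hq, hqle⟩ := QCAL_le_of_splittable μ hk hB hBA hne hC hd1 hdm hα0 hα hε hε1 hδ hδ1
    hτ hτ1 hϱ hϱ1 (fun g hg Δ hΔ => by
      have hlt : (((S.toReal / 2).toNNReal : ℝ≥0) : ℝ≥0∞) < S := by
        change ENNReal.ofReal (S.toReal / 2) < S
        rw [ENNReal.ofReal_lt_iff_lt_toReal (by positivity) hSt]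
        linarith
      have := splittable_of_lt_splittingIndex μ hlt hg hΔ
      rwa [Real.coe_toNNReal _ (by positivity)] at this)
  calc (QCAL ε δ C (BN C α μ) : ℝ≥0∞) ≤ ((q : ℕ∞) : ℝ≥0∞) := ENat.toENNReal_le.2 hq
    _ = ENNReal.ofReal q := by simp
    _ ≤ ENNReal.ofReal (queryConst ((k : ℝ) ^ 2) B * (d : ℝ) ^ 3 / (1 - 2 * α) ^ 2 *
        Real.log (1 / (ε * δ * τ * (1 - 2 * α))) ^ 5 / S.toReal) := ENNReal.ofReal_le_ofReal hqle
    _ = _ := by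
        rw [ENNReal.ofReal_div_of_pos hϱ, ENNReal.ofReal_toReal hSt]

end UpperBound

end ActiveLearning

end

/-! ### The two bounds combined -/

theorem mainTheorem7 :
    ∃ c₁ : ℝ, 0 < c₁ ∧ ∀ k : ℕ, ∃ c₂ : ℝ, 0 < c₂ ∧
      ∀ (X : Type*) [MeasurableSpace X] (μ : Measure X) [IsProbabilityMeasure μ]
        (C : Set (X → Fin k)) (d : ℕ) (α ε δ : ℝ),
        C.Nonempty → (∀ h ∈ C, Measurable h) →
        ActiveLearning.natarajanDim C = (d : ℕ∞) →
        0 ≤ α → α < 1 / 2 → 0 < ε → ε < 1 / 16 → 0 < δ → δ < 1 / 16 →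
          (⨅ τ ∈ Set.Ioc (0 : ℝ) 1,
              ENNReal.ofReal c₁ / ActiveLearning.splittingIndex μ C τ (4 * ε))
            ≤ (ActiveLearning.QCAL ε δ C (ActiveLearning.BN C α μ) : ℝ≥0∞) ∧
          (ActiveLearning.QCAL ε δ C (ActiveLearning.BN C α μ) : ℝ≥0∞)
            ≤ ⨅ τ ∈ Set.Ioc (0 : ℝ) 1,
                ENNReal.ofReal (c₂ * (d : ℝ) ^ 3 / (1 - 2 * α) ^ 2 *
                    Real.log (1 / (ε * δ * τ * (1 - 2 * α))) ^ 5)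
                  / ActiveLearning.splittingIndex μ C τ ε := by
  refine ⟨1 / 2, by norm_num, fun k => ?_⟩
  -- Without labels there is no classifier on the nonempty space `X`, so any constant serves.
  rcases Nat.eq_zero_or_pos k with rfl | hk
  · refine ⟨1, one_pos, ?_⟩
    intro X _ μ _ C d α ε δ hne
    obtain ⟨h, -⟩ := hne
    obtain ⟨x⟩ := nonempty_of_isProbabilityMeasure μ
    exact (h x).elim0
  have hK : (1 : ℝ) ≤ (k : ℝ) ^ 2 := one_le_pow₀ (by exact_mod_cast hk)
  obtain ⟨B, hB, hBA⟩ := ActiveLearning.exists_packing_scale hK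
  refine ⟨ActiveLearning.queryConst ((k : ℝ) ^ 2) B, ActiveLearning.queryConst_pos hK hB, ?_⟩
  intro X _ μ _ C d α ε δ hne hC hd hα0 hα hε hε1 hδ hδ1
  exact ⟨ActiveLearning.lower_bound μ hC hα0 hε.le hδ1, le_iInf₂ fun τ hτ =>
    ActiveLearning.upper_bound μ hk hB hBA hne hC hd hα0 hα hε hε1 hδ hδ1 hτ.1 hτ.2⟩
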